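/- **Setting.** Let $M\subset\mathbb R^D$ be a compact $\beta$-smooth submanifold (locally a graph of a $C^\beta$ function) of dimension $d\ge 3$ with $\operatorname{diam}M\le 1$ and positive reach $$\tau=\sup\{\varepsilon:\ \text{every }x\text{ with }\operatorname{dist}(x,M)<\varepsilon\text{ has a unique nearest point in }M\}.$$ For $y\in M$ let $\Phi_y:B_{T_yM}(0,\tau/8)\to M\cap B(y,\tau/4)$ be the inverse of the orthogonal projection $x\mapsto \mathrm{pr}_{T_yM}(x-y)$, and assume $\|\Phi_y\|_{C^\beta(B_{T_yM}(0,\tau/8))}\le L_M$ for all $y\in M$, with $L_M>0$, where $\|f\|_{C^k(U)}=\max_{0\le i\le k}\sup_{x\in U}\|d^if(x)\|_{op}$. Let $\mu$ be a probability measure on $M$ with a density $p$ with respect to the Riemannian volume $\mathrm{Vol}$ of $M$ (the $d$-dimensional Hausdorff measure normalized as Lebesgue measure), such that $\|p\circ\Phi_y\|_{C^\alpha(B_{T_yM}(0,\tau/8))}\le L_\mu$ for all $y\in M$; here $\alpha\ge0$, $\beta$ are integers with $\alpha+1\le\beta$. Let $C_{\log}>\max(d,4)$ be such that $e^{-C_{\log}}<p(y)<e^{C_{\log}}$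 for all $y\in M$, $\log\mathrm{Vol}(M)<e^{C_{\log}}$, and $\min(\tau,L_M^{-1})\ge e^{-C_{\log}}$. Let $X$ solve $dX(t)=-X(t)\,dt+\sqrt2\,dB(t)$, $X(0)\sim\mu$, with $B$ a standard $D$-dimensional Brownian motion independent of $X(0)$. Put $c_t=e^{-t}$, $\sigma_t=\sqrt{1-e^{-2t}}$, $\log_+x=\max(\log x,0)$, and let $s(t,x)=\nabla_x\log\int e^{-\|x-c_ty\|^2/(2\sigma_t^2)}\,\mu(dy)$ be the score. **Lemma 6.1.** Let $t>0$ and $0<\gamma<1/4$, and define $$s_{t+\gamma}(t,x,x')=c_\gamma^{-1}\frac{\sigma_{t+\gamma}^2}{\sigma_t^2}\,s(t+\gamma,x')-\frac{x-c_\gamma^{-1}x'}{\sigma_t^2}.$$ If $$R:=66^2\,\gamma\,\sigma_t^{-4}\Big(20d\big(\log_+(\sigma_{t+\gamma}/c_{t+\gamma})+4C_{\log}\big)+9\log\gamma^{-1}\Big)^3<1,$$ then $\mathbb E\,\|s(t,X(t))-s_{t+\gamma}(t,X(t),X(t+\gamma))\|^2\le R$ (in particular the expectation is finite). -/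

import Mathlib

open MeasureTheory ProbabilityTheory Set
open scoped NNReal ENNReal

noncomputable section

namespace ManifoldDiffusion

/-! ### The forward process and its score -/

/-- `c_t = e^{-t}`. -/
def c (t : ℝ) : ℝ := Real.exp (-t)

/-- `σ_t = √(1 - e^{-2t})`. -/
def σ (t : ℝ) : ℝ := √(1 - Real.exp (-2 * t))

/-- `B` is a standard `D`-dimensional Brownian motion: its coordinates are independent
one-dimensional Brownian motions. -/
structure IsBrownian {Ω : Type*} [MeasurableSpace Ω] {D : ℕ}
    (B : ℝ≥0 → Ω → EuclideanSpace ℝ (Fin D)) (P : Measure Ω) : Prop where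
  measurable : ∀ t, Measurable (B t)
  coord : ∀ i, IsBrownianReal (fun t ω => B t ω i) P
  indep : iIndepFun (fun i ω (t : ℝ≥0) => B t ω i) P

/-- `X` is the Ornstein-Uhlenbeck process `dX(t) = -X(t) dt + √2 dB(t)`, `X(0) ∼ μ`, where `B` is a
standard `D`-dimensional Brownian motion independent of `X(0)`. As the noise is additive, the
stochastic differential equation is the pathwise integral equation
`X(t) = X(0) - ∫₀ᵗ X(s) ds + √2 B(t)`. -/
def IsForwardProcess {Ω : Type*} [MeasurableSpace Ω] {D : ℕ}
    (X : ℝ≥0 → Ω → EuclideanSpace ℝ (Fin D)) (μ : Measure (EuclideanSpace ℝ (Fin D)))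
    (P : Measure Ω) : Prop :=
  (∀ t, Measurable (X t)) ∧ P.map (X 0) = μ ∧
    ∃ B : ℝ≥0 → Ω → EuclideanSpace ℝ (Fin D),
      IsBrownian B P ∧ IndepFun (X 0) (fun ω t => B t ω) P ∧
      ∀ᵐ ω ∂P, Continuous (fun t => X t ω) ∧
        ∀ t : ℝ≥0,
          X t ω = X 0 ω - (∫ s in (0 : ℝ)..(t : ℝ), X s.toNNReal ω) + √2 • B t ω

variable {D : ℕ}

/-- The unnormalized density `p(t, x) = ∫ e^{-‖x - c_t y‖² / (2 σ_t²)} μ(dy)` of `X(t)`. -/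
def marginal (μ : Measure (EuclideanSpace ℝ (Fin D))) (t : ℝ) (x : EuclideanSpace ℝ (Fin D)) : ℝ :=
  ∫ y, Real.exp (-‖x - c t • y‖ ^ 2 / (2 * σ t ^ 2)) ∂μ

/-- The score `s(t, x) = ∇ₓ log p(t, x)`. -/
def score (μ : Measure (EuclideanSpace ℝ (Fin D))) (t : ℝ) (x : EuclideanSpace ℝ (Fin D)) :
    EuclideanSpace ℝ (Fin D) :=
  gradient (fun x' => Real.log (marginal μ t x')) x

/-- The modified one-step proxy
`s_{t+γ}(t, x, x') = c_γ⁻¹ (σ_{t+γ}² / σ_t²) s(t+γ, x') - (x - c_γ⁻¹ x') / σ_t²`. -/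
def scoreProxy (μ : Measure (EuclideanSpace ℝ (Fin D))) (γ t : ℝ)
    (x x' : EuclideanSpace ℝ (Fin D)) : EuclideanSpace ℝ (Fin D) :=
  ((c γ)⁻¹ * (σ (t + γ) ^ 2 / σ t ^ 2)) • score μ (t + γ) x'
    - (σ t ^ 2)⁻¹ • (x - (c γ)⁻¹ • x')

/-! ### Regular manifolds and measures on them -/

/-- `M` is a `β`-smooth `d`-dimensional manifold in `ℝ^D`: near each of its points `y` it is the
graph `z ↦ Φ z = y + L z + N z`, with `N z` orthogonal to the range of `L`, of a `β`-smooth function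
over a neighbourhood of the origin of a linearly and isometrically embedded copy of `ℝ^d`. -/
def IsSmoothManifold (d β : ℕ) (M : Set (EuclideanSpace ℝ (Fin D))) : Prop :=
  ∀ y ∈ M, ∃ (L : EuclideanSpace ℝ (Fin d) →ₗᵢ[ℝ] EuclideanSpace ℝ (Fin D))
    (Φ : EuclideanSpace ℝ (Fin d) → EuclideanSpace ℝ (Fin D))
    (U : Set (EuclideanSpace ℝ (Fin d))) (V : Set (EuclideanSpace ℝ (Fin D))),
    IsOpen U ∧ 0 ∈ U ∧ IsOpen V ∧ ContDiffOn ℝ β Φ U ∧ Φ 0 = y ∧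
    (∀ z ∈ U, ∀ w, inner ℝ (Φ z - y - L z) (L w) = 0) ∧ Φ '' U = M ∩ V

/-- The tangent space `T_y M`, spanned by the limits of rescaled secants of `M` at `y`. -/
def tangentSpace (M : Set (EuclideanSpace ℝ (Fin D))) (y : EuclideanSpace ℝ (Fin D)) :
    Submodule ℝ (EuclideanSpace ℝ (Fin D)) :=
  Submodule.span ℝ (tangentConeAt ℝ M y)

/-- The reach: the supremum of the `ε` such that every point at distance less than `ε` from `M` has
exactly one nearest point on `M`. -/
def reach (M : Set (EuclideanSpace ℝ (Fin D))) : ℝ :=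
  sSup {ε : ℝ | ∀ x, Metric.infDist x M < ε → ∃! y, y ∈ M ∧ Metric.infDist x M = ‖x - y‖}

/-- `Φ`, on the ball of radius `τ/8` around `0` in `T_y M` (`τ` the reach of `M`), is the inverse of
the orthogonal projection `π_y : M ∩ B(y, τ/4) → T_y M`, `x ↦ pr (x - y)`. -/
def IsInverseProjection (M : Set (EuclideanSpace ℝ (Fin D))) (y : EuclideanSpace ℝ (Fin D))
    (Φ : tangentSpace M y → EuclideanSpace ℝ (Fin D)) : Prop :=
  ∀ z ∈ Metric.ball (0 : tangentSpace M y) (reach M / 8),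
    Φ z ∈ M ∩ Metric.ball y (reach M / 4) ∧
      (tangentSpace M y).orthogonalProjectionOnto (Φ z - y) = z

/-- `f` is `k` times continuously differentiable on the open set `U` with
`‖f‖_{C^k(U)} = max_{i ≤ k} sup_{x ∈ U} ‖dⁱ f(x)‖_op ≤ K`. -/
def CkNormLE {E F : Type*} [NormedAddCommGroup E] [NormedSpace ℝ E] [NormedAddCommGroup F]
    [NormedSpace ℝ F] (k : ℕ) (f : E → F) (U : Set E) (K : ℝ) : Prop :=
  ContDiffOn ℝ k f U ∧ ∀ i ≤ k, ∀ x ∈ U, ‖iteratedFDeriv ℝ i f x‖ ≤ K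

/-- The regularity assumption on the manifold `M`, with smoothness constant `LM`. -/
structure RegularManifold (d β : ℕ) (LM : ℝ) (M : Set (EuclideanSpace ℝ (Fin D))) : Prop where
  three_le : 3 ≤ d
  compact : IsCompact M
  smooth : IsSmoothManifold d β M
  reach_pos : 0 < reach M
  LM_pos : 0 < LM
  chart : ∀ y ∈ M, ∃ Φ : tangentSpace M y → EuclideanSpace ℝ (Fin D),
    IsInverseProjection M y Φ ∧ CkNormLE β Φ (Metric.ball 0 (reach M / 8)) LM

/-- The regularity assumption on the measure `μ`: it has an `α`-smooth density `p` with respect to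
the Riemannian volume of `M`, which is the `d`-dimensional Hausdorff measure (normalized to be
Lebesgue measure on `ℝ^d`) restricted to `M`. -/
structure RegularDensity (d α : ℕ) (Lμ : ℝ) (M : Set (EuclideanSpace ℝ (Fin D)))
    (p : EuclideanSpace ℝ (Fin D) → ℝ) (μ : Measure (EuclideanSpace ℝ (Fin D))) : Prop where
  measurable : Measurable p
  density : μ = ((μHE[d]).restrict M).withDensity (fun y => ENNReal.ofReal (p y))
  smooth : ∀ y ∈ M, ∀ Φ : tangentSpace M y → EuclideanSpace ℝ (Fin D),
    IsInverseProjection M y Φ → CkNormLE α (p ∘ Φ) (Metric.ball 0 (reach M / 8)) Lμ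

/-- The complexity bounds that define the constant `C = C_log`. -/
structure LogComplexity (d : ℕ) (LM C : ℝ) (M : Set (EuclideanSpace ℝ (Fin D)))
    (p : EuclideanSpace ℝ (Fin D) → ℝ) : Prop where
  gt : max (d : ℝ) 4 < C
  density : ∀ y ∈ M, Real.exp (-C) < p y ∧ p y < Real.exp C
  vol : Real.log ((μHE[d] : Measure (EuclideanSpace ℝ (Fin D))).real M) < Real.exp C
  reach_LM : Real.exp (-C) ≤ min (reach M) LM⁻¹

/-- The bound `66² γ σ_t⁻⁴ (20 d (log₊(σ_{t+γ} / c_{t+γ}) + 4 C) + 9 log γ⁻¹)³`. -/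
def scoreBound (d : ℕ) (C t γ : ℝ) : ℝ :=
  66 ^ 2 * γ * (σ t ^ 4)⁻¹ *
    (20 * d * (Real.posLog (σ (t + γ) / c (t + γ)) + 4 * C) + 9 * Real.log γ⁻¹) ^ 3

end ManifoldDiffusion

end

/-! By Tweedie's formula the score at time t is c_t/σ_t² times the posterior mean of X(0) given
X(t), minus x/σ_t². The linear terms of the proxy are chosen so that they cancel: the error is
exactly c_t/σ_t² times the difference between the posterior means of X(0) given X(t) and given
X(t+γ) (`score_sub_scoreProxy`).

Put l = 1/(e^{2(t+γ)} - 1) and l + h = 1/(e^{2t} - 1). Then U = l e^{t+γ} X(t+γ) is l X(0) plus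
noise of covariance l, and (l+h) e^t X(t) = U + V, where V is h X(0) plus noise of covariance h; the
two noises and X(0) are independent (`IsForwardProcess.map_noise_eq_prod`). Going back from t+γ to t
therefore reveals one more observation V whose signal-to-noise ratio h is of order γ for fixed t,
and the error measures how far V moves the posterior mean.

Two estimates control this movement. In `lintegral_likelihood_mul_sq_posteriorMean_sub_le`, a prior
with variance V₀ and support of diameter at most 1 has its mean moved by at most h e^{3h/2} V₀² in
mean square: Jensen bounds the normalization from below, the square becomes an integral over two
replicas, the Gaussian integral is explicit, and the first-order term vanishes because the replicas
are centred. In `lintegral_likelihood_mul_sq_variance_le`, the posterior given U has mean squared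
variance of order l^{-2} log²(1/m), where m bounds from below the mass of a ball of radius about
l^{-1/2}: two replicas from one posterior have Gaussian tails at that scale, up to a factor 1/m.
Taking the posterior given U as the prior for V combines them.

Geometry enters only through m, bounded below in `le_measureReal_closedBall`. Orthogonal projection
to the tangent space is 1-Lipschitz, and the chart shows that the image of a small piece of M
contains a ball of the tangent space, whose dimension is at least d. That the chart sends 0 to its
base point follows from Federer's inequality for sets of positive reach (`two_mul_inner_normal_le`).
The choice of radius σ_t and the smallness of R then turn all logarithms into powers of the bracket
in R. -/

namespace ManifoldDiffusion

/-! ### Gaussian tilts and Gaussian measures -/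

section Tilt

variable {E : Type*} [NormedAddCommGroup E] [InnerProductSpace ℝ E]

/-- The Gaussian tilt `exp (⟪u, y⟫ - s ‖y‖² / 2)`: the density at `u` of the Gaussian with
mean `s • y` and covariance `s • 1` relative to the centered one. -/
noncomputable def tilt (s : ℝ) (u y : E) : ℝ := Real.exp (inner ℝ u y - s * ‖y‖ ^ 2 / 2)

lemma tilt_pos (s : ℝ) (u y : E) : 0 < tilt s u y := Real.exp_pos _

lemma continuous_tilt (s : ℝ) : Continuous fun p : E × E ↦ tilt s p.1 p.2 := by
  unfold tilt; fun_prop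

end Tilt

section GaussianMeasure

variable {E : Type*} [NormedAddCommGroup E] [InnerProductSpace ℝ E] [FiniteDimensional ℝ E]
  [MeasurableSpace E] [BorelSpace E]

/-- The normalizing constant of the centered Gaussian with covariance `s • 1`. -/
noncomputable def gaussianNorm (E : Type*) [NormedAddCommGroup E] [InnerProductSpace ℝ E]
    [FiniteDimensional ℝ E] [MeasurableSpace E] [BorelSpace E] (s : ℝ) : ℝ :=
  (Real.pi / (1 / (2 * s))) ^ (Module.finrank ℝ E / 2 : ℝ)

lemma gaussianNorm_pos {s : ℝ} (hs : 0 < s) : 0 < gaussianNorm E s := by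
  unfold gaussianNorm; positivity

/-- The density of the centered Gaussian with covariance `s • 1`. -/
noncomputable def gaussianDensity (s : ℝ) (u : E) : ℝ :=
  (gaussianNorm E s)⁻¹ * Real.exp (-(1 / (2 * s)) * ‖u‖ ^ 2)

lemma gaussianDensity_nonneg {s : ℝ} (hs : 0 < s) (u : E) : 0 ≤ gaussianDensity s u :=
  mul_nonneg (inv_nonneg.2 (gaussianNorm_pos hs).le) (Real.exp_nonneg _)

lemma measurable_gaussianDensity (s : ℝ) : Measurable (gaussianDensity s : E → ℝ) := by
  unfold gaussianDensity; fun_prop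

/-- The centered Gaussian measure with covariance `s • 1`. -/
noncomputable def gaussianMeasure (E : Type*) [NormedAddCommGroup E] [InnerProductSpace ℝ E]
    [FiniteDimensional ℝ E] [MeasurableSpace E] [BorelSpace E] (s : ℝ) : Measure E :=
  volume.withDensity fun u ↦ ENNReal.ofReal (gaussianDensity s u)

lemma integral_gaussianMeasure {F : Type*} [NormedAddCommGroup F] [NormedSpace ℝ F] {s : ℝ}
    (hs : 0 < s) (f : E → F) :
    ∫ u, f u ∂(gaussianMeasure E s) = ∫ u, gaussianDensity s u • f u := by
  rw [gaussianMeasure, integral_withDensity_eq_integral_toReal_smul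
    (measurable_gaussianDensity s).ennreal_ofReal (by simp)]
  simp only [ENNReal.toReal_ofReal (gaussianDensity_nonneg hs _)]

lemma gaussianDensity_smul_cexp {s : ℝ} (c : ℂ) (w u : E) :
    gaussianDensity s u • Complex.exp (c * (inner ℝ w u : ℝ)) = ((gaussianNorm E s)⁻¹ : ℝ) •
      Complex.exp (-((1 / (2 * s) : ℝ) : ℂ) * (‖u‖ : ℂ) ^ 2 + c * (inner ℝ w u : ℝ)) := by
  rw [gaussianDensity, mul_smul, Complex.exp_add]
  congr 1
  rw [Complex.real_smul, Complex.ofReal_exp]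
  push_cast
  rfl

lemma integrable_cexp_gaussianMeasure {s : ℝ} (hs : 0 < s) (c : ℂ) (w : E) :
    Integrable (fun u ↦ Complex.exp (c * (inner ℝ w u : ℝ))) (gaussianMeasure E s) := by
  rw [gaussianMeasure, integrable_withDensity_iff_integrable_smul'
    (measurable_gaussianDensity s).ennreal_ofReal (by simp)]
  simp only [ENNReal.toReal_ofReal (gaussianDensity_nonneg hs _), gaussianDensity_smul_cexp]
  refine Integrable.smul (𝕜 := ℝ) _ (GaussianFourier.integrable_cexp_neg_mul_sq_norm_add ?_ c w)
  rw [Complex.ofReal_re]; positivity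

lemma integral_cexp_gaussianMeasure {s : ℝ} (hs : 0 < s) (c : ℂ) (w : E) :
    ∫ u, Complex.exp (c * (inner ℝ w u : ℝ)) ∂(gaussianMeasure E s) =
      Complex.exp (c ^ 2 * s * ‖w‖ ^ 2 / 2) := by
  rw [integral_gaussianMeasure hs]
  simp only [gaussianDensity_smul_cexp]
  rw [integral_smul, GaussianFourier.integral_cexp_neg_mul_sq_norm_add
    (by rw [Complex.ofReal_re]; positivity)]
  have h : ((Real.pi : ℂ) / ((1 / (2 * s) : ℝ) : ℂ)) ^ ((Module.finrank ℝ E : ℂ) / 2) =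
      (gaussianNorm E s : ℂ) := by
    rw [gaussianNorm, Complex.ofReal_cpow (by positivity)]
    push_cast
    rfl
  rw [h, Complex.real_smul, ← mul_assoc, ← Complex.ofReal_mul,
    inv_mul_cancel₀ (gaussianNorm_pos hs).ne', Complex.ofReal_one, one_mul]
  congr 1
  have : (s : ℂ) ≠ 0 := by exact_mod_cast hs.ne'
  push_cast
  field_simp
  ring

lemma integrable_exp_inner_gaussianMeasure {s : ℝ} (hs : 0 < s) (w : E) :
    Integrable (fun u ↦ Real.exp (inner ℝ w u)) (gaussianMeasure E s) := by
  have := (integrable_cexp_gaussianMeasure hs 1 w).re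
  refine this.congr (Filter.Eventually.of_forall fun u ↦ ?_)
  simp [← Complex.ofReal_exp]

lemma integral_exp_inner_gaussianMeasure {s : ℝ} (hs : 0 < s) (w : E) :
    ∫ u, Real.exp (inner ℝ w u) ∂(gaussianMeasure E s) = Real.exp (s * ‖w‖ ^ 2 / 2) := by
  have := integral_cexp_gaussianMeasure hs 1 w
  have h2 : ∀ u, Complex.exp (1 * (inner ℝ w u : ℝ)) = ((Real.exp (inner ℝ w u) : ℝ) : ℂ) := by
    intro u; simp
  simp only [h2] at this
  rw [integral_complex_ofReal] at this
  apply Complex.ofReal_injective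
  rw [this]
  push_cast
  simp

lemma isProbabilityMeasure_gaussianMeasure {s : ℝ} (hs : 0 < s) :
    IsProbabilityMeasure (gaussianMeasure E s) := by
  have h := integral_exp_inner_gaussianMeasure hs (0 : E)
  have hi := integrable_exp_inner_gaussianMeasure hs (0 : E)
  simp only [inner_zero_left, Real.exp_zero, norm_zero] at h hi
  have : IsFiniteMeasure (gaussianMeasure E s) := by
    simpa using (integrable_const_iff (μ := gaussianMeasure E s) (c := (1 : ℝ))).1 hi
  rw [integral_const] at h
  refine ⟨?_⟩
  have h3 : (gaussianMeasure E s).real univ = 1 := by simpa using h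
  rwa [Measure.real, ENNReal.toReal_eq_one_iff] at h3

lemma charFun_gaussianMeasure {s : ℝ} (hs : 0 < s) (w : E) :
    ∫ u, Complex.exp ((inner ℝ w u : ℝ) * Complex.I) ∂(gaussianMeasure E s) =
      Complex.exp (-(s * ‖w‖ ^ 2 / 2 : ℝ)) := by
  have := integral_cexp_gaussianMeasure hs Complex.I w
  simp only [mul_comm Complex.I] at this
  rw [this]
  congr 1
  push_cast
  rw [Complex.I_sq]
  ring

/-- Cameron–Martin: translation invariance of Lebesgue measure and completing the square. It turns
averages over an observation into likelihood-weighted averages over pure noise. -/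
lemma lintegral_gaussianMeasure_add_smul {s : ℝ} (hs : 0 < s) (y : E) {f : E → ℝ≥0∞}
    (hf : Measurable f) :
    ∫⁻ u, f (s • y + u) ∂(gaussianMeasure E s) =
      ∫⁻ u, ENNReal.ofReal (tilt s u y) * f u ∂(gaussianMeasure E s) := by
  have hm := (measurable_gaussianDensity (E := E) s).ennreal_ofReal
  have ht : Measurable fun u : E ↦ ENNReal.ofReal (tilt s u y) := by
    unfold tilt; fun_prop
  rw [gaussianMeasure, lintegral_withDensity_eq_lintegral_mul _ hm (by fun_prop),
    lintegral_withDensity_eq_lintegral_mul _ hm (by fun_prop)]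
  refine Eq.trans (lintegral_congr fun u ↦ ?_) (lintegral_add_left_eq_self
    (fun u ↦ ENNReal.ofReal (gaussianDensity s u) * (ENNReal.ofReal (tilt s u y) * f u)) (s • y))
  simp only [Pi.mul_apply]
  rw [← mul_assoc, ← ENNReal.ofReal_mul (gaussianDensity_nonneg hs _)]
  congr 2
  rw [gaussianDensity, gaussianDensity, tilt, mul_assoc, ← Real.exp_add]
  congr 2
  rw [norm_add_sq_real, inner_add_left, inner_smul_left, inner_smul_left, norm_smul,
    real_inner_self_eq_norm_sq, real_inner_comm y u, Real.norm_of_nonneg hs.le]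
  simp only [conj_trivial]
  field_simp
  ring

end GaussianMeasure

/-! ### Integrability for compactly supported measures -/

section CompactSupport

lemma integrable_of_continuous_of_ae_mem {X F : Type*} [TopologicalSpace X] [MeasurableSpace X]
    [OpensMeasurableSpace X] [NormedAddCommGroup F] [SecondCountableTopologyEither X F]
    {κ : Measure X} [IsFiniteMeasure κ] {K : Set X} (hK : IsCompact K) (hκ : ∀ᵐ x ∂κ, x ∈ K)
    {f : X → F} (hf : Continuous f) : Integrable f κ := by
  obtain ⟨c, hc⟩ := hK.exists_bound_of_continuousOn hf.continuousOn
  exact Integrable.of_bound hf.aestronglyMeasurable c (hκ.mono fun x hx ↦ hc x hx)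

lemma ae_prod_mem {X : Type*} [MeasurableSpace X] {κ : Measure X} [SFinite κ] {K : Set X}
    (hκ : ∀ᵐ x ∂κ, x ∈ K) : ∀ᵐ p ∂(κ.prod κ), p ∈ K ×ˢ K := by
  have h1 : ∀ᵐ p ∂(κ.prod κ), p.1 ∈ K := Measure.quasiMeasurePreserving_fst.ae hκ
  have h2 : ∀ᵐ p ∂(κ.prod κ), p.2 ∈ K := Measure.quasiMeasurePreserving_snd.ae hκ
  filter_upwards [h1, h2] with p hp1 hp2 using ⟨hp1, hp2⟩

end CompactSupport

/-! ### Displacement of the posterior mean by one weak observation -/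

section Posterior

variable {E : Type*} [NormedAddCommGroup E] [InnerProductSpace ℝ E] [MeasurableSpace E]

/-- The likelihood `∫ exp (⟪u, y⟫ - s ‖y‖² / 2) κ(dy)` of the observation `u` of `s • y` under
Gaussian noise of covariance `s • 1`, when `y ∼ κ`. -/
noncomputable def likelihood (κ : Measure E) (s : ℝ) (u : E) : ℝ := ∫ y, tilt s u y ∂κ

/-- The posterior mean of `y ∼ κ` given the observation `u` of `s • y` under Gaussian noise of
covariance `s • 1`. -/
noncomputable def posteriorMean (κ : Measure E) (s : ℝ) (u : E) : E :=
  (likelihood κ s u)⁻¹ • ∫ y, tilt s u y • y ∂κ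

variable [FiniteDimensional ℝ E] [BorelSpace E] {κ : Measure E} {K : Set E}

omit [FiniteDimensional ℝ E] in
lemma likelihood_pos [IsFiniteMeasure κ] [NeZero κ] (hK : IsCompact K) (hκ : ∀ᵐ y ∂κ, y ∈ K)
    (s : ℝ) (u : E) : 0 < likelihood κ s u := by
  have hi : Integrable (fun y ↦ tilt s u y) κ :=
    integrable_of_continuous_of_ae_mem hK hκ (by unfold tilt; fun_prop)
  rw [likelihood, integral_pos_iff_support_of_nonneg (fun y ↦ (tilt_pos s u y).le) hi]
  have : Function.support (fun y ↦ tilt s u y) = univ := by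
    ext y; simp [(tilt_pos s u y).ne']
  rw [this]
  exact Measure.measure_univ_pos.2 (NeZero.ne κ)

/-- Jensen's lower bound for the likelihood. -/
lemma exp_le_likelihood [IsProbabilityMeasure κ] (hK : IsCompact K) (hκ : ∀ᵐ y ∂κ, y ∈ K)
    (s : ℝ) (u : E) :
    Real.exp (inner ℝ u (∫ y, y ∂κ) - s * (∫ y, ‖y‖ ^ 2 ∂κ) / 2) ≤ likelihood κ s u := by
  have h1 : Integrable (fun y ↦ (inner ℝ u y : ℝ) - s * ‖y‖ ^ 2 / 2) κ :=
    integrable_of_continuous_of_ae_mem hK hκ (by fun_prop)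
  have h2 : Integrable (Real.exp ∘ fun y ↦ (inner ℝ u y : ℝ) - s * ‖y‖ ^ 2 / 2) κ :=
    integrable_of_continuous_of_ae_mem hK hκ (by fun_prop)
  have hid : Integrable (fun y : E ↦ y) κ :=
    integrable_of_continuous_of_ae_mem hK hκ continuous_id
  have hsq : Integrable (fun y : E ↦ s * ‖y‖ ^ 2 / 2) κ :=
    integrable_of_continuous_of_ae_mem hK hκ (by fun_prop)
  have := convexOn_exp.map_integral_le Real.continuous_exp.continuousOn isClosed_univ
    (Filter.Eventually.of_forall fun _ ↦ mem_univ _) h1 h2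
  rw [integral_sub (hid.const_inner u) hsq, integral_inner hid, integral_div,
    integral_const_mul] at this
  exact this

/-- The replica identity: the square of an integral is an integral over two independent copies. It
linearizes squared posterior moments so that the Gaussian variable can be integrated first. -/
lemma integral_inner_prod {f : E → E} [IsFiniteMeasure κ] (hK : IsCompact K)
    (hκ : ∀ᵐ y ∂κ, y ∈ K) (hf : Continuous f) :
    ∫ p, inner ℝ (f p.1) (f p.2) ∂(κ.prod κ) = ‖∫ y, f y ∂κ‖ ^ 2 := by
  have hi : Integrable f κ := integrable_of_continuous_of_ae_mem hK hκ hf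
  rw [integral_prod _ (integrable_of_continuous_of_ae_mem (hK.prod hK) (ae_prod_mem hκ)
    (by fun_prop))]
  simp only [integral_inner hi]
  have h : ∀ x, inner ℝ (f x) (∫ y, f y ∂κ) = inner ℝ (∫ y, f y ∂κ) (f x) :=
    fun x ↦ real_inner_comm _ _
  simp only [h]
  rw [integral_inner hi, real_inner_self_eq_norm_sq]

/-- The linear term is kept exactly because it integrates to zero in the application, leaving an
error of order h x². -/
lemma mul_exp_mul_le {x h : ℝ} (hx : |x| ≤ 1) (hh : 0 ≤ h) :
    x * Real.exp (h * x) ≤ x + h * Real.exp h * x ^ 2 := by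
  obtain ⟨hx1, hx2⟩ := abs_le.1 hx
  have h1 : 1 ≤ Real.exp h := Real.one_le_exp hh
  rcases le_or_gt 0 x with h0 | h0
  · have h2 : Real.exp (h * x) - 1 ≤ h * x * Real.exp (h * x) := by
      have h3 := Real.add_one_le_exp (-(h * x))
      have h4 : Real.exp (-(h * x)) * Real.exp (h * x) = 1 := by rw [← Real.exp_add]; simp
      nlinarith [Real.exp_pos (h * x)]
    have h3 : Real.exp (h * x) ≤ Real.exp h := Real.exp_le_exp.2 (by nlinarith)
    have h4 : h * x * Real.exp (h * x) ≤ h * x * Real.exp h := by gcongr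
    nlinarith [mul_le_mul_of_nonneg_left (h2.trans h4) h0]
  · have h2 := Real.add_one_le_exp (h * x)
    have h3 : h * x ^ 2 * 1 ≤ h * x ^ 2 * Real.exp h := by gcongr
    nlinarith [mul_le_mul_of_nonpos_left h2 h0.le]

/-- A further observation with small signal-to-noise ratio `h` moves the posterior mean by little:
the mean squared displacement is of order `h` times the squared variance of the prior. -/
lemma lintegral_likelihood_mul_sq_posteriorMean_sub_le [IsProbabilityMeasure κ]
    (hK : IsCompact K) (hκ : ∀ᵐ y ∂κ, y ∈ K)
    (hdiam : ∀ x ∈ K, ∀ y ∈ K, ‖x - y‖ ≤ 1) {h : ℝ} (hh : 0 < h) :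
    ∫⁻ v, ENNReal.ofReal (likelihood κ h v * ‖posteriorMean κ h v - ∫ y, y ∂κ‖ ^ 2)
        ∂(gaussianMeasure E h) ≤
      ENNReal.ofReal (h * Real.exp (3 * h / 2) * (∫ y, ‖y - ∫ z, z ∂κ‖ ^ 2 ∂κ) ^ 2) := by
  have : IsProbabilityMeasure (gaussianMeasure E h) := isProbabilityMeasure_gaussianMeasure hh
  obtain ⟨m, hm⟩ : ∃ m, m = ∫ y, y ∂κ := ⟨_, rfl⟩
  obtain ⟨Q, hQ⟩ : ∃ Q, Q = ∫ y, ‖y‖ ^ 2 ∂κ := ⟨_, rfl⟩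
  obtain ⟨V, hV⟩ : ∃ V, V = ∫ y, ‖y - m‖ ^ 2 ∂κ := ⟨_, rfl⟩
  rw [← hm, ← hV]
  have hid : Integrable (fun y : E ↦ y) κ :=
    integrable_of_continuous_of_ae_mem hK hκ continuous_id
  have hKK := hK.prod hK
  have hκκ := ae_prod_mem hκ
  have hdist : ∀ᵐ y ∂κ, ‖y - m‖ ≤ 1 := by
    filter_upwards [hκ] with y hy
    have h1 : y - m = ∫ z, (y - z) ∂κ := by
      rw [integral_sub (integrable_const _) hid]; simp [hm]
    rw [h1]
    have := norm_integral_le_of_norm_le_const (μ := κ) (f := fun z ↦ y - z) (C := 1)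
      (hκ.mono fun z hz ↦ hdiam y hy z hz)
    simpa using this
  have hV1 : V ≤ 1 := by
    have : V ≤ ∫ _, (1 : ℝ) ∂κ := by
      rw [hV]
      refine integral_mono_ae
        (integrable_of_continuous_of_ae_mem hK hκ (by fun_prop)) (integrable_const _) ?_
      filter_upwards [hdist] with y hy
      exact pow_le_one₀ (norm_nonneg _) hy
    simpa using this
  have hQV : Q = V + ‖m‖ ^ 2 := by
    have h1 : ∀ y, ‖y‖ ^ 2 = ‖y - m‖ ^ 2 + 2 * inner ℝ m y - ‖m‖ ^ 2 := by
      intro y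
      rw [norm_sub_sq_real, real_inner_comm]; ring
    rw [hQ, funext h1, integral_sub, integral_add, integral_const_mul, integral_inner hid, ← hm,
      real_inner_self_eq_norm_sq, integral_const, probReal_univ, one_smul, ← hV]
    · ring
    all_goals exact integrable_of_continuous_of_ae_mem hK hκ (by fun_prop)
  obtain ⟨x, hx⟩ : ∃ x : E × E → ℝ, x = fun p ↦ inner ℝ (p.1 - m) (p.2 - m) := ⟨_, rfl⟩
  have hxc : Continuous x := by rw [hx]; fun_prop
  -- `c` gathers the factors that do not involve the observation v; in `F` only exp of a linear form
  -- in v remains, so its Gaussian integral is explicit.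
  obtain ⟨c, hc⟩ : ∃ c : E × E → ℝ, c = fun p ↦
    Real.exp (h * (Q - ‖p.1‖ ^ 2 - ‖p.2‖ ^ 2) / 2) * x p := ⟨_, rfl⟩
  have hcc : Continuous c := by rw [hc]; fun_prop
  obtain ⟨F, hF⟩ : ∃ F : E × (E × E) → ℝ, F = fun q ↦
    Real.exp (inner ℝ (q.2.1 + q.2.2 - m) q.1) * c q.2 := ⟨_, rfl⟩
  have hFc : Continuous F := by rw [hF]; fun_prop
  have hFi : Integrable F ((gaussianMeasure E h).prod (κ.prod κ)) := by
    rw [integrable_prod_iff' hFc.aestronglyMeasurable]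
    refine ⟨Filter.Eventually.of_forall fun p ↦ ?_, ?_⟩
    · simp only [hF]
      exact (integrable_exp_inner_gaussianMeasure hh (p.1 + p.2 - m)).mul_const (c p)
    have : (fun p : E × E ↦ ∫ v, ‖F (v, p)‖ ∂(gaussianMeasure E h)) =
        fun p ↦ Real.exp (h * ‖p.1 + p.2 - m‖ ^ 2 / 2) * ‖c p‖ := by
      ext p
      simp only [hF, norm_mul, Real.norm_of_nonneg (Real.exp_nonneg _)]
      rw [integral_mul_const, integral_exp_inner_gaussianMeasure hh]
    rw [this]
    exact integrable_of_continuous_of_ae_mem hKK hκκ (by fun_prop)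
  obtain ⟨G, hGF⟩ : ∃ G : E → ℝ, G = fun v ↦ ∫ p, F (v, p) ∂(κ.prod κ) := ⟨_, rfl⟩
  have hGi : Integrable G (gaussianMeasure E h) := by rw [hGF]; exact hFi.integral_prod_left
  have hG : ∀ v, G v = ‖∫ y, tilt h v y • (y - m) ∂κ‖ ^ 2 *
      Real.exp (-(inner ℝ v m - h * Q / 2)) := by
    intro v
    rw [hGF, ← integral_inner_prod hK hκ (by unfold tilt; fun_prop), ← integral_mul_const]
    refine integral_congr_ae (Filter.Eventually.of_forall fun p ↦ ?_)
    simp only [hF, hc, hx, tilt, inner_smul_left, inner_smul_right, conj_trivial]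
    rw [← mul_assoc, ← mul_assoc, ← Real.exp_add, ← Real.exp_add, mul_right_comm, ← Real.exp_add]
    congr 2
    rw [inner_sub_left, inner_add_left, real_inner_comm v p.1, real_inner_comm v p.2,
      real_inner_comm v m]
    ring
  have hle : ∀ v, likelihood κ h v * ‖posteriorMean κ h v - m‖ ^ 2 ≤ G v := by
    intro v
    have hZ := likelihood_pos hK hκ h v
    have hJ := exp_le_likelihood hK hκ h v
    have hn : ∫ y, tilt h v y • (y - m) ∂κ =
        likelihood κ h v • (posteriorMean κ h v - m) := by
      simp only [smul_sub]
      rw [integral_sub, integral_smul_const, posteriorMean, smul_inv_smul₀ hZ.ne']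
      · rfl
      all_goals exact integrable_of_continuous_of_ae_mem hK hκ (by unfold tilt; fun_prop)
    rw [hG, hn, norm_smul, mul_pow, Real.norm_of_nonneg hZ.le, Real.exp_neg]
    rw [← hm, ← hQ] at hJ
    -- The left side of the claim is the squared norm of the tilted centred moment over the
    -- likelihood; Jensen replaces this denominator by an exponential of an affine function of v.
    have h1 : 1 ≤ likelihood κ h v * (Real.exp (inner ℝ v m - h * Q / 2))⁻¹ := by
      rw [← div_eq_mul_inv, one_le_div (Real.exp_pos _)]
      exact hJ
    have h2 : 0 ≤ likelihood κ h v * ‖posteriorMean κ h v - m‖ ^ 2 := by positivity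
    nlinarith [mul_le_mul_of_nonneg_left h1 h2]
  have hG0 : ∀ v, 0 ≤ G v := fun v ↦ by rw [hG]; positivity
  have hGint : ∫ v, G v ∂(gaussianMeasure E h) ≤ h * Real.exp (3 * h / 2) * V ^ 2 := by
    have h1 : ∫ v, G v ∂(gaussianMeasure E h) =
        ∫ p, Real.exp (h * V / 2) * (x p * Real.exp (h * x p)) ∂(κ.prod κ) := by
      simp only [hGF]
      rw [integral_integral_swap (f := fun v p ↦ F (v, p)) hFi]
      refine integral_congr_ae (Filter.Eventually.of_forall fun p ↦ ?_)
      simp only [hF]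
      rw [integral_mul_const, integral_exp_inner_gaussianMeasure hh]
      simp only [hc]
      rw [mul_comm (x p) (Real.exp _), ← mul_assoc, ← mul_assoc, ← Real.exp_add, ← Real.exp_add]
      congr 2
      -- Expanding around the mean, ‖y + y' - m‖² + Q - ‖y‖² - ‖y'‖² collapses to V + 2 x, so the
      -- total exponent is h V / 2 + h x.
      have h2 : p.1 + p.2 - m = m + ((p.1 - m) + (p.2 - m)) := by abel
      have h3 : ‖p.1‖ ^ 2 = ‖m + (p.1 - m)‖ ^ 2 := by congr 2; abel
      have h4 : ‖p.2‖ ^ 2 = ‖m + (p.2 - m)‖ ^ 2 := by congr 2; abel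
      rw [h2, h3, h4, hQV, norm_add_sq_real m, norm_add_sq_real m (p.1 - m),
        norm_add_sq_real m (p.2 - m), norm_add_sq_real (p.1 - m), inner_add_right]
      simp only [hx]
      ring
    have hx1 : ∀ᵐ p ∂(κ.prod κ), |x p| ≤ ‖p.1 - m‖ * ‖p.2 - m‖ :=
      Filter.Eventually.of_forall fun p ↦ by
        rw [hx]; exact abs_real_inner_le_norm _ _
    have hd2 : ∀ᵐ p ∂(κ.prod κ), ‖p.1 - m‖ ≤ 1 ∧ ‖p.2 - m‖ ≤ 1 := ae_prod_mem hdist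
    -- The cancellation that makes the bound linear in h: the two copies are independent and
    -- centred.
    have hx0 : ∫ p, x p ∂(κ.prod κ) = 0 := by
      simp only [hx]
      rw [integral_inner_prod hK hκ (f := fun y ↦ y - m) (by fun_prop),
        integral_sub hid (integrable_const _)]
      simp [hm]
    have hx2 : ∫ p, (x p) ^ 2 ∂(κ.prod κ) ≤ V ^ 2 := by
      rw [sq V, hV, ← integral_prod_mul]
      refine integral_mono_ae (integrable_of_continuous_of_ae_mem hKK hκκ (by fun_prop))
        (integrable_of_continuous_of_ae_mem hKK hκκ (by fun_prop)) ?_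
      filter_upwards [hx1] with p hp
      rw [← sq_abs, ← mul_pow]
      gcongr
    rw [h1, integral_const_mul]
    have h5 : ∫ p, x p * Real.exp (h * x p) ∂(κ.prod κ) ≤
        ∫ p, (x p + h * Real.exp h * x p ^ 2) ∂(κ.prod κ) := by
      refine integral_mono_ae (integrable_of_continuous_of_ae_mem hKK hκκ (by fun_prop))
        (integrable_of_continuous_of_ae_mem hKK hκκ (by fun_prop)) ?_
      filter_upwards [hx1, hd2] with p hp hp2
      exact mul_exp_mul_le (hp.trans (mul_le_one₀ hp2.1 (norm_nonneg _) hp2.2)) hh.le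
    rw [integral_add, hx0, zero_add, integral_const_mul] at h5
    · have h6 : Real.exp (h * V / 2) ≤ Real.exp (h / 2) := Real.exp_le_exp.2 (by nlinarith)
      have h7 : Real.exp (h / 2) * Real.exp h = Real.exp (3 * h / 2) := by
        rw [← Real.exp_add]; congr 1; ring
      calc Real.exp (h * V / 2) * ∫ p, x p * Real.exp (h * x p) ∂(κ.prod κ)
          ≤ Real.exp (h * V / 2) * (h * Real.exp h * V ^ 2) := by
            gcongr
            exact h5.trans (by gcongr)
        _ ≤ Real.exp (h / 2) * (h * Real.exp h * V ^ 2) := by gcongr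
        _ = h * Real.exp (3 * h / 2) * V ^ 2 := by rw [← h7]; ring
    all_goals exact integrable_of_continuous_of_ae_mem hKK hκκ (by fun_prop)
  calc _ ≤ ∫⁻ v, ENNReal.ofReal (G v) ∂(gaussianMeasure E h) :=
        lintegral_mono fun v ↦ ENNReal.ofReal_le_ofReal (hle v)
    _ = ENNReal.ofReal (∫ v, G v ∂(gaussianMeasure E h)) :=
        (ofReal_integral_eq_lintegral_ofReal hGi (Filter.Eventually.of_forall hG0)).symm
    _ ≤ _ := ENNReal.ofReal_le_ofReal hGint

end Posterior

/-! ### Concentration of two draws from the same posterior -/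

section Replica

variable {E : Type*} [NormedAddCommGroup E] [InnerProductSpace ℝ E] [MeasurableSpace E]
  [FiniteDimensional ℝ E] [BorelSpace E] {κ : Measure E} {K : Set E}

/-- A lower bound for the likelihood in terms of the mass that the prior gives to a ball. -/
lemma exists_mul_exp_le_likelihood [IsProbabilityMeasure κ] (hK : IsCompact K)
    (hκ : ∀ᵐ y ∂κ, y ∈ K) {s ε m : ℝ} (hs : 0 ≤ s) (hm : 0 < m) (y : E)
    (hy : m ≤ κ.real (Metric.closedBall y ε)) :
    ∃ e : E, ‖e‖ ≤ ε ∧ ∀ u, m * Real.exp (inner ℝ u (y + e) -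
      s * (‖y‖ ^ 2 + 2 * inner ℝ y e + ε ^ 2) / 2) ≤ likelihood κ s u := by
  set B := Metric.closedBall y ε with hB
  have hBpos : 0 < κ.real B := hm.trans_le hy
  have hBne : κ B ≠ 0 := by
    intro h
    simp [Measure.real, h] at hBpos
  -- Jensen is applied to κ conditioned on the ball, which costs only the factor κ(B); `e` is the
  -- offset of the conditional barycentre from the centre y.
  have hprob : IsProbabilityMeasure (κ[|B]) := cond_isProbabilityMeasure hBne
  have hBm : MeasurableSet B := Metric.isClosed_closedBall.measurableSet
  have hcB : ∀ᵐ w ∂(κ[|B]), w ∈ B := ae_cond_mem hBm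
  have hcK : ∀ᵐ w ∂(κ[|B]), w ∈ K := cond_absolutelyContinuous.ae_le hκ
  have hid : Integrable (fun w : E ↦ w) (κ[|B]) :=
    integrable_of_continuous_of_ae_mem hK hcK continuous_id
  set e := (∫ w, w ∂(κ[|B])) - y with he
  have hmean : ∫ w, w ∂(κ[|B]) = y + e := by rw [he]; abel
  have hnorm : ‖e‖ ≤ ε := by
    have h1 : e = ∫ w, (w - y) ∂(κ[|B]) := by
      rw [integral_sub hid (integrable_const _)]; simp [he]
    rw [h1]
    have := norm_integral_le_of_norm_le_const (μ := κ[|B]) (f := fun w ↦ w - y) (C := ε)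
      (hcB.mono fun w hw ↦ by rwa [hB, mem_closedBall_iff_norm] at hw)
    simpa using this
  have hε : 0 ≤ ε := (norm_nonneg _).trans hnorm
  have hsq : ∫ w, ‖w‖ ^ 2 ∂(κ[|B]) ≤ ‖y‖ ^ 2 + 2 * inner ℝ y e + ε ^ 2 := by
    have h1 : ∫ w, ‖w‖ ^ 2 ∂(κ[|B]) ≤ ∫ w, (ε ^ 2 + 2 * inner ℝ y w - ‖y‖ ^ 2) ∂(κ[|B]) := by
      refine integral_mono_ae (integrable_of_continuous_of_ae_mem hK hcK (by fun_prop))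
        (integrable_of_continuous_of_ae_mem hK hcK (by fun_prop)) ?_
      filter_upwards [hcB] with w hw
      rw [hB, mem_closedBall_iff_norm] at hw
      have h2 : ‖w - y‖ ^ 2 ≤ ε ^ 2 := by gcongr
      rw [norm_sub_sq_real, real_inner_comm] at h2
      linarith
    have h3 : Integrable (fun w : E ↦ 2 * (inner ℝ y w : ℝ)) (κ[|B]) :=
      integrable_of_continuous_of_ae_mem hK hcK (by fun_prop)
    have h4 : Integrable (fun w : E ↦ ε ^ 2 + 2 * (inner ℝ y w : ℝ)) (κ[|B]) :=
      integrable_of_continuous_of_ae_mem hK hcK (by fun_prop)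
    rw [integral_sub h4 (integrable_const _), integral_add (integrable_const _) h3,
      integral_const_mul, integral_inner hid, hmean, inner_add_right, real_inner_self_eq_norm_sq] at h1
    simp only [integral_const, probReal_univ, one_smul] at h1
    linarith
  refine ⟨e, hnorm, fun u ↦ ?_⟩
  have hi : Integrable (fun w ↦ tilt s u w) κ :=
    integrable_of_continuous_of_ae_mem hK hκ (by unfold tilt; fun_prop)
  have hJ := exp_le_likelihood hK hcK s u
  have hL : κ.real B * likelihood (κ[|B]) s u ≤ likelihood κ s u := by
    rw [likelihood, ProbabilityTheory.cond, integral_smul_measure, ENNReal.toReal_inv]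
    change κ.real B * ((κ.real B)⁻¹ • _) ≤ _
    rw [smul_eq_mul, mul_inv_cancel_left₀ hBpos.ne']
    exact setIntegral_le_integral hi (Filter.Eventually.of_forall fun w ↦ (tilt_pos s u w).le)
  refine le_trans ?_ hL
  gcongr
  refine le_trans ?_ hJ
  rw [hmean]
  gcongr

/-- Two points drawn from the same posterior are close to each other. -/
lemma lintegral_tilt_mul_tilt_div_likelihood_le [IsProbabilityMeasure κ] (hK : IsCompact K)
    (hκ : ∀ᵐ y ∂κ, y ∈ K) {s ε m : ℝ} (hs : 0 < s) (hm : 0 < m) {y y' : E}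
    (hy : m ≤ κ.real (Metric.closedBall y ε)) (hy' : m ≤ κ.real (Metric.closedBall y' ε)) :
    ∫⁻ u, ENNReal.ofReal (tilt s u y * tilt s u y' / likelihood κ s u) ∂(gaussianMeasure E s) ≤
      ENNReal.ofReal (m⁻¹ * Real.exp (2 * s * ε ^ 2) * Real.exp (-(s * ‖y - y'‖ ^ 2 / 16))) := by
  obtain ⟨e, he, hle⟩ := exists_mul_exp_le_likelihood hK hκ hs.le hm y hy
  obtain ⟨e', he', hle'⟩ := exists_mul_exp_le_likelihood hK hκ hs.le hm y' hy'
  have hε : 0 ≤ ε := (norm_nonneg _).trans he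
  obtain ⟨w, hw⟩ : ∃ w : E, w = (1 / 2 : ℝ) • (y + y' - (e + e')) := ⟨_, rfl⟩
  obtain ⟨c, hc⟩ : ∃ c, c = s * (‖y‖ ^ 2 + 2 * inner ℝ y e + ε ^ 2) / 2 / 2 +
    s * (‖y'‖ ^ 2 + 2 * inner ℝ y' e' + ε ^ 2) / 2 / 2 - s * ‖y‖ ^ 2 / 2 - s * ‖y'‖ ^ 2 / 2 :=
    ⟨_, rfl⟩
  have hpt : ∀ u, tilt s u y * tilt s u y' / likelihood κ s u ≤
      (m⁻¹ * Real.exp c) * Real.exp (inner ℝ w u) := by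
    intro u
    have h1 := hle u
    have h2 := hle' u
    set A := inner ℝ u (y + e) - s * (‖y‖ ^ 2 + 2 * inner ℝ y e + ε ^ 2) / 2 with hA
    set A' := inner ℝ u (y' + e') - s * (‖y'‖ ^ 2 + 2 * inner ℝ y' e' + ε ^ 2) / 2 with hA'
    -- Both lower bounds hold, hence so does their geometric mean. Dividing by it leaves an exponent
    -- linear in u with slope `w`, about (y + y')/2, whose Gaussian integral decays in ‖y - y'‖.
    have h3 : m * Real.exp (A / 2 + A' / 2) ≤ likelihood κ s u := by
      rcases le_total A A' with h | h
      · exact le_trans (by gcongr; linarith) h2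
      · exact le_trans (by gcongr; linarith) h1
    have hZ : 0 < likelihood κ s u := lt_of_lt_of_le (by positivity) h3
    rw [div_le_iff₀ hZ]
    refine le_trans ?_ (mul_le_mul_of_nonneg_left h3 (by positivity))
    refine le_of_eq ?_
    have h4 : ∀ a b : ℝ, m⁻¹ * a * b * (m * Real.exp (A / 2 + A' / 2)) =
        a * b * Real.exp (A / 2 + A' / 2) := by
      intro a b; field_simp
    rw [h4, tilt, tilt, ← Real.exp_add, ← Real.exp_add, ← Real.exp_add]
    congr 1
    rw [hc, hw, hA, hA', inner_smul_left, inner_sub_left, inner_add_left, inner_add_left,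
      inner_add_right, inner_add_right, real_inner_comm u y, real_inner_comm u y',
      real_inner_comm u e, real_inner_comm u e']
    simp only [conj_trivial]
    ring
  have hexp : c + s * ‖w‖ ^ 2 / 2 ≤ 2 * s * ε ^ 2 + -(s * ‖y - y'‖ ^ 2 / 16) := by
    have h1 : ‖w‖ ^ 2 = (‖y‖ ^ 2 + 2 * inner ℝ y y' + ‖y'‖ ^ 2 -
        2 * (inner ℝ y e + inner ℝ y e' + inner ℝ y' e + inner ℝ y' e') + ‖e + e'‖ ^ 2) / 4 := by
      rw [hw, norm_smul, mul_pow, norm_sub_sq_real, norm_add_sq_real y y', inner_add_left,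
        inner_add_right, inner_add_right]
      norm_num
      ring
    have h2 : ‖y - y'‖ ^ 2 = ‖y‖ ^ 2 - 2 * inner ℝ y y' + ‖y'‖ ^ 2 := norm_sub_sq_real _ _
    have h3 : inner ℝ (y - y') (e - e') =
        inner ℝ y e - inner ℝ y e' - inner ℝ y' e + inner ℝ y' e' := by
      rw [inner_sub_left, inner_sub_right, inner_sub_right]; ring
    have h4 : inner ℝ (y - y') (e - e') ≤ ‖y - y'‖ * (2 * ε) := by
      refine (real_inner_le_norm _ _).trans ?_
      gcongr
      linarith [norm_sub_le e e']
    have h5 : ‖e + e'‖ ^ 2 ≤ (2 * ε) ^ 2 := by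
      gcongr
      linarith [norm_add_le e e']
    -- Half of the available decay s ‖y - y'‖²/8 is spent on the cross term, which explains the 16.
    have h6 : ‖y - y'‖ * (2 * ε) ≤ ‖y - y'‖ ^ 2 / 4 + 4 * ε ^ 2 := by
      nlinarith [sq_nonneg (‖y - y'‖ / 2 - 2 * ε)]
    have h7 : c + s * ‖w‖ ^ 2 / 2 = s / 2 * (-(1 / 4) * ‖y - y'‖ ^ 2 +
        1 / 2 * inner ℝ (y - y') (e - e') + ‖e + e'‖ ^ 2 / 4 + ε ^ 2) := by
      rw [hc, h1, h2, h3]; ring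
    rw [h7]
    have h8 : s / 2 * (-(1 / 4) * ‖y - y'‖ ^ 2 +
        1 / 2 * inner ℝ (y - y') (e - e') + ‖e + e'‖ ^ 2 / 4 + ε ^ 2) ≤
        s / 2 * (4 * ε ^ 2 - ‖y - y'‖ ^ 2 / 8) := by
      gcongr
      nlinarith
    refine h8.trans (le_of_eq ?_)
    ring
  calc _ ≤ ∫⁻ u, ENNReal.ofReal ((m⁻¹ * Real.exp c) * Real.exp (inner ℝ w u))
        ∂(gaussianMeasure E s) := lintegral_mono fun u ↦ ENNReal.ofReal_le_ofReal (hpt u)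
    _ = ENNReal.ofReal (∫ u, (m⁻¹ * Real.exp c) * Real.exp (inner ℝ w u)
        ∂(gaussianMeasure E s)) :=
        (ofReal_integral_eq_lintegral_ofReal
          ((integrable_exp_inner_gaussianMeasure hs w).const_mul _)
          (Filter.Eventually.of_forall fun u ↦ by positivity)).symm
    _ ≤ _ := by
        refine ENNReal.ofReal_le_ofReal ?_
        rw [integral_const_mul, integral_exp_inner_gaussianMeasure hs, mul_assoc, mul_assoc,
          ← Real.exp_add, ← Real.exp_add]
        gcongr

/-- The squared variance is bounded by the fourth moment of the distance of two independent
copies. -/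
lemma sq_integral_norm_sub_mean_sq_le [IsProbabilityMeasure κ] (hK : IsCompact K)
    (hκ : ∀ᵐ y ∂κ, y ∈ K) :
    (∫ y, ‖y - ∫ z, z ∂κ‖ ^ 2 ∂κ) ^ 2 ≤ ∫ p, ‖p.1 - p.2‖ ^ 4 ∂(κ.prod κ) := by
  have jensen : ∀ {X : Type _} [MeasurableSpace X] (ρ : Measure X) [IsProbabilityMeasure ρ]
      (f : X → ℝ), Integrable f ρ → Integrable (fun x ↦ f x ^ 2) ρ →
      (∫ x, f x ∂ρ) ^ 2 ≤ ∫ x, f x ^ 2 ∂ρ := by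
    intro X _ ρ _ f hf hf2
    exact (even_two.convexOn_pow (𝕜 := ℝ)).map_integral_le (continuous_pow 2).continuousOn
      isClosed_univ (Filter.Eventually.of_forall fun _ ↦ mem_univ _) hf hf2
  have hid : Integrable (fun y : E ↦ y) κ :=
    integrable_of_continuous_of_ae_mem hK hκ continuous_id
  have hKK := hK.prod hK
  have hκκ := ae_prod_mem hκ
  have h1 : ∀ y, ‖y - ∫ z, z ∂κ‖ ^ 2 ≤ ∫ z, ‖y - z‖ ^ 2 ∂κ := by
    intro y
    -- An independent copy replaces the mean: Jensen over the copy z here, then over the pair for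
    -- the outer square.
    have h2 : y - ∫ z, z ∂κ = ∫ z, (y - z) ∂κ := by
      rw [integral_sub (integrable_const _) hid]; simp
    rw [h2]
    calc ‖∫ z, (y - z) ∂κ‖ ^ 2 ≤ (∫ z, ‖y - z‖ ∂κ) ^ 2 := by
          gcongr; exact norm_integral_le_integral_norm _
      _ ≤ _ := jensen κ _ (integrable_of_continuous_of_ae_mem hK hκ (by fun_prop))
          (integrable_of_continuous_of_ae_mem hK hκ (by fun_prop))
  have h3 : Integrable (fun p : E × E ↦ ‖p.1 - p.2‖ ^ 2) (κ.prod κ) :=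
    integrable_of_continuous_of_ae_mem hKK hκκ (by fun_prop)
  have h4 : ∫ y, ‖y - ∫ z, z ∂κ‖ ^ 2 ∂κ ≤ ∫ p, ‖p.1 - p.2‖ ^ 2 ∂(κ.prod κ) := by
    rw [integral_prod _ h3]
    exact integral_mono (integrable_of_continuous_of_ae_mem hK hκ (by fun_prop))
      h3.integral_prod_left h1
  calc _ ≤ (∫ p, ‖p.1 - p.2‖ ^ 2 ∂(κ.prod κ)) ^ 2 := by
        gcongr
    _ ≤ ∫ p, (‖p.1 - p.2‖ ^ 2) ^ 2 ∂(κ.prod κ) :=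
        jensen _ _ h3 (integrable_of_continuous_of_ae_mem hKK hκκ (by fun_prop))
    _ = _ := by simp only [← pow_mul]

end Replica

/-! ### Sequential Bayes updates and the mean squared posterior variance -/

section PosteriorMeasure

variable {E : Type*} [NormedAddCommGroup E] [InnerProductSpace ℝ E] [MeasurableSpace E]
  [FiniteDimensional ℝ E] [BorelSpace E] {κ : Measure E} {K : Set E}

/-- The posterior distribution of `y ∼ κ` given the observation `u` of `s • y` under Gaussian
noise of covariance `s • 1`. -/
noncomputable def posterior (κ : Measure E) (s : ℝ) (u : E) : Measure E :=
  κ.tilted fun y ↦ inner ℝ u y - s * ‖y‖ ^ 2 / 2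

omit [FiniteDimensional ℝ E] [BorelSpace E] in
lemma integral_posterior {F : Type*} [NormedAddCommGroup F] [NormedSpace ℝ F] (s : ℝ) (u : E)
    (f : E → F) :
    ∫ y, f y ∂(posterior κ s u) = (likelihood κ s u)⁻¹ • ∫ y, tilt s u y • f y ∂κ := by
  rw [posterior, integral_tilted, ← integral_smul]
  refine integral_congr_ae (Filter.Eventually.of_forall fun y ↦ ?_)
  simp only [smul_smul, likelihood, tilt]
  congr 1
  rw [div_eq_inv_mul]

omit [FiniteDimensional ℝ E] in
lemma isProbabilityMeasure_posterior [IsProbabilityMeasure κ] (hK : IsCompact K)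
    (hκ : ∀ᵐ y ∂κ, y ∈ K) (s : ℝ) (u : E) : IsProbabilityMeasure (posterior κ s u) :=
  isProbabilityMeasure_tilted (integrable_of_continuous_of_ae_mem hK hκ (by fun_prop))

omit [FiniteDimensional ℝ E] [BorelSpace E] in
lemma ae_posterior (hκ : ∀ᵐ y ∂κ, y ∈ K) (s : ℝ) (u : E) : ∀ᵐ y ∂(posterior κ s u), y ∈ K :=
  (tilted_absolutelyContinuous κ _).ae_le hκ

omit [FiniteDimensional ℝ E] [MeasurableSpace E] [BorelSpace E] in
lemma tilt_mul_tilt (s h : ℝ) (u v y : E) :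
    tilt s u y * tilt h v y = tilt (s + h) (u + v) y := by
  rw [tilt, tilt, tilt, ← Real.exp_add, inner_add_left]
  congr 1; ring

omit [FiniteDimensional ℝ E] [BorelSpace E] in
lemma integral_id_posterior (s : ℝ) (u : E) :
    ∫ y, y ∂(posterior κ s u) = posteriorMean κ s u := integral_posterior s u _

-- Because tilts multiply, updating by u and then by v is the same as one update by u + v at
-- precision s + h. This lets the posterior given u play the role of prior for v.
omit [FiniteDimensional ℝ E] [BorelSpace E] in
lemma likelihood_posterior (s h : ℝ) (u v : E) :
    likelihood (posterior κ s u) h v = (likelihood κ s u)⁻¹ * likelihood κ (s + h) (u + v) := by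
  rw [likelihood, integral_posterior]
  simp only [smul_eq_mul, tilt_mul_tilt]
  rfl

omit [FiniteDimensional ℝ E] in
lemma posteriorMean_posterior [IsProbabilityMeasure κ] (hK : IsCompact K)
    (hκ : ∀ᵐ y ∂κ, y ∈ K) (s h : ℝ) (u v : E) :
    posteriorMean (posterior κ s u) h v = posteriorMean κ (s + h) (u + v) := by
  rw [posteriorMean, posteriorMean, likelihood_posterior, integral_posterior]
  simp only [smul_smul, tilt_mul_tilt]
  congr 1
  have := (likelihood_pos hK hκ s u).ne'
  field_simp

/-- Under the posterior, the fourth moment of the distance of two independent copies. -/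
lemma likelihood_mul_integral_posterior_prod [IsProbabilityMeasure κ] (hK : IsCompact K)
    (hκ : ∀ᵐ y ∂κ, y ∈ K) (s : ℝ) (u : E) {f : E × E → ℝ} (hf : Continuous f) :
    likelihood κ s u * ∫ p, f p ∂((posterior κ s u).prod (posterior κ s u)) =
      ∫ p, f p * (tilt s u p.1 * tilt s u p.2 / likelihood κ s u) ∂(κ.prod κ) := by
  have := isProbabilityMeasure_posterior hK hκ s u
  have hZ := likelihood_pos hK hκ s u
  rw [integral_prod _ (integrable_of_continuous_of_ae_mem (hK.prod hK)
    (ae_prod_mem (ae_posterior hκ s u)) hf)]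
  rw [integral_prod _ (integrable_of_continuous_of_ae_mem (hK.prod hK) (ae_prod_mem hκ)
    (by unfold tilt; fun_prop))]
  simp only [integral_posterior, smul_eq_mul]
  rw [mul_inv_cancel_left₀ hZ.ne']
  refine integral_congr_ae (Filter.Eventually.of_forall fun y ↦ ?_)
  simp only
  rw [← mul_assoc, ← integral_const_mul]
  refine integral_congr_ae (Filter.Eventually.of_forall fun z ↦ ?_)
  simp only
  field_simp

omit [FiniteDimensional ℝ E] in
lemma measurable_likelihood [SecondCountableTopology E] [SFinite κ] (s : ℝ) :
    Measurable (likelihood κ s) := by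
  have : Continuous fun p : E × E ↦ tilt s p.1 p.2 := continuous_tilt s
  exact (this.stronglyMeasurable.integral_prod_right (ν := κ)).measurable

lemma measurable_posteriorMean [SFinite κ] (s : ℝ) : Measurable (posteriorMean κ s) := by
  have : Continuous fun p : E × E ↦ tilt s p.1 p.2 • p.2 := (continuous_tilt s).smul continuous_snd
  exact (measurable_likelihood s).inv.smul
    (this.stronglyMeasurable.integral_prod_right (ν := κ)).measurable

/-- Converts an exponential moment into a second moment: a bound on the mean of exp(x - l) costs
only l², hence a squared logarithm of the ball mass. -/
lemma sq_le_two_mul_sq_add_exp {x l : ℝ} (hx : 0 ≤ x) :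
    x ^ 2 ≤ 2 * l ^ 2 + 4 * Real.exp (x - l) := by
  rcases le_or_gt x l with h | h
  · have : x ^ 2 ≤ l ^ 2 := by gcongr
    nlinarith [Real.exp_pos (x - l), sq_nonneg l]
  · have := Real.quadratic_le_exp_of_nonneg (sub_nonneg.2 h.le)
    nlinarith [sq_nonneg (x - 2 * l), sq_nonneg (x - l), sq_nonneg l]

/-- The mean squared variance of the posterior. -/
lemma lintegral_likelihood_mul_sq_variance_le [IsProbabilityMeasure κ] (hK : IsCompact K)
    (hκ : ∀ᵐ y ∂κ, y ∈ K) {s ε m : ℝ} (hs : 0 < s) (hm : 0 < m)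
    (hball : ∀ y ∈ K, m ≤ κ.real (Metric.closedBall y ε)) :
    ∫⁻ u, ENNReal.ofReal (likelihood κ s u *
        (∫ y, ‖y - ∫ z, z ∂(posterior κ s u)‖ ^ 2 ∂(posterior κ s u)) ^ 2)
        ∂(gaussianMeasure E s) ≤
      ENNReal.ofReal (256 / s ^ 2 * (2 * (2 * s * ε ^ 2 + Real.log m⁻¹) ^ 2 + 4)) := by
  have : IsProbabilityMeasure (gaussianMeasure E s) := isProbabilityMeasure_gaussianMeasure hs
  obtain ⟨J, hJ⟩ : ∃ J : E × E → E → ℝ, J = fun p u ↦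
    tilt s u p.1 * tilt s u p.2 / likelihood κ s u := ⟨_, rfl⟩
  obtain ⟨l, hl⟩ : ∃ l, l = 2 * s * ε ^ 2 + Real.log m⁻¹ := ⟨_, rfl⟩
  have hJ0 : ∀ p u, 0 ≤ J p u := by
    intro p u
    rw [hJ]
    exact div_nonneg (mul_nonneg (tilt_pos _ _ _).le (tilt_pos _ _ _).le)
      (likelihood_pos hK hκ s u).le
  have hJm : Measurable fun q : E × (E × E) ↦ J q.2 q.1 := by
    have h1 := (continuous_tilt (E := E) s).measurable
    have h2 := measurable_likelihood (κ := κ) s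
    rw [hJ]
    exact ((h1.comp (f := fun q : E × (E × E) ↦ (q.1, q.2.1)) (by fun_prop)).mul
      (h1.comp (f := fun q : E × (E × E) ↦ (q.1, q.2.2)) (by fun_prop))).div
      (h2.comp measurable_fst)
  have hJi : ∀ {f : E × E → ℝ}, Continuous f → ∀ u,
      Integrable (fun p ↦ f p * J p u) (κ.prod κ) := by
    intro f hf u
    rw [hJ]
    exact integrable_of_continuous_of_ae_mem (hK.prod hK) (ae_prod_mem hκ)
      (by unfold tilt; fun_prop)
  -- `I` is the density, relative to κ ⊗ κ, of the law of two points drawn from one posterior after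
  -- averaging over the observation. By Tonelli (`hswap`) mean posterior moments are integrals
  -- against it.
  obtain ⟨I, hI⟩ : ∃ I : E × E → ℝ≥0∞, I = fun p ↦
    ∫⁻ u, ENNReal.ofReal (J p u) ∂(gaussianMeasure E s) := ⟨_, rfl⟩
  have hIm : Measurable I := by
    rw [hI]
    exact hJm.ennreal_ofReal.lintegral_prod_left'
  have hswap : ∀ f : E × E → ℝ, Continuous f → (∀ p, 0 ≤ f p) →
      ∫⁻ u, ENNReal.ofReal (likelihood κ s u *
        ∫ p, f p ∂((posterior κ s u).prod (posterior κ s u))) ∂(gaussianMeasure E s) =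
      ∫⁻ p, ENNReal.ofReal (f p) * I p ∂(κ.prod κ) := by
    intro f hf hf0
    calc _ = ∫⁻ u, ∫⁻ p, ENNReal.ofReal (f p * J p u) ∂(κ.prod κ) ∂(gaussianMeasure E s) := by
          refine lintegral_congr fun u ↦ ?_
          rw [likelihood_mul_integral_posterior_prod hK hκ s u hf,
            ofReal_integral_eq_lintegral_ofReal]
          · rw [hJ]
          · simpa only [hJ] using hJi hf u
          · exact Filter.Eventually.of_forall fun p ↦
              by simpa only [hJ, Pi.zero_apply] using mul_nonneg (hf0 p) (hJ0 p u)
      _ = ∫⁻ p, ∫⁻ u, ENNReal.ofReal (f p * J p u) ∂(gaussianMeasure E s) ∂(κ.prod κ) := by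
          rw [lintegral_lintegral_swap]
          exact ((hf.measurable.comp measurable_snd).mul hJm).ennreal_ofReal.aemeasurable
      _ = _ := by
          refine lintegral_congr fun p ↦ ?_
          simp only [ENNReal.ofReal_mul (hf0 p)]
          rw [lintegral_const_mul' _ _ ENNReal.ofReal_ne_top, hI]
  -- Test function 1 in `hswap`: the likelihood has total Gaussian mass 1, by the shift formula
  -- applied to a constant.
  have hI1 : ∫⁻ p, I p ∂(κ.prod κ) = 1 := by
    have h1 := hswap (fun _ ↦ 1) continuous_const (fun _ ↦ zero_le_one)
    simp only [ENNReal.ofReal_one, one_mul] at h1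
    rw [← h1]
    have h2 : ∀ u, ∫ _, (1 : ℝ) ∂((posterior κ s u).prod (posterior κ s u)) = 1 := by
      intro u
      have := isProbabilityMeasure_posterior hK hκ s u
      simp
    simp only [h2, mul_one]
    have h3 : ∀ u, ENNReal.ofReal (likelihood κ s u) = ∫⁻ y, ENNReal.ofReal (tilt s u y) ∂κ := by
      intro u
      rw [likelihood, ofReal_integral_eq_lintegral_ofReal
        (integrable_of_continuous_of_ae_mem hK hκ (by unfold tilt; fun_prop))
        (Filter.Eventually.of_forall fun y ↦ (tilt_pos s u y).le)]
    simp only [h3]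
    rw [lintegral_lintegral_swap (continuous_tilt s).measurable.ennreal_ofReal.aemeasurable]
    have h4 : ∀ y, ∫⁻ u, ENNReal.ofReal (tilt s u y) ∂(gaussianMeasure E s) = 1 := by
      intro y
      have := lintegral_gaussianMeasure_add_smul hs y (f := fun _ ↦ 1) measurable_const
      simpa using this.symm
    simp [h4]
  -- `S` is the decay exponent of the replica bound and `l` the logarithm of its prefactor, so exp(S
  -- - l) I ≤ 1 on K × K. The constant 256 / s² comes from ‖y - y'‖⁴ = (16/s)² S².
  obtain ⟨S, hS⟩ : ∃ S : E × E → ℝ, S = fun p ↦ s * ‖p.1 - p.2‖ ^ 2 / 16 := ⟨_, rfl⟩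
  have hS0 : ∀ p, 0 ≤ S p := fun p ↦ by rw [hS]; positivity
  have hSc : Continuous S := by rw [hS]; fun_prop
  have hIexp : ∫⁻ p, ENNReal.ofReal (Real.exp (S p - l)) * I p ∂(κ.prod κ) ≤ 1 := by
    calc _ ≤ ∫⁻ _, 1 ∂(κ.prod κ) := by
          refine lintegral_mono_ae ?_
          filter_upwards [ae_prod_mem hκ] with p hp
          have h1 := lintegral_tilt_mul_tilt_div_likelihood_le hK hκ hs hm (hball _ hp.1)
            (hball _ hp.2)
          have h2 : I p ≤ ENNReal.ofReal (m⁻¹ * Real.exp (2 * s * ε ^ 2) *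
              Real.exp (-(s * ‖p.1 - p.2‖ ^ 2 / 16))) := by
            rw [hI, hJ]; exact h1
          refine (mul_le_mul_right h2 _).trans ?_
          rw [← ENNReal.ofReal_mul (Real.exp_nonneg _), ← ENNReal.ofReal_one]
          refine ENNReal.ofReal_le_ofReal (le_of_eq ?_)
          have h3 : m⁻¹ = Real.exp (Real.log m⁻¹) := (Real.exp_log (inv_pos.2 hm)).symm
          nth_rw 1 [h3]
          rw [← Real.exp_add, ← Real.exp_add, ← Real.exp_add, hS, hl, Real.exp_eq_one_iff]
          ring
      _ = 1 := by simp
  calc _ ≤ ∫⁻ u, ENNReal.ofReal (likelihood κ s u *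
        ∫ p, ‖p.1 - p.2‖ ^ 4 ∂((posterior κ s u).prod (posterior κ s u)))
          ∂(gaussianMeasure E s) := by
        refine lintegral_mono fun u ↦ ENNReal.ofReal_le_ofReal ?_
        have := isProbabilityMeasure_posterior hK hκ s u
        exact mul_le_mul_of_nonneg_left
          (sq_integral_norm_sub_mean_sq_le hK (ae_posterior hκ s u)) (likelihood_pos hK hκ s u).le
    _ = ∫⁻ p, ENNReal.ofReal (‖p.1 - p.2‖ ^ 4) * I p ∂(κ.prod κ) :=
        hswap (fun p ↦ ‖p.1 - p.2‖ ^ 4) (by fun_prop) (fun p ↦ by positivity)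
    _ ≤ ∫⁻ p, ENNReal.ofReal (256 / s ^ 2) * (ENNReal.ofReal (2 * l ^ 2) * I p +
          4 * (ENNReal.ofReal (Real.exp (S p - l)) * I p)) ∂(κ.prod κ) := by
        refine lintegral_mono fun p ↦ ?_
        rw [← mul_assoc 4, ← add_mul, ← mul_assoc]
        gcongr
        have h4 : (4 : ℝ≥0∞) = ENNReal.ofReal 4 := by norm_num
        rw [h4, ← ENNReal.ofReal_mul (by norm_num),
          ← ENNReal.ofReal_add (by positivity) (by positivity),
          ← ENNReal.ofReal_mul (by positivity)]
        refine ENNReal.ofReal_le_ofReal ?_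
        refine le_trans (le_of_eq ?_) (mul_le_mul_of_nonneg_left
          (sq_le_two_mul_sq_add_exp (hS0 p)) (by positivity))
        rw [hS]
        field_simp
        ring
    _ = ENNReal.ofReal (256 / s ^ 2) * (ENNReal.ofReal (2 * l ^ 2) +
          4 * ∫⁻ p, ENNReal.ofReal (Real.exp (S p - l)) * I p ∂(κ.prod κ)) := by
        have hm2 : Measurable fun p ↦ ENNReal.ofReal (Real.exp (S p - l)) * I p :=
          (by fun_prop : Measurable fun p ↦ ENNReal.ofReal (Real.exp (S p - l))).mul hIm
        rw [lintegral_const_mul' _ _ ENNReal.ofReal_ne_top,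
          lintegral_add_left (hIm.const_mul _), lintegral_const_mul _ hIm,
          lintegral_const_mul _ hm2, hI1, mul_one]
    _ ≤ ENNReal.ofReal (256 / s ^ 2) * (ENNReal.ofReal (2 * l ^ 2) + 4 * 1) := by gcongr
    _ = _ := by
        have h4 : (4 : ℝ≥0∞) = ENNReal.ofReal 4 := by norm_num
        rw [mul_one, h4, ← ENNReal.ofReal_add (by positivity) (by norm_num),
          ← ENNReal.ofReal_mul (by positivity), hl]

/-- The mean squared displacement of the posterior mean under an additional observation with
signal-to-noise ratio `h`. -/
lemma lintegral_sq_posteriorMean_sub_le [IsProbabilityMeasure κ] (hK : IsCompact K)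
    (hκ : ∀ᵐ y ∂κ, y ∈ K) (hdiam : ∀ x ∈ K, ∀ y ∈ K, ‖x - y‖ ≤ 1) {s h ε m : ℝ} (hs : 0 < s)
    (hh : 0 < h) (hm : 0 < m)
    (hball : ∀ y ∈ K, m ≤ κ.real (Metric.closedBall y ε)) :
    ∫⁻ u, ∫⁻ v, ENNReal.ofReal (likelihood κ (s + h) (u + v) *
        ‖posteriorMean κ (s + h) (u + v) - posteriorMean κ s u‖ ^ 2)
        ∂(gaussianMeasure E h) ∂(gaussianMeasure E s) ≤
      ENNReal.ofReal (h * Real.exp (3 * h / 2) *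
        (256 / s ^ 2 * (2 * (2 * s * ε ^ 2 + Real.log m⁻¹) ^ 2 + 4))) := by
  have hpt : ∀ u, ∫⁻ v, ENNReal.ofReal (likelihood κ (s + h) (u + v) *
      ‖posteriorMean κ (s + h) (u + v) - posteriorMean κ s u‖ ^ 2) ∂(gaussianMeasure E h) ≤
      ENNReal.ofReal (h * Real.exp (3 * h / 2)) * ENNReal.ofReal (likelihood κ s u *
        (∫ y, ‖y - ∫ z, z ∂(posterior κ s u)‖ ^ 2 ∂(posterior κ s u)) ^ 2) := by
    intro u
    have := isProbabilityMeasure_posterior hK hκ s u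
    have hZ := likelihood_pos hK hκ s u
    -- For fixed u the displacement bound is used with the posterior given u as prior.
    have h1 := lintegral_likelihood_mul_sq_posteriorMean_sub_le hK (ae_posterior hκ s u) hdiam hh
    have h2 : ∀ v, ENNReal.ofReal (likelihood κ (s + h) (u + v) *
        ‖posteriorMean κ (s + h) (u + v) - posteriorMean κ s u‖ ^ 2) =
        ENNReal.ofReal (likelihood κ s u) * ENNReal.ofReal (likelihood (posterior κ s u) h v *
          ‖posteriorMean (posterior κ s u) h v - ∫ y, y ∂(posterior κ s u)‖ ^ 2) := by
      intro v
      rw [← ENNReal.ofReal_mul hZ.le, likelihood_posterior, posteriorMean_posterior hK hκ,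
        integral_id_posterior, ← mul_assoc, mul_inv_cancel_left₀ hZ.ne']
    simp only [h2]
    rw [lintegral_const_mul' _ _ ENNReal.ofReal_ne_top]
    refine (mul_le_mul_right h1 _).trans (le_of_eq ?_)
    rw [← ENNReal.ofReal_mul hZ.le, ← ENNReal.ofReal_mul (by positivity)]
    congr 1
    ring
  calc _ ≤ ∫⁻ u, ENNReal.ofReal (h * Real.exp (3 * h / 2)) * ENNReal.ofReal (likelihood κ s u *
        (∫ y, ‖y - ∫ z, z ∂(posterior κ s u)‖ ^ 2 ∂(posterior κ s u)) ^ 2)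
          ∂(gaussianMeasure E s) := lintegral_mono hpt
    _ ≤ _ := by
        rw [lintegral_const_mul' _ _ ENNReal.ofReal_ne_top]
        refine (mul_le_mul_right
          (lintegral_likelihood_mul_sq_variance_le hK hκ hs hm hball) _).trans (le_of_eq ?_)
        rw [← ENNReal.ofReal_mul (by positivity)]

end PosteriorMeasure

/-! ### Riemann sums for ∫ eˣ df(x) along continuous paths -/

section RiemannSum

open Filter Topology

lemma tendsto_riemannSum {f g : ℝ → ℝ} (hf : Continuous f) (hg : Continuous g) (a : ℝ) {l : ℝ}
    (hl : 0 ≤ l) :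
    Tendsto (fun n : ℕ ↦ ∑ k ∈ Finset.range n, f (a + k * (l / n)) *
      ∫ x in (a + k * (l / n))..(a + (k + 1 : ℕ) * (l / n)), g x) atTop
      (𝓝 (∫ x in a..(a + l), f x * g x)) := by
  obtain ⟨c, hc⟩ := (isCompact_Icc (a := a) (b := a + l)).exists_bound_of_continuousOn
    hg.continuousOn
  have hc0 : 0 ≤ c := (norm_nonneg _).trans (hc a ⟨le_rfl, by linarith⟩)
  rw [Metric.tendsto_atTop]
  intro ε hε
  have huc := (isCompact_Icc (a := a) (b := a + l)).uniformContinuousOn_of_continuous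
    hf.continuousOn
  rw [Metric.uniformContinuousOn_iff] at huc
  have hη : 0 < ε / (c * l + 1) := by positivity
  obtain ⟨δ, hδ, huc⟩ := huc _ hη
  obtain ⟨N, hN⟩ := exists_nat_gt (l / δ)
  refine ⟨N + 1, fun n hn ↦ ?_⟩
  have hn0 : (0 : ℝ) < n := by exact_mod_cast (Nat.succ_pos N).trans_le hn
  have hNn : (N : ℝ) < n := by exact_mod_cast hn
  have hstep : l / n < δ := by
    rw [div_lt_iff₀ hδ] at hN
    rw [div_lt_iff₀ hn0]
    nlinarith
  have hstep0 : 0 ≤ l / n := by positivity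
  set x : ℕ → ℝ := fun k ↦ a + k * (l / n) with hx
  have hx0 : x 0 = a := by simp [hx]
  have hxn : x n = a + l := by simp only [hx]; field_simp
  have hxs : ∀ k, x (k + 1) = x k + l / n := by intro k; simp only [hx]; push_cast; ring
  have hxa : ∀ k, a ≤ x k := by intro k; simp only [hx]; have := k.cast_nonneg (α := ℝ); nlinarith
  have hxb : ∀ k ≤ n, x k ≤ a + l := by
    intro k hk
    rw [← hxn]
    simp only [hx]
    gcongr
  have hsum : ∫ y in a..(a + l), f y * g y =
      ∑ k ∈ Finset.range n, ∫ y in (x k)..(x (k + 1)), f y * g y := by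
    have := intervalIntegral.sum_integral_adjacent_intervals (μ := volume) (n := n) (a := x)
      (f := fun y ↦ f y * g y) (fun k _ ↦ (by fun_prop : Continuous _).intervalIntegrable _ _)
    rw [this, hx0, hxn]
  change dist (∑ k ∈ Finset.range n, f (x k) * ∫ y in (x k)..(x (k + 1)), g y) _ < ε
  rw [hsum, dist_eq_norm, ← Finset.sum_sub_distrib]
  have hterm : ∀ k ∈ Finset.range n, ‖f (x k) * (∫ y in (x k)..(x (k + 1)), g y) -
      ∫ y in (x k)..(x (k + 1)), f y * g y‖ ≤ ε / (c * l + 1) * c * (l / n) := by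
    intro k hk
    have hk' : k + 1 ≤ n := Finset.mem_range.1 hk
    have hc1 : Continuous fun y ↦ f (x k) * g y := by fun_prop
    have hc2 : Continuous fun y ↦ f y * g y := by fun_prop
    rw [← intervalIntegral.integral_const_mul, ← intervalIntegral.integral_sub
      (hc1.intervalIntegrable _ _) (hc2.intervalIntegrable _ _)]
    have := intervalIntegral.norm_integral_le_of_norm_le_const (a := x k) (b := x (k + 1))
      (f := fun y ↦ f (x k) * g y - f y * g y) (C := ε / (c * l + 1) * c) ?_
    · have hlen : |x (k + 1) - x k| = l / n := by
        rw [hxs, add_sub_cancel_left, abs_of_nonneg hstep0]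
      rwa [hlen] at this
    · intro y hy
      rw [uIoc_of_le (by rw [hxs]; linarith)] at hy
      have hy1 : a ≤ y := (hxa k).trans hy.1.le
      have hy2 : y ≤ a + l := hy.2.trans (hxb _ hk')
      rw [← sub_mul, norm_mul]
      refine mul_le_mul ?_ (hc y ⟨hy1, hy2⟩) (norm_nonneg _) hη.le
      rw [← dist_eq_norm]
      refine (huc _ ⟨hxa k, hxb k (by omega)⟩ _ ⟨hy1, hy2⟩ ?_).le
      rw [Real.dist_eq, abs_sub_comm, abs_of_nonneg (by linarith [hy.1])]
      have := hy.2
      rw [hxs] at this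
      linarith
  refine (norm_sum_le_of_le _ hterm).trans_lt ?_
  rw [Finset.sum_const, Finset.card_range, nsmul_eq_mul]
  have h1 : (n : ℝ) * (ε / (c * l + 1) * c * (l / n)) = ε * ((c * l) / (c * l + 1)) := by
    field_simp
  rw [h1]
  have h2 : (c * l) / (c * l + 1) < 1 := by
    rw [div_lt_one (by positivity)]; linarith
  nlinarith

/-- The Riemann sum over `[a, a + l]` for the stochastic integral `∫ eˣ df(x)`. -/
noncomputable def expSum (a l : ℝ) (n : ℕ) (f : ℝ≥0 → ℝ) : ℝ :=
  ∑ k ∈ Finset.range n, Real.exp (a + (k + 1 : ℕ) * (l / n)) *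
    (f (a + (k + 1 : ℕ) * (l / n)).toNNReal - f (a + k * (l / n)).toNNReal)

/-- The pathwise value, by parts, of the stochastic integral `∫ eˣ df(x)` over `[a, b]`. -/
noncomputable def expIntegral (a b : ℝ) (f : ℝ≥0 → ℝ) : ℝ :=
  Real.exp b * f b.toNNReal - Real.exp a * f a.toNNReal -
    ∫ x in a..b, f x.toNNReal * Real.exp x

/-- Summation by parts moves the increments onto the smooth factor, so continuity of the path
suffices and no Itô integral is needed. The right-endpoint weights make the by-parts identity exact,
with f at left endpoints against ∫ eˣ dx. -/
lemma tendsto_expSum {f : ℝ≥0 → ℝ} (hf : Continuous f) (a : ℝ) {l : ℝ} (hl : 0 ≤ l) :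
    Tendsto (fun n ↦ expSum a l n f) atTop (𝓝 (expIntegral a (a + l) f)) := by
  have h1 := tendsto_riemannSum (f := fun x ↦ f x.toNNReal) (g := Real.exp)
    (hf.comp continuous_real_toNNReal) Real.continuous_exp a hl
  refine Tendsto.congr' ?_ (tendsto_const_nhds.sub h1)
  filter_upwards [eventually_gt_atTop 0] with n hn
  have hn0 : (n : ℝ) ≠ 0 := by exact_mod_cast hn.ne'
  have h2 := Finset.sum_range_sub (fun k : ℕ ↦ Real.exp (a + k * (l / n)) *
    f (a + k * (l / n)).toNNReal) n
  have h3 : a + n * (l / n) = a + l := by field_simp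
  simp only [h3, Nat.cast_zero, zero_mul, add_zero] at h2
  rw [← h2, ← Finset.sum_sub_distrib, expSum]
  refine Finset.sum_congr rfl fun k _ ↦ ?_
  rw [integral_exp]
  ring

lemma tendsto_sum_exp_sq (a : ℝ) {l : ℝ} (hl : 0 ≤ l) :
    Tendsto (fun n : ℕ ↦ ∑ k ∈ Finset.range n, Real.exp (a + (k + 1 : ℕ) * (l / n)) ^ 2 * (l / n))
      atTop (𝓝 ((Real.exp (2 * (a + l)) - Real.exp (2 * a)) / 2)) := by
  have h1 := tendsto_riemannSum (f := fun x ↦ Real.exp (2 * x)) (g := fun _ ↦ 1)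
    (by fun_prop) continuous_const a hl
  have h2 : ∫ x in a..(a + l), Real.exp (2 * x) * 1 =
      (Real.exp (2 * (a + l)) - Real.exp (2 * a)) / 2 := by
    simp only [mul_one]
    rw [intervalIntegral.integral_comp_mul_left (fun x ↦ Real.exp x) two_ne_zero, integral_exp]
    simp [div_eq_inv_mul]
  -- The right-endpoint sum is the left-endpoint Riemann sum times this factor, which tends to 1.
  have h3 : Tendsto (fun n : ℕ ↦ Real.exp (2 * (l / n))) atTop (𝓝 1) := by
    have : Tendsto (fun n : ℕ ↦ 2 * (l / n)) atTop (𝓝 (2 * 0)) :=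
      (tendsto_const_div_atTop_nhds_zero_nat l).const_mul 2
    rw [mul_zero] at this
    simpa [Function.comp_def] using (Real.continuous_exp.tendsto 0).comp this
  rw [h2] at h1
  have h4 := h3.mul h1
  rw [one_mul] at h4
  refine h4.congr fun n ↦ ?_
  rw [Finset.mul_sum]
  refine Finset.sum_congr rfl fun k _ ↦ ?_
  rw [intervalIntegral.integral_const, smul_eq_mul, mul_one, ← mul_assoc, ← Real.exp_add,
    ← Real.exp_nat_mul]
  push_cast
  congr 2 <;> ring

lemma measurable_expSum (a l : ℝ) (n : ℕ) : Measurable (expSum a l n) := by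
  unfold expSum; fun_prop

end RiemannSum

/-! ### Characteristic functions of weighted Brownian increments -/

section Brownian

open Filter Topology

variable {Ω : Type*} [MeasurableSpace Ω] {P : Measure Ω}

lemma integral_cexp_sum_increments {B : ℝ≥0 → Ω → ℝ} (hB : IsPreBrownianReal B P)
    {s : ℕ → ℝ≥0} (hs : Monotone s) (w : ℕ → ℝ) (N : ℕ) :
    ∫ ω, Complex.exp ((∑ k ∈ Finset.range N, w k * (B (s (k + 1)) ω - B (s k) ω) : ℝ) *
      Complex.I) ∂P =
      Complex.exp (-(∑ k ∈ Finset.range N, w k ^ 2 * (s (k + 1) - s k : ℝ) / 2 : ℝ)) := by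
  have hind := (hB.hasIndepIncrements.nat hs).precomp (g := fun i : Fin N ↦ (i : ℕ))
    Fin.val_injective
  have h1 := hind.integral_fun_prod_comp (ι := Fin N)
    (X := fun i ω ↦ B (s (i + 1)) ω - B (s i) ω)
    (f := fun i x ↦ Complex.exp ((w i * x : ℝ) * Complex.I))
    (fun i ↦ (hB.aemeasurable _).sub (hB.aemeasurable _))
    (fun i ↦ (by fun_prop : Continuous _).aestronglyMeasurable)
  have h2 : ∀ k : ℕ, ∫ ω, Complex.exp ((w k * (B (s (k + 1)) ω - B (s k) ω) : ℝ) * Complex.I) ∂P =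
      Complex.exp (-(w k ^ 2 * (s (k + 1) - s k : ℝ) / 2 : ℝ)) := by
    intro k
    have hlaw := hB.hasLaw_sub (s (k + 1)) (s k)
    have h3 := charFun_gaussianReal (μ := 0) (v := nndist (s (k + 1)).1 (s k).1) (w k)
    rw [← hlaw.map_eq, charFun_apply_real, integral_map hlaw.aemeasurable
      (by fun_prop : Continuous _).aestronglyMeasurable] at h3
    have h4 : ((nndist (s (k + 1)).1 (s k).1 : ℝ≥0) : ℝ) = s (k + 1) - s k := by
      rw [coe_nndist, Real.dist_eq, abs_of_nonneg]
      · rfl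
      · exact sub_nonneg.2 (hs (Nat.le_succ k))
    rw [h4] at h3
    convert h3 using 2
    · ext ω
      congr 1
      simp
    · push_cast; ring
  simp only [← Fin.sum_univ_eq_sum_range (fun k ↦ w k * (B (s (k + 1)) _ - B (s k) _))]
  rw [← Fin.sum_univ_eq_sum_range (fun k ↦ w k ^ 2 * (s (k + 1) - s k : ℝ) / 2)]
  rw [Complex.ofReal_sum, ← Finset.sum_neg_distrib, Complex.exp_sum]
  simp only [← h2]
  refine Eq.trans (integral_congr_ae (Eventually.of_forall fun ω ↦ ?_)) h1
  simp only [Complex.ofReal_sum, Finset.sum_mul, Complex.exp_sum]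

/-- The characteristic function of the Riemann sums of `∫ eˣ dB(x)` over two adjacent intervals. -/
lemma integral_cexp_expSum {B : ℝ≥0 → Ω → ℝ} (hB : IsPreBrownianReal B P) {t γ : ℝ}
    (ht : 0 ≤ t) (hγ : 0 ≤ γ) (θ η : ℝ) {n : ℕ} (hn : 0 < n) :
    ∫ ω, Complex.exp ((θ * expSum 0 t n (fun r ↦ B r ω) + η * expSum t γ n (fun r ↦ B r ω) : ℝ) *
      Complex.I) ∂P =
    Complex.exp (-((θ ^ 2 *
        (∑ k ∈ Finset.range n, Real.exp (0 + (k + 1 : ℕ) * (t / n)) ^ 2 * (t / n)) +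
      η ^ 2 * (∑ k ∈ Finset.range n, Real.exp (t + (k + 1 : ℕ) * (γ / n)) ^ 2 * (γ / n))) / 2
        : ℝ)) := by
  have hn0 : (n : ℝ) ≠ 0 := by exact_mod_cast hn.ne'
  -- A single grid of 2n steps, n of length t/n followed by n of length γ/n, so that independence of
  -- increments handles both intervals, and their mutual independence, at once. Truncated
  -- subtraction glues the two halves.
  obtain ⟨r, hr⟩ : ∃ r : ℕ → ℝ, r = fun k ↦
    (min k n : ℕ) * (t / n) + (k - n : ℕ) * (γ / n) := ⟨_, rfl⟩
  have hr0 : ∀ k, 0 ≤ r k := fun k ↦ by rw [hr]; positivity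
  have hrm : Monotone r := by
    intro i j hij
    rw [hr]
    simp only
    gcongr
  have hr1 : ∀ k ≤ n, r k = 0 + k * (t / n) := by
    intro k hk
    simp only [hr, min_eq_left hk, Nat.sub_eq_zero_of_le hk]
    simp
  have hr2 : ∀ k, r (n + k) = t + k * (γ / n) := by
    intro k
    have h1 : min (n + k) n = n := by omega
    have h2 : n + k - n = k := by omega
    simp only [hr, h1, h2]
    field_simp
  obtain ⟨w, hw⟩ : ∃ w : ℕ → ℝ, w = fun k ↦ (if k < n then θ else η) * Real.exp (r (k + 1)) :=
    ⟨_, rfl⟩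
  have hw1 : ∀ k < n, w k = θ * Real.exp (0 + (k + 1 : ℕ) * (t / n)) := by
    intro k hk
    rw [hw]
    simp only [hk, if_true]
    rw [hr1 (k + 1) hk]
  have hw2 : ∀ k, w (n + k) = η * Real.exp (t + (k + 1 : ℕ) * (γ / n)) := by
    intro k
    rw [hw]
    simp only [show ¬ (n + k < n) by omega, if_false]
    rw [add_assoc, hr2]
  have hmain := integral_cexp_sum_increments hB (s := fun k ↦ (r k).toNNReal)
    (fun i j hij ↦ Real.toNNReal_le_toNNReal (hrm hij)) w (n + n)
  have h1 : ∀ ω, ∑ k ∈ Finset.range (n + n),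
      w k * (B (r (k + 1)).toNNReal ω - B (r k).toNNReal ω) =
      θ * expSum 0 t n (fun r ↦ B r ω) + η * expSum t γ n (fun r ↦ B r ω) := by
    intro ω
    rw [Finset.sum_range_add, expSum, expSum, Finset.mul_sum, Finset.mul_sum]
    congr 1
    · refine Finset.sum_congr rfl fun k hk ↦ ?_
      have hk' := Finset.mem_range.1 hk
      rw [hw1 k hk', hr1 k hk'.le, hr1 (k + 1) hk']
      ring
    · refine Finset.sum_congr rfl fun k hk ↦ ?_
      rw [hw2 k, hr2 k, add_assoc, hr2 (k + 1)]
      ring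
  have h2 : ∑ k ∈ Finset.range (n + n), w k ^ 2 *
      (((r (k + 1)).toNNReal : ℝ) - ((r k).toNNReal : ℝ)) / 2 = (θ ^ 2 *
        (∑ k ∈ Finset.range n, Real.exp (0 + (k + 1 : ℕ) * (t / n)) ^ 2 * (t / n)) +
      η ^ 2 * (∑ k ∈ Finset.range n, Real.exp (t + (k + 1 : ℕ) * (γ / n)) ^ 2 * (γ / n))) / 2 := by
    simp only [Real.coe_toNNReal _ (hr0 _)]
    rw [Finset.sum_range_add, Finset.mul_sum, Finset.mul_sum, add_div, Finset.sum_div,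
      Finset.sum_div]
    congr 1
    · refine Finset.sum_congr rfl fun k hk ↦ ?_
      have hk' := Finset.mem_range.1 hk
      rw [hw1 k hk', hr1 k hk'.le, hr1 (k + 1) hk']
      push_cast
      ring
    · refine Finset.sum_congr rfl fun k hk ↦ ?_
      rw [hw2 k, hr2 k, add_assoc, hr2 (k + 1)]
      push_cast
      ring
  simp only [h1, h2] at hmain
  exact hmain

end Brownian

/-! ### The Ornstein–Uhlenbeck process and its Gaussian increments -/

section OrnsteinUhlenbeck

open Filter Topology

/-- The solution of the Ornstein-Uhlenbeck equation driven by a continuous path `b`. -/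
lemma exp_mul_sub_eq_expIntegral {x b : ℝ≥0 → ℝ} (hx : Continuous x) (hb : Continuous b)
    (heq : ∀ t : ℝ≥0, x t = x 0 - (∫ s in (0 : ℝ)..t, x s.toNNReal) + √2 * b t)
    {a c : ℝ} (ha : 0 ≤ a) (hac : a ≤ c) :
    Real.exp c * x c.toNNReal - Real.exp a * x a.toNNReal = √2 * expIntegral a c b := by
  have hX : Continuous fun s : ℝ ↦ x s.toNNReal := hx.comp continuous_real_toNNReal
  have hB : Continuous fun s : ℝ ↦ b s.toNNReal := hb.comp continuous_real_toNNReal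
  have heq' : ∀ s : ℝ, 0 ≤ s → x s.toNNReal =
      x 0 - (∫ r in (0 : ℝ)..s, x r.toNNReal) + √2 * b s.toNNReal := by
    intro s hs
    have := heq s.toNNReal
    rwa [Real.coe_toNNReal _ hs] at this
  -- Integrating factor: the unknown enters the derivative of eˢ ∫₀ˢ x only through ∫₀ˢ x + x(s),
  -- which the equation replaces by x(0) + √2 b(s).
  have hderiv : ∀ s ∈ uIcc a c, HasDerivAt
      (fun s ↦ Real.exp s * ∫ r in (0 : ℝ)..s, x r.toNNReal)
      (Real.exp s * x 0 + √2 * (b s.toNNReal * Real.exp s)) s := by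
    intro s hs
    rw [uIcc_of_le hac] at hs
    have h1 := (Real.hasDerivAt_exp s).mul (intervalIntegral.integral_hasDerivAt_right
      (hX.intervalIntegrable 0 s) (hX.stronglyMeasurableAtFilter _ _) hX.continuousAt)
    refine h1.congr_deriv ?_
    rw [heq' s (ha.trans hs.1)]
    ring
  have hint := intervalIntegral.integral_eq_sub_of_hasDerivAt hderiv
    ((by fun_prop : Continuous fun s : ℝ ↦ Real.exp s * x 0 +
      √2 * (b s.toNNReal * Real.exp s)).intervalIntegrable _ _)
  rw [intervalIntegral.integral_add
    ((by fun_prop : Continuous fun s : ℝ ↦ Real.exp s * x 0).intervalIntegrable _ _)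
    ((by fun_prop : Continuous fun s : ℝ ↦
      √2 * (b s.toNNReal * Real.exp s)).intervalIntegrable _ _),
    intervalIntegral.integral_mul_const, intervalIntegral.integral_const_mul, integral_exp] at hint
  rw [heq' a ha, heq' c (ha.trans hac), expIntegral]
  linarith

variable {Ω : Type*} [MeasurableSpace Ω] {P : Measure Ω} [IsProbabilityMeasure P] {D : ℕ}
  {X : ℝ≥0 → Ω → EuclideanSpace ℝ (Fin D)} {μ : Measure (EuclideanSpace ℝ (Fin D))}

/-- The joint characteristic function of the initial value and of the two independent Gaussian
increments of the time-changed Ornstein-Uhlenbeck process `t ↦ eᵗ X(t)`. -/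
lemma IsForwardProcess.integral_cexp (hX : IsForwardProcess X μ P) (t γ : ℝ≥0)
    (ξ α β : EuclideanSpace ℝ (Fin D)) :
    ∫ ω, Complex.exp ((inner ℝ ξ (X 0 ω) + inner ℝ α (Real.exp t • X t ω - X 0 ω) +
      inner ℝ β (Real.exp (t + γ) • X (t + γ) ω - Real.exp t • X t ω) : ℝ) * Complex.I) ∂P =
    (∫ y, Complex.exp ((inner ℝ ξ y : ℝ) * Complex.I) ∂μ) *
      Complex.exp (-(((Real.exp (2 * t) - 1) * ‖α‖ ^ 2 +
        (Real.exp (2 * (t + γ)) - Real.exp (2 * t)) * ‖β‖ ^ 2) / 2 : ℝ)) := by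
  obtain ⟨hXm, hX0, B, hB, hind, hsol⟩ := hX
  -- Discretized exponent: at fixed n it depends on finitely many values of B, so independence gives
  -- the characteristic function exactly; dominated convergence then passes to n → ∞.
  obtain ⟨S, hS⟩ : ∃ S : ℕ → (ℝ≥0 → EuclideanSpace ℝ (Fin D)) → ℝ, S = fun n f ↦
    ∑ i, (√2 * α i * expSum 0 t n (fun r ↦ f r i) + √2 * β i * expSum t γ n (fun r ↦ f r i)) :=
    ⟨_, rfl⟩
  have hSm : ∀ n, Measurable (S n) := by
    intro n
    rw [hS]
    refine Finset.measurable_sum _ fun i _ ↦ ?_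
    have h1 : Measurable fun (f : ℝ≥0 → EuclideanSpace ℝ (Fin D)) r ↦ f r i := by fun_prop
    exact (((measurable_expSum 0 t n).comp h1).const_mul _).add
      (((measurable_expSum t γ n).comp h1).const_mul _)
  have hBm : Measurable fun ω r ↦ B r ω := measurable_pi_lambda _ hB.measurable
  have hcoef : ∀ n : ℕ, 0 < n → ∫ ω, Complex.exp ((inner ℝ ξ (X 0 ω) + S n (fun r ↦ B r ω) : ℝ) *
      Complex.I) ∂P = (∫ y, Complex.exp ((inner ℝ ξ y : ℝ) * Complex.I) ∂μ) *
      ∏ i, Complex.exp (-(((√2 * α i) ^ 2 *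
        (∑ k ∈ Finset.range n, Real.exp (0 + (k + 1 : ℕ) * (t / n)) ^ 2 * (t / n)) +
      (√2 * β i) ^ 2 * (∑ k ∈ Finset.range n, Real.exp (t + (k + 1 : ℕ) * (γ / n)) ^ 2 * (γ / n)))
        / 2 : ℝ)) := by
    intro n hn
    have h1 := hind.integral_fun_comp_mul_comp
      (f := fun y ↦ Complex.exp ((inner ℝ ξ y : ℝ) * Complex.I))
      (g := fun f ↦ Complex.exp ((S n f : ℝ) * Complex.I)) (hXm 0).aemeasurable hBm.aemeasurable
      (by fun_prop : Continuous _).aestronglyMeasurable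
      (by have := hSm n; fun_prop : Measurable _).aestronglyMeasurable
    have h2 : ∫ ω, Complex.exp ((inner ℝ ξ (X 0 ω) : ℝ) * Complex.I) ∂P =
        ∫ y, Complex.exp ((inner ℝ ξ y : ℝ) * Complex.I) ∂μ := by
      rw [← hX0, integral_map (hXm 0).aemeasurable
        (by fun_prop : Continuous _).aestronglyMeasurable]
    have h3 := hB.indep.integral_fun_prod_comp (f := fun i (f : ℝ≥0 → ℝ) ↦ Complex.exp
      ((√2 * α i * expSum 0 t n f + √2 * β i * expSum t γ n f : ℝ) * Complex.I))
      (fun i ↦ (measurable_pi_lambda _ fun r ↦ by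
        have := hB.measurable r; fun_prop : Measurable _).aemeasurable)
      (fun i ↦ (by
        have := measurable_expSum 0 t n
        have := measurable_expSum t γ n
        fun_prop : Measurable _).aestronglyMeasurable)
    simp only [fun i ↦ integral_cexp_expSum (hB.coord i).toIsPreBrownianReal t.coe_nonneg
      γ.coe_nonneg (√2 * α i) (√2 * β i) hn] at h3
    rw [h2] at h1
    rw [← h3]
    refine Eq.trans (integral_congr_ae (Eventually.of_forall fun ω ↦ ?_))
      (h1.trans (congrArg _ (integral_congr_ae (Eventually.of_forall fun ω ↦ ?_))))
    · simp only
      rw [← Complex.exp_add]; push_cast; ring_nf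
    · simp only [hS]
      rw [Complex.ofReal_sum, Finset.sum_mul, Complex.exp_sum]
  have hlim : ∀ᵐ ω ∂P, Tendsto (fun n ↦ S n (fun r ↦ B r ω)) atTop
      (𝓝 (inner ℝ α (Real.exp t • X t ω - X 0 ω) +
        inner ℝ β (Real.exp (t + γ) • X (t + γ) ω - Real.exp t • X t ω))) := by
    have hcont : ∀ᵐ ω ∂P, ∀ i, Continuous fun r ↦ B r ω i := ae_all_iff.2 fun i ↦ (hB.coord i).cont
    filter_upwards [hsol, hcont] with ω hω hBc
    obtain ⟨hXc, heq⟩ := hω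
    have hcoord : ∀ i (r : ℝ≥0), X r ω i =
        X 0 ω i - (∫ s in (0 : ℝ)..r, X s.toNNReal ω i) + √2 * B r ω i := by
      intro i r
      have h1 := congrArg (fun v ↦ v i) (heq r)
      have h2 := (EuclideanSpace.proj (𝕜 := ℝ) i).intervalIntegral_comp_comm (μ := volume)
        ((hXc.comp continuous_real_toNNReal).intervalIntegrable 0 (r : ℝ))
      simp only [PiLp.add_apply, PiLp.sub_apply, PiLp.smul_apply, smul_eq_mul] at h1
      rw [h1]
      congr 2
      exact h2.symm
    have hXi : ∀ i, Continuous fun r ↦ X r ω i := fun i ↦ by fun_prop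
    have h1 : ∀ i, Real.exp t * X t ω i - X 0 ω i =
        √2 * expIntegral 0 (0 + t) (fun r ↦ B r ω i) := by
      intro i
      have := exp_mul_sub_eq_expIntegral (hXi i) (hBc i) (hcoord i) le_rfl t.coe_nonneg
      simpa using this
    have h2 : ∀ i, Real.exp (t + γ) * X (t + γ) ω i - Real.exp t * X t ω i =
        √2 * expIntegral t (t + γ) (fun r ↦ B r ω i) := by
      intro i
      have := exp_mul_sub_eq_expIntegral (hXi i) (hBc i) (hcoord i) t.coe_nonneg
        (show (t : ℝ) ≤ t + γ by simp)
      rw [← NNReal.coe_add, Real.toNNReal_coe] at this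
      simpa using this
    have h3 : inner ℝ α (Real.exp t • X t ω - X 0 ω) +
        inner ℝ β (Real.exp (t + γ) • X (t + γ) ω - Real.exp t • X t ω) =
        ∑ i, (√2 * α i * expIntegral 0 (0 + t) (fun r ↦ B r ω i) +
          √2 * β i * expIntegral t (t + γ) (fun r ↦ B r ω i)) := by
      rw [PiLp.inner_apply, PiLp.inner_apply, ← Finset.sum_add_distrib]
      refine Finset.sum_congr rfl fun i _ ↦ ?_
      simp only [PiLp.sub_apply, PiLp.smul_apply, smul_eq_mul, RCLike.inner_apply, conj_trivial]
      rw [h1, h2]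
      ring
    rw [h3, hS]
    exact tendsto_finsetSum _ fun i _ ↦
      ((tendsto_expSum (hBc i) 0 t.coe_nonneg).const_mul _).add
        ((tendsto_expSum (hBc i) t γ.coe_nonneg).const_mul _)
  have hL : Tendsto (fun n ↦ ∫ ω, Complex.exp ((inner ℝ ξ (X 0 ω) + S n (fun r ↦ B r ω) : ℝ) *
      Complex.I) ∂P) atTop (𝓝 (∫ ω, Complex.exp ((inner ℝ ξ (X 0 ω) +
      inner ℝ α (Real.exp t • X t ω - X 0 ω) + inner ℝ β (Real.exp (t + γ) • X (t + γ) ω -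
        Real.exp t • X t ω) : ℝ) * Complex.I) ∂P)) := by
    refine tendsto_integral_of_dominated_convergence (fun _ ↦ 1) (fun n ↦ ?_)
      (integrable_const _) (fun n ↦ Eventually.of_forall fun ω ↦ ?_) ?_
    · have h1 := (hSm n).comp hBm
      have h2 := hXm 0
      have h3 : Measurable fun ω ↦ (inner ℝ ξ (X 0 ω) + S n (fun r ↦ B r ω) : ℝ) :=
        (by fun_prop : Measurable fun ω ↦ (inner ℝ ξ (X 0 ω) : ℝ)).add h1
      exact (by fun_prop : Measurable _).aestronglyMeasurable
    · rw [Complex.norm_exp_ofReal_mul_I]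
    · filter_upwards [hlim] with ω hω
      have h1 : Continuous fun x : ℝ ↦ Complex.exp ((inner ℝ ξ (X 0 ω) + x : ℝ) * Complex.I) := by
        fun_prop
      have h2 := (h1.tendsto _).comp hω
      simp only [← add_assoc] at h2
      exact h2
  have hR : Tendsto (fun n : ℕ ↦ (∫ y, Complex.exp ((inner ℝ ξ y : ℝ) * Complex.I) ∂μ) *
      ∏ i, Complex.exp (-(((√2 * α i) ^ 2 *
        (∑ k ∈ Finset.range n, Real.exp (0 + (k + 1 : ℕ) * (t / n)) ^ 2 * (t / n)) +
      (√2 * β i) ^ 2 * (∑ k ∈ Finset.range n, Real.exp (t + (k + 1 : ℕ) * (γ / n)) ^ 2 * (γ / n)))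
        / 2 : ℝ))) atTop (𝓝 ((∫ y, Complex.exp ((inner ℝ ξ y : ℝ) * Complex.I) ∂μ) *
      ∏ i, Complex.exp (-(((√2 * α i) ^ 2 * ((Real.exp (2 * (0 + t)) - Real.exp (2 * 0)) / 2) +
      (√2 * β i) ^ 2 * ((Real.exp (2 * (t + γ)) - Real.exp (2 * t)) / 2)) / 2 : ℝ)))) := by
    refine Tendsto.const_mul _ (tendsto_finsetProd _ fun i _ ↦ ?_)
    have h1 := ((tendsto_sum_exp_sq 0 t.coe_nonneg).const_mul ((√2 * α i) ^ 2)).add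
      ((tendsto_sum_exp_sq t γ.coe_nonneg).const_mul ((√2 * β i) ^ 2))
    have h2 : Continuous fun x : ℝ ↦ Complex.exp (-(x / 2 : ℝ)) := by fun_prop
    exact (h2.tendsto _).comp h1
  have heq := tendsto_nhds_unique hL (hR.congr' (by
    filter_upwards [eventually_gt_atTop 0] with n hn using (hcoef n hn).symm))
  rw [heq, ← Complex.exp_sum]
  congr 2
  have h2 : (√2 : ℝ) ^ 2 = 2 := Real.sq_sqrt (by norm_num)
  rw [Finset.sum_neg_distrib, neg_inj, ← Complex.ofReal_sum]
  congr 1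
  rw [EuclideanSpace.real_norm_sq_eq, EuclideanSpace.real_norm_sq_eq, Finset.mul_sum,
    Finset.mul_sum, ← Finset.sum_add_distrib, Finset.sum_div]
  refine Finset.sum_congr rfl fun i _ ↦ ?_
  rw [mul_pow, mul_pow, h2]
  simp only [zero_add, mul_zero, Real.exp_zero]
  ring

end OrnsteinUhlenbeck

/-! ### Sets of positive reach and Federer's inequality -/

section Reach

open Filter Topology

variable {E : Type*} [NormedAddCommGroup E] {M : Set E} {ρ : ℝ}

/-- Every point at distance less than `ρ` from `M` has at most one nearest point on `M`. -/
def UniqueNearest (M : Set E) (ρ : ℝ) : Prop :=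
  ∀ x, Metric.infDist x M < ρ → ∀ a ∈ M, ∀ b ∈ M, Metric.infDist x M = ‖x - a‖ →
    Metric.infDist x M = ‖x - b‖ → a = b

lemma exists_nearest (hM : IsCompact M) (hne : M.Nonempty) (x : E) :
    ∃ a ∈ M, Metric.infDist x M = ‖x - a‖ := by
  obtain ⟨a, ha, h⟩ := hM.exists_infDist_eq_dist hne x
  exact ⟨a, ha, by rw [h, dist_eq_norm]⟩

lemma infDist_le_norm_sub (x : E) {a : E} (ha : a ∈ M) : Metric.infDist x M ≤ ‖x - a‖ := by
  rw [← dist_eq_norm]; exact Metric.infDist_le_dist_of_mem ha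

lemma infDist_le_infDist_add_norm_sub (x x' : E) :
    Metric.infDist x M ≤ Metric.infDist x' M + ‖x - x'‖ := by
  rw [← dist_eq_norm]; exact Metric.infDist_le_infDist_add_dist

/-- The nearest point projection is continuous. -/
lemma exists_norm_nearest_sub_lt (hM : IsCompact M) {x a : E}
    (huniq : ∀ b ∈ M, Metric.infDist x M = ‖x - b‖ → b = a) {ε : ℝ} (hε : 0 < ε) :
    ∃ κ > 0, ∀ x', ‖x' - x‖ < κ → ∀ a' ∈ M, Metric.infDist x' M = ‖x' - a'‖ → ‖a' - a‖ < ε := by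
  have hK : IsCompact (M ∩ {m | ε ≤ ‖m - a‖}) :=
    hM.inter_right (isClosed_le continuous_const (by fun_prop))
  rcases (M ∩ {m | ε ≤ ‖m - a‖}).eq_empty_or_nonempty with h | h
  · refine ⟨1, one_pos, fun x' _ a' ha' _ ↦ ?_⟩
    by_contra! hcon
    exact (h ▸ (⟨ha', hcon⟩ : a' ∈ M ∩ {m | ε ≤ ‖m - a‖}) : a' ∈ (∅ : Set E))
  · obtain ⟨m, hm, hmin⟩ := hK.exists_isMinOn h
      (f := fun m ↦ ‖x - m‖) (by fun_prop)
    have hlt : Metric.infDist x M < ‖x - m‖ := by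
      refine lt_of_le_of_ne (infDist_le_norm_sub x hm.1) fun heq ↦ ?_
      have h1 := hm.2
      rw [huniq m hm.1 heq] at h1
      simp only [mem_ofPred_eq, sub_self, norm_zero] at h1
      linarith
    refine ⟨(‖x - m‖ - Metric.infDist x M) / 2, by linarith, fun x' hx' a' ha' hn ↦ ?_⟩
    by_contra! hcon
    have h1 : ‖x - m‖ ≤ ‖x - a'‖ := hmin ⟨ha', hcon⟩
    have h2 : ‖x - a'‖ ≤ ‖x' - x‖ + ‖x' - a'‖ := by
      have := norm_sub_le_norm_sub_add_norm_sub x x' a'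
      rwa [norm_sub_rev x x'] at this
    have h3 := infDist_le_infDist_add_norm_sub (M := M) x' x
    linarith

variable [InnerProductSpace ℝ E]

/-- Away from `M`, the distance to `M` grows with slope `1` in the direction opposite to the
nearest point. -/
lemma exists_infDist_add_smul_ge (hM : IsCompact M) {x a : E} (haM : a ∈ M)
    (ha : Metric.infDist x M = ‖x - a‖)
    (huniq : ∀ b ∈ M, Metric.infDist x M = ‖x - b‖ → b = a) (hpos : 0 < Metric.infDist x M)
    {r : ℝ} (hr0 : 0 ≤ r) (hr : r < 1) :
    ∃ κ > 0, ∀ k, 0 ≤ k → k < κ →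
      Metric.infDist x M + r * k ≤ Metric.infDist (x + (k / ‖x - a‖) • (x - a)) M := by
  set δ := Metric.infDist x M with hδ
  obtain ⟨κ, hκ, h⟩ := exists_norm_nearest_sub_lt hM huniq
    (ε := (1 - r) * δ) (mul_pos (by linarith) hpos)
  refine ⟨κ, hκ, fun k hk0 hk ↦ ?_⟩
  have hxa : 0 < ‖x - a‖ := by rw [← ha]; exact hpos
  set n := (1 / ‖x - a‖) • (x - a) with hn
  have hn1 : ‖n‖ = 1 := by
    rw [hn, norm_smul, Real.norm_of_nonneg (by positivity)]; field_simp
  have hkn : (k / ‖x - a‖) • (x - a) = k • n := by rw [hn, smul_smul]; congr 1; ring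
  rw [hkn]
  obtain ⟨a', ha'M, ha'⟩ := exists_nearest hM ⟨a, haM⟩ (x + k • n)
  have h1 : ‖a' - a‖ < (1 - r) * δ := by
    refine h _ ?_ a' ha'M ha'
    rw [add_sub_cancel_left, norm_smul, hn1, mul_one, Real.norm_of_nonneg hk0]
    exact hk
  have h2 : δ ≤ ‖x - a'‖ := infDist_le_norm_sub x ha'M
  have h3 : r * δ ≤ inner ℝ n (x - a') := by
    have h4 : inner ℝ n (x - a') = inner ℝ n (x - a) - inner ℝ n (a' - a) := by
      rw [← inner_sub_right]; congr 1; abel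
    have h5 : inner ℝ n (x - a) = δ := by
      rw [hn, inner_smul_left, real_inner_self_eq_norm_sq, conj_trivial, ha]; field_simp
    have h6 := real_inner_le_norm n (a' - a)
    rw [hn1, one_mul] at h6
    rw [h4, h5]
    linarith
  rw [ha']
  refine abs_le_of_sq_le_sq' ?_ (norm_nonneg _) |>.2
  have h7 : x + k • n - a' = (x - a') + k • n := by abel
  rw [h7, norm_add_sq_real, norm_smul, hn1, inner_smul_right, real_inner_comm, mul_one,
    Real.norm_of_nonneg hk0]
  have h8 : δ ^ 2 ≤ ‖x - a'‖ ^ 2 := by gcongr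
  have h9 : r ^ 2 ≤ 1 := by nlinarith
  nlinarith [mul_le_mul_of_nonneg_left h3 hk0, mul_le_mul_of_nonneg_right h9 (sq_nonneg k)]

variable [FiniteDimensional ℝ E]

/-- Replaces following the gradient flow of the distance function: a point realizing the largest
possible increase is obtained by maximizing over a ball. -/
lemma exists_mem_closedBall_infDist_ge (hM : IsCompact M) (hne : M.Nonempty)
    (hρ : UniqueNearest M ρ) {x : E} (hpos : 0 < Metric.infDist x M) {h : ℝ} (hh : 0 ≤ h)
    (hlt : Metric.infDist x M + h < ρ) :
    ∃ x' ∈ Metric.closedBall x h, Metric.infDist x M + h ≤ Metric.infDist x' M := by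
  have hcomp : IsCompact (Metric.closedBall x h) := isCompact_closedBall x h
  have hxmem : x ∈ Metric.closedBall x h := Metric.mem_closedBall_self hh
  have hcont : Continuous fun z ↦ Metric.infDist z M := Metric.continuous_infDist_pt M
  -- Maximize the distance penalized by r ‖z - x‖. An interior maximizer could be moved away from M
  -- with gain rate (1 + r)/2 > r, so the maximizer lies on the sphere; then r → 1.
  have key : ∀ r, 0 ≤ r → r < 1 → ∃ z ∈ Metric.closedBall x h,
      Metric.infDist x M + r * h ≤ Metric.infDist z M := by
    intro r hr0 hr1
    obtain ⟨z, hz, hmax⟩ := hcomp.exists_isMaxOn ⟨x, hxmem⟩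
      (f := fun z ↦ Metric.infDist z M - r * ‖z - x‖) (by fun_prop)
    have hz' : ‖z - x‖ ≤ h := by rwa [mem_closedBall_iff_norm] at hz
    have h1 : Metric.infDist x M ≤ Metric.infDist z M - r * ‖z - x‖ := by
      have : Metric.infDist x M - r * ‖x - x‖ ≤ Metric.infDist z M - r * ‖z - x‖ := hmax hxmem
      simpa using this
    rcases hz'.lt_or_eq with hlt' | heq
    · exfalso
      obtain ⟨a, haM, ha⟩ := exists_nearest hM hne z
      have hzpos : 0 < Metric.infDist z M := by
        have : 0 ≤ r * ‖z - x‖ := by positivity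
        linarith
      have hzρ : Metric.infDist z M < ρ := by
        have := infDist_le_infDist_add_norm_sub (M := M) z x
        linarith
      obtain ⟨κ, hκ, hstep⟩ := exists_infDist_add_smul_ge hM haM ha
        (fun b hb hb' ↦ hρ z hzρ b hb a haM hb' ha) hzpos (r := (1 + r) / 2)
        (by linarith) (by linarith)
      obtain ⟨k, hk0, hk⟩ := exists_between (lt_min hκ (sub_pos.2 hlt'))
      have hkκ := hk.trans_le (min_le_left _ _)
      have hkh := hk.trans_le (min_le_right _ _)
      have hs := hstep k hk0.le hkκ
      have hza : 0 < ‖z - a‖ := by rw [← ha]; exact hzpos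
      have hnorm : ‖(k / ‖z - a‖) • (z - a)‖ = k := by
        rw [norm_smul, Real.norm_of_nonneg (by positivity)]; field_simp
      set z' := z + (k / ‖z - a‖) • (z - a) with hz'def
      have hz'x : ‖z' - x‖ ≤ ‖z - x‖ + k := by
        have : z' - x = (z - x) + (k / ‖z - a‖) • (z - a) := by rw [hz'def]; abel
        rw [this]
        exact (norm_add_le _ _).trans (by rw [hnorm])
      have hz'mem : z' ∈ Metric.closedBall x h := by
        rw [mem_closedBall_iff_norm]; linarith
      have h2 : Metric.infDist z' M - r * ‖z' - x‖ ≤ Metric.infDist z M - r * ‖z - x‖ :=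
        hmax hz'mem
      nlinarith
    · exact ⟨z, hz, by rw [heq] at h1; linarith⟩
  obtain ⟨z, hz, hmax⟩ := hcomp.exists_isMaxOn ⟨x, hxmem⟩ (f := fun z ↦ Metric.infDist z M)
    hcont.continuousOn
  refine ⟨z, hz, ?_⟩
  have h1 : ∀ r, 0 ≤ r → r < 1 → Metric.infDist x M + r * h ≤ Metric.infDist z M := by
    intro r hr0 hr1
    obtain ⟨w, hw, hle⟩ := key r hr0 hr1
    exact hle.trans (hmax hw)
  have h2 : Tendsto (fun r : ℝ ↦ Metric.infDist x M + r * h) (𝓝[<] 1)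
      (𝓝 (Metric.infDist x M + 1 * h)) := by
    have : Continuous fun r : ℝ ↦ Metric.infDist x M + r * h := by fun_prop
    exact (this.tendsto 1).mono_left nhdsWithin_le_nhds
  rw [one_mul] at h2
  refine le_of_tendsto h2 ?_
  filter_upwards [Ioo_mem_nhdsLT (show (0 : ℝ) < 1 by norm_num)] with r hr using h1 r hr.1.le hr.2

/-- The ball of radius `r` touching `M` from outside at the nearest point `a` of `x` does not meet
`M`. -/
lemma two_mul_inner_sub_nearest_le (hM : IsCompact M) (hρ : UniqueNearest M ρ) {x a : E}
    (haM : a ∈ M) (ha : Metric.infDist x M = ‖x - a‖) (hpos : 0 < ‖x - a‖) {r : ℝ}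
    (hr : ‖x - a‖ ≤ r) (hrρ : r < ρ) {b : E} (hb : b ∈ M) :
    2 * r * inner ℝ (x - a) (b - a) ≤ ‖x - a‖ * ‖b - a‖ ^ 2 := by
  obtain ⟨x', hx', hge⟩ := exists_mem_closedBall_infDist_ge hM ⟨a, haM⟩ hρ (x := x)
    (by rwa [ha]) (h := r - ‖x - a‖) (by linarith) (by rw [ha]; linarith)
  rw [ha, add_sub_cancel] at hge
  rw [mem_closedBall_iff_norm] at hx'
  obtain ⟨δ, hδ⟩ : ∃ δ, δ = ‖x - a‖ := ⟨_, rfl⟩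
  rw [← hδ] at hr hx' hpos ⊢
  have h1 : r ≤ ‖x' - a‖ := hge.trans (infDist_le_norm_sub x' haM)
  have h2 : r ≤ ‖x' - b‖ := hge.trans (infDist_le_norm_sub x' hb)
  have hr0 : 0 < r := hpos.trans_le hr
  have h3 : ‖x' - a‖ ^ 2 = ‖x' - x‖ ^ 2 + 2 * inner ℝ (x' - x) (x - a) + δ ^ 2 := by
    rw [hδ, ← norm_add_sq_real]; congr 2; abel
  have h4 : (r - δ) * δ ≤ inner ℝ (x' - x) (x - a) := by
    have h5 : r ^ 2 ≤ ‖x' - a‖ ^ 2 := by gcongr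
    have h6 : ‖x' - x‖ ^ 2 ≤ (r - δ) ^ 2 := by gcongr
    nlinarith
  -- Equality case of the triangle inequality: x' is at distance at most r - δ from x and at least r
  -- from a, hence on the ray from a through x. The open ball of radius r around x' misses M and has
  -- a on its boundary.
  have h7 : δ • (x' - a) = r • (x - a) := by
    have h8 : ‖δ • (x' - x) - (r - δ) • (x - a)‖ ^ 2 ≤ 0 := by
      rw [norm_sub_sq_real, norm_smul, norm_smul, inner_smul_left, inner_smul_right, ← hδ,
        conj_trivial, mul_pow, mul_pow, Real.norm_eq_abs, Real.norm_eq_abs, sq_abs, sq_abs]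
      have h6 : ‖x' - x‖ ^ 2 ≤ (r - δ) ^ 2 := by gcongr
      have h9 : 0 ≤ δ * (r - δ) := mul_nonneg hpos.le (by linarith)
      nlinarith [mul_le_mul_of_nonneg_left h6 (sq_nonneg δ), mul_le_mul_of_nonneg_left h4 h9]
    have h9 : δ • (x' - x) - (r - δ) • (x - a) = 0 := by
      have : ‖δ • (x' - x) - (r - δ) • (x - a)‖ ^ 2 = 0 := le_antisymm h8 (sq_nonneg _)
      simpa using this
    have h10 : δ • (x' - a) - r • (x - a) = δ • (x' - x) - (r - δ) • (x - a) := by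
      rw [smul_sub, smul_sub, smul_sub, smul_sub, sub_smul, sub_smul]; abel
    rw [← sub_eq_zero, h10, h9]
  have h11 : ‖x' - b‖ ^ 2 = ‖x' - a‖ ^ 2 - 2 * inner ℝ (x' - a) (b - a) + ‖b - a‖ ^ 2 := by
    rw [← norm_sub_sq_real]; congr 2; abel
  have h12 : ‖x' - a‖ = r := by
    have := congrArg norm h7
    rw [norm_smul, norm_smul, ← hδ, Real.norm_of_nonneg hpos.le, Real.norm_of_nonneg hr0.le,
      mul_comm r δ] at this
    exact mul_left_cancel₀ hpos.ne' this
  have h13 : δ * inner ℝ (x' - a) (b - a) = r * inner ℝ (x - a) (b - a) := by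
    have := congrArg (fun v ↦ inner ℝ v (b - a)) h7
    simpa [inner_smul_left] using this
  have h14 : r ^ 2 ≤ ‖x' - b‖ ^ 2 := by gcongr
  rw [h11, h12] at h14
  nlinarith

/-- Vectors orthogonal to all limits of secants are almost orthogonal to short secants. -/
lemma exists_abs_inner_sub_le {y v : E} (hv : ∀ u ∈ tangentConeAt ℝ M y, inner ℝ u v = 0)
    {ε : ℝ} (hε : 0 < ε) :
    ∃ κ > 0, ∀ m ∈ M, ‖m - y‖ < κ → |inner ℝ (m - y) v| ≤ ε * ‖m - y‖ := by
  by_contra! hcon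
  -- Otherwise normalized secants along a sequence tending to y subconverge to a unit vector of the
  -- tangent cone that is not orthogonal to v.
  choose m hmM hmy hm using fun j : ℕ ↦ hcon (1 / ((j : ℝ) + 1)) (by positivity)
  have hne : ∀ j, 0 < ‖m j - y‖ := by
    intro j
    by_contra! h
    have h0 : m j - y = 0 := norm_le_zero_iff.1 h
    have := hm j
    simp [h0] at this
  have hsphere : ∀ j, (‖m j - y‖)⁻¹ • (m j - y) ∈ Metric.sphere (0 : E) 1 := by
    intro j
    rw [mem_sphere_zero_iff_norm, norm_smul, norm_inv, norm_norm, inv_mul_cancel₀ (hne j).ne']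
  obtain ⟨u, -, φ, hφ, hlim⟩ := (isCompact_sphere (0 : E) 1).tendsto_subseq hsphere
  have hdt : Tendsto (fun j ↦ m j - y) atTop (𝓝 0) :=
    squeeze_zero_norm (fun j ↦ (hmy j).le) tendsto_one_div_add_atTop_nhds_zero_nat
  have hu : u ∈ tangentConeAt ℝ M y := by
    refine mem_tangentConeAt_of_seq atTop (fun j ↦ (‖m (φ j) - y‖)⁻¹) (fun j ↦ m (φ j) - y)
      (hdt.comp hφ.tendsto_atTop) (Eventually.of_forall fun j ↦ ?_) hlim
    rw [add_sub_cancel]; exact hmM _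
  have hc : Continuous fun w : E ↦ |inner ℝ w v| := by fun_prop
  have hge : ε ≤ |inner ℝ u v| := by
    refine ge_of_tendsto ((hc.tendsto u).comp hlim) (Eventually.of_forall fun j ↦ ?_)
    simp only [Function.comp_apply]
    rw [inner_smul_left, conj_trivial, abs_mul, abs_inv, abs_norm, inv_mul_eq_div,
      le_div_iff₀ (hne _)]
    exact (hm _).le
  rw [hv u hu] at hge
  simp only [abs_zero] at hge
  linarith

/-- Federer's inequality for unit normal vectors of a set of positive reach. -/
lemma two_mul_inner_normal_le (hM : IsCompact M) (hρ : UniqueNearest M ρ) {y v : E} (hy : y ∈ M)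
    (hv1 : ‖v‖ = 1) (hv : ∀ u ∈ tangentConeAt ℝ M y, inner ℝ u v = 0) {r : ℝ} (hr : 0 < r)
    (hrρ : r < ρ) {b : E} (hb : b ∈ M) :
    2 * r * inner ℝ v (b - y) ≤ ‖b - y‖ ^ 2 := by
  -- The touching-ball estimate applies only to vectors x - a with a nearest to x. The normal v is
  -- approximated by such vectors at nearby points, starting from x = y + s' v, and the inequality
  -- passes to the limit.
  have key : ∀ ε, 0 < ε → ε ≤ 1 → ∃ a w : E, ‖a - y‖ ≤ ε ∧ ‖w - v‖ ≤ ε ∧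
      2 * r * inner ℝ w (b - a) ≤ ‖b - a‖ ^ 2 := by
    intro ε hε hε1
    obtain ⟨κ, hκ, hsec⟩ := exists_abs_inner_sub_le hv (ε := ε / 4) (by positivity)
    obtain ⟨s, hs0, hs⟩ := exists_between (lt_min (lt_min hκ one_pos) hr)
    have hsκ := (hs.trans_le (min_le_left _ _)).trans_le (min_le_left _ _)
    have hs1 := (hs.trans_le (min_le_left _ _)).trans_le (min_le_right _ _)
    have hsr := hs.trans_le (min_le_right _ _)
    -- Half of s, because the nearest point a satisfies only ‖a - y‖ ≤ 2 s', and this must stay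
    -- below κ.
    obtain ⟨s', hs', hs's⟩ : ∃ s', 0 < s' ∧ s' = s / 2 := ⟨s / 2, by positivity, rfl⟩
    obtain ⟨x, hx⟩ : ∃ x, x = y + s' • v := ⟨_, rfl⟩
    have hxy : ‖x - y‖ = s' := by
      rw [hx, add_sub_cancel_left, norm_smul, hv1, mul_one, Real.norm_of_nonneg hs'.le]
    obtain ⟨a, haM, ha⟩ := exists_nearest hM ⟨y, hy⟩ x
    have hxa : ‖x - a‖ ≤ s' := by rw [← ha, ← hxy]; exact infDist_le_norm_sub x hy
    have hay : ‖a - y‖ ≤ s := by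
      have := norm_sub_le_norm_sub_add_norm_sub a x y
      rw [norm_sub_rev a x] at this
      linarith
    have hay2 : ‖a - y‖ ≤ s' * (ε / 2) := by
      have h1 : x - a = s' • v - (a - y) := by rw [hx]; abel
      have h2 : ‖x - a‖ ^ 2 = s' ^ 2 - 2 * (s' * inner ℝ (a - y) v) + ‖a - y‖ ^ 2 := by
        rw [h1, norm_sub_sq_real, norm_smul, hv1, inner_smul_left, conj_trivial, mul_one,
          Real.norm_of_nonneg hs'.le, real_inner_comm]
      have h3 : ‖x - a‖ ^ 2 ≤ s' ^ 2 := by gcongr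
      have h4 := (le_abs_self _).trans (hsec a haM (lt_of_le_of_lt hay hsκ))
      have h5 : ‖a - y‖ ^ 2 ≤ s' * (ε / 2) * ‖a - y‖ := by
        nlinarith [mul_le_mul_of_nonneg_left h4 hs'.le]
      by_contra! hcon
      have h6 : 0 < ‖a - y‖ := lt_trans (by positivity) hcon
      nlinarith
    have hdiff : ‖(x - a) - s' • v‖ ≤ s' * (ε / 2) := by
      have : (x - a) - s' • v = -(a - y) := by rw [hx]; abel
      rwa [this, norm_neg]
    have hxapos : 0 < ‖x - a‖ := by
      have h1 := norm_sub_norm_le (s' • v) (x - a)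
      rw [norm_sub_rev (s' • v) (x - a), norm_smul, hv1, mul_one,
        Real.norm_of_nonneg hs'.le] at h1
      nlinarith
    have h7 := two_mul_inner_sub_nearest_le hM hρ haM ha hxapos (r := r) (by linarith) hrρ hb
    refine ⟨a, s'⁻¹ • (x - a), ?_, ?_, ?_⟩
    · nlinarith
    · have h8 : s'⁻¹ • (x - a) - v = s'⁻¹ • ((x - a) - s' • v) := by
        rw [smul_sub _ (x - a), inv_smul_smul₀ hs'.ne']
      rw [h8, norm_smul, norm_inv, Real.norm_of_nonneg hs'.le, inv_mul_le_iff₀ hs']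
      nlinarith
    · rw [inner_smul_left, conj_trivial]
      have h9 : 2 * r * inner ℝ (x - a) (b - a) ≤ s' * ‖b - a‖ ^ 2 :=
        h7.trans (by gcongr)
      have h10 : 2 * r * (s'⁻¹ * inner ℝ (x - a) (b - a)) =
          s'⁻¹ * (2 * r * inner ℝ (x - a) (b - a)) := by ring
      rw [h10, inv_mul_le_iff₀ hs']
      exact h9
  choose a w ha hw h using fun j : ℕ ↦ key (1 / ((j : ℝ) + 1)) (by positivity)
    (by rw [div_le_one (by positivity)]; have := j.cast_nonneg (α := ℝ); linarith)
  have ha' : Tendsto a atTop (𝓝 y) := by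
    rw [tendsto_iff_norm_sub_tendsto_zero]
    exact squeeze_zero (fun _ ↦ norm_nonneg _) ha tendsto_one_div_add_atTop_nhds_zero_nat
  have hw' : Tendsto w atTop (𝓝 v) := by
    rw [tendsto_iff_norm_sub_tendsto_zero]
    exact squeeze_zero (fun _ ↦ norm_nonneg _) hw tendsto_one_div_add_atTop_nhds_zero_nat
  exact le_of_tendsto_of_tendsto' ((hw'.inner (tendsto_const_nhds.sub ha')).const_mul (2 * r))
    ((tendsto_const_nhds.sub ha').norm.pow 2) h

end Reach

/-! ### Charts, volume and mass of small balls -/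

section Charts

open Filter Topology Module

variable {D : ℕ} {M : Set (EuclideanSpace ℝ (Fin D))} {y : EuclideanSpace ℝ (Fin D)}

lemma uniqueNearest_of_lt_reach (hM : 0 < reach M) {ρ : ℝ} (hρ : ρ < reach M) :
    UniqueNearest M ρ := by
  have hne : {ε : ℝ | ∀ x, Metric.infDist x M < ε →
      ∃! y, y ∈ M ∧ Metric.infDist x M = ‖x - y‖}.Nonempty := by
    by_contra h
    -- The real supremum of the empty set is 0, so positive reach forces admissible radii to exist.
    rw [reach, not_nonempty_iff_eq_empty.1 h, Real.sSup_empty] at hM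
    exact lt_irrefl _ hM
  obtain ⟨ε, hε, hlt⟩ := exists_lt_of_lt_csSup hne hρ
  intro x hx a ha b hb hxa hxb
  exact (hε x (hx.trans hlt)).unique ⟨ha, hxa⟩ ⟨hb, hxb⟩

/-- The inverse projection maps the origin of the tangent space to the base point. -/
lemma IsInverseProjection.apply_zero {Φ : tangentSpace M y → EuclideanSpace ℝ (Fin D)}
    (hΦ : IsInverseProjection M y Φ) (hM : IsCompact M) (hτ : 0 < reach M) (hy : y ∈ M) :
    Φ 0 = y := by
  obtain ⟨⟨hqM, hqy⟩, hq⟩ := hΦ 0 (Metric.mem_ball_self (by positivity))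
  rw [mem_ball_iff_norm] at hqy
  rw [Submodule.orthogonalProjectionOnto_eq_zero_iff] at hq
  by_contra hne
  have hpos : 0 < ‖Φ 0 - y‖ := norm_pos_iff.2 (sub_ne_zero.2 hne)
  -- Φ(0) - y is normal to M at y. Federer's inequality with radius τ/2 would force ‖Φ(0) - y‖ ≥ τ
  -- if it were nonzero, while the chart stays within τ/4.
  have h := two_mul_inner_normal_le hM
    (uniqueNearest_of_lt_reach hτ (ρ := 3 / 4 * reach M) (by linarith)) hy
    (v := ‖Φ 0 - y‖⁻¹ • (Φ 0 - y))
    (by rw [norm_smul, norm_inv, norm_norm, inv_mul_cancel₀ hpos.ne'])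
    (fun u hu ↦ by
      rw [inner_smul_right, (Submodule.mem_orthogonal _ _).1 hq u (Submodule.subset_span hu),
        mul_zero])
    (r := reach M / 2) (by positivity) (by linarith) hqM
  rw [inner_smul_left, conj_trivial, real_inner_self_eq_norm_sq] at h
  have h1 : ‖Φ 0 - y‖⁻¹ * ‖Φ 0 - y‖ ^ 2 = ‖Φ 0 - y‖ := by field_simp
  rw [h1] at h
  nlinarith

/-- The tangent spaces of a `d`-dimensional manifold have dimension at least `d`. -/
lemma IsSmoothManifold.le_finrank_tangentSpace {d β : ℕ} (hM : IsSmoothManifold d β M)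
    (hβ : 1 ≤ β) (hy : y ∈ M) : d ≤ finrank ℝ (tangentSpace M y) := by
  obtain ⟨L, Φ, U, V, hU, h0, hV, hΦ, hΦ0, horth, himage⟩ := hM y hy
  have hdiff : DifferentiableAt ℝ Φ 0 :=
    (hΦ.differentiableOn (by exact_mod_cast (by lia : β ≠ 0))).differentiableAt (hU.mem_nhds h0)
  set A := fderiv ℝ Φ 0
  have hA : HasFDerivAt Φ A 0 := hdiff.hasFDerivAt
  have hrange : ∀ w, A w ∈ tangentSpace M y := by
    intro w
    have hw : w ∈ tangentConeAt ℝ U 0 := by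
      rw [tangentConeAt_of_mem_nhds (hU.mem_nhds h0)]; trivial
    have h1 := (hA.hasFDerivWithinAt (s := U)).mapsTo_tangent_cone hw
    rw [hΦ0, himage] at h1
    exact Submodule.subset_span (tangentConeAt_mono inter_subset_left h1)
  -- Differentiating the graph condition: A is L plus a part orthogonal to the range of L, so A w =
  -- 0 forces L w = 0. Thus A embeds ℝ^d in the tangent space.
  have hinner : ∀ w w', inner ℝ (A w - L w) (L w') = 0 := by
    intro w w'
    have h1 : HasFDerivAt (fun z ↦ inner ℝ (L w') (Φ z - y - L z))
        ((innerSL ℝ (L w')).comp (A - L.toContinuousLinearMap)) 0 :=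
      (innerSL ℝ (L w')).hasFDerivAt.comp 0
        ((hA.sub_const y).sub L.toContinuousLinearMap.hasFDerivAt)
    have h2 : (fun z ↦ inner ℝ (L w') (Φ z - y - L z)) =ᶠ[𝓝 0] fun _ ↦ (0 : ℝ) := by
      filter_upwards [hU.mem_nhds h0] with z hz
      rw [real_inner_comm]
      exact horth z hz w'
    have h3 := h1.unique ((hasFDerivAt_const (0 : ℝ) _).congr_of_eventuallyEq h2)
    rw [real_inner_comm]
    rw [inner_sub_right]
    simpa using congrArg (fun T ↦ T w) h3
  have hinj : Function.Injective (A.toLinearMap.codRestrict (tangentSpace M y) hrange) := by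
    rw [← LinearMap.ker_eq_bot, LinearMap.ker_eq_bot']
    intro w hw
    have hw' : A w = 0 := congrArg Subtype.val hw
    have h1 := hinner w w
    rw [hw', zero_sub, inner_neg_left, real_inner_self_eq_norm_sq, L.norm_map] at h1
    simpa using h1
  simpa using LinearMap.finrank_le_finrank_of_injective hinj

/-- A finite-dimensional inner product space contains isometric copies of all Euclidean spaces of
smaller dimension. -/
lemma nonempty_linearIsometry_of_le_finrank {F : Type*} [NormedAddCommGroup F]
    [InnerProductSpace ℝ F] [FiniteDimensional ℝ F] {d : ℕ} (h : d ≤ finrank ℝ F) :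
    Nonempty (EuclideanSpace ℝ (Fin d) →ₗᵢ[ℝ] F) := by
  let b := EuclideanSpace.basisFun (Fin d) ℝ
  let b' := stdOrthonormalBasis ℝ F
  refine ⟨LinearMap.isometryOfOrthonormal
    (b.toBasis.constr ℝ fun i ↦ b' (Fin.castLE h i)) (v := b.toBasis) ?_ ?_⟩
  · simp [b.orthonormal]
  · have : (b.toBasis.constr ℝ fun i ↦ b' (Fin.castLE h i)) ∘ b.toBasis =
        b' ∘ Fin.castLE h := by
      ext1 i
      simp
    rw [this]
    exact b'.orthonormal.comp _ (Fin.castLE_injective h)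

/-- The inscribed cube of half-side r/√d suffices: the resulting loss is only logarithmic in the
final bound. -/
lemma ofReal_pow_le_volume_ball (d : ℕ) (hd : 0 < d) {r : ℝ} (hr : 0 < r) :
    ENNReal.ofReal ((2 * r / √d) ^ d) ≤ volume (Metric.ball (0 : EuclideanSpace ℝ (Fin d)) r) := by
  have hd' : (0 : ℝ) < d := by exact_mod_cast hd
  have h1 : volume (Metric.ball (0 : Fin d → ℝ) (r / √d)) =
      ENNReal.ofReal ((2 * r / √d) ^ d) := by
    rw [Real.volume_pi_ball _ (by positivity), Fintype.card_fin, mul_div_assoc]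
  rw [← h1, ← (PiLp.volume_preserving_toLp (Fin d)).measure_preimage
    Metric.isOpen_ball.measurableSet.nullMeasurableSet]
  refine measure_mono fun x hx ↦ ?_
  rw [mem_ball_zero_iff, pi_norm_lt_iff (by positivity)] at hx
  rw [mem_preimage, mem_ball_zero_iff, EuclideanSpace.norm_eq, Real.sqrt_lt' hr]
  have : Nonempty (Fin d) := ⟨⟨0, hd⟩⟩
  calc ∑ i, ‖(WithLp.toLp 2 x : EuclideanSpace ℝ (Fin d)) i‖ ^ 2
      < ∑ _i : Fin d, (r / √d) ^ 2 :=
        Finset.sum_lt_sum_of_nonempty Finset.univ_nonempty fun i _ ↦ by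
          have := hx i
          simp only
          gcongr
    _ = r ^ 2 := by
        rw [Finset.sum_const, Finset.card_univ, Fintype.card_fin, nsmul_eq_mul, div_pow,
          Real.sq_sqrt hd'.le]
        field_simp

/-- Lower bound for the volume of small balls of a manifold. -/
lemma ofReal_pow_le_euclideanHausdorffMeasure {d β : ℕ} {LM : ℝ} (hM : RegularManifold d β LM M)
    (hβ : 1 ≤ β) (hy : y ∈ M) {r ε : ℝ} (hr : 0 < r) (hrτ : r ≤ reach M / 8) (hrε : LM * r ≤ ε) :
    ENNReal.ofReal ((2 * r / √d) ^ d) ≤ μHE[d] (M ∩ Metric.closedBall y ε) := by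
  obtain ⟨Φ, hΦ, hsmooth, hbound⟩ := hM.chart y hy
  have hΦ0 := hΦ.apply_zero hM.compact hM.reach_pos hy
  obtain ⟨J⟩ := nonempty_linearIsometry_of_le_finrank
    (hM.smooth.le_finrank_tangentSpace hβ hy)
  have hsub : Metric.ball (0 : tangentSpace M y) r ⊆ Metric.ball 0 (reach M / 8) :=
    Metric.ball_subset_ball hrτ
  have hlip : ∀ z ∈ Metric.ball (0 : tangentSpace M y) r, ‖Φ z - y‖ ≤ ε := by
    intro z hz
    have h1 := (convex_ball (0 : tangentSpace M y) (reach
      M / 8)).norm_image_sub_le_of_norm_fderiv_le (𝕜 := ℝ) (f := Φ) (C := LM)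
      (fun x hx ↦ (hsmooth.differentiableOn
        (by exact_mod_cast (by lia : β ≠ 0))).differentiableAt (Metric.isOpen_ball.mem_nhds hx))
      (fun x hx ↦ by rw [← norm_iteratedFDeriv_one]; exact hbound 1 hβ x hx)
      (hsub (Metric.mem_ball_self hr)) (hsub hz)
    rw [hΦ0, sub_zero] at h1
    rw [mem_ball_zero_iff] at hz
    exact h1.trans ((mul_le_mul_of_nonneg_left hz.le hM.LM_pos.le).trans hrε)
  set π : EuclideanSpace ℝ (Fin D) → tangentSpace M y :=
    fun x ↦ (tangentSpace M y).orthogonalProjectionOnto (x - y)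
  have hπ : LipschitzWith 1 π := by
    refine LipschitzWith.of_dist_le_mul fun a b ↦ ?_
    rw [dist_eq_norm, dist_eq_norm, NNReal.coe_one, one_mul]
    have h1 : π a - π b = (tangentSpace M y).orthogonalProjectionOnto (a - b) := by
      simp only [π]
      rw [← map_sub, sub_sub_sub_cancel_right]
    rw [h1]
    exact Submodule.norm_orthogonalProjectionOnto_apply_le _ _
  -- The chart is used only as a section of the projection; its Lipschitz bound keeps the lifted
  -- points within ε of y. No area formula is needed, since π does not increase Hausdorff measure.
  have hπ_image : J '' Metric.ball 0 r ⊆ π '' (M ∩ Metric.closedBall y ε) := by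
    rintro _ ⟨w, hw, rfl⟩
    have hJw : J w ∈ Metric.ball (0 : tangentSpace M y) r := by
      rw [mem_ball_zero_iff] at hw ⊢
      rwa [J.norm_map]
    exact ⟨Φ (J w), ⟨(hΦ _ (hsub hJw)).1.1, mem_closedBall_iff_norm.2 (hlip _ hJw)⟩,
      (hΦ _ (hsub hJw)).2⟩
  have hπ_measure : μHE[d] (π '' (M ∩ Metric.closedBall y ε)) ≤
      μHE[d] (M ∩ Metric.closedBall y ε) := by
    simp_rw [Measure.euclideanHausdorffMeasure_def, Measure.smul_apply]
    gcongr
    simpa using hπ.hausdorffMeasure_image_le (d := d) (by positivity) (M ∩ Metric.closedBall y ε)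
  calc ENNReal.ofReal ((2 * r / √d) ^ d)
      ≤ volume (Metric.ball (0 : EuclideanSpace ℝ (Fin d)) r) :=
        ofReal_pow_le_volume_ball d (by have := hM.three_le; lia) hr
    _ = μHE[d] (J '' Metric.ball 0 r) := by
        rw [J.isometry.euclideanHausdorffMeasure_image,
          EuclideanSpace.euclideanHausdorffMeasure_eq_volume]
    _ ≤ μHE[d] (π '' (M ∩ Metric.closedBall y ε)) := measure_mono hπ_image
    _ ≤ _ := hπ_measure

/-- The measure `μ` does not charge the complement of `M`. -/
lemma RegularDensity.ae_mem {d α : ℕ} {Lμ : ℝ} {p : EuclideanSpace ℝ (Fin D) → ℝ}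
    {μ : Measure (EuclideanSpace ℝ (Fin D))} (hμ : RegularDensity d α Lμ M p μ)
    (hM : IsCompact M) : ∀ᵐ x ∂μ, x ∈ M := by
  rw [hμ.density]
  exact (withDensity_absolutelyContinuous _ _).ae_le (ae_restrict_mem hM.measurableSet)

/-- Lower bound for the mass of small balls centred on the manifold. -/
lemma le_measureReal_closedBall {d α β : ℕ} {LM Lμ C : ℝ} {p : EuclideanSpace ℝ (Fin D) → ℝ}
    {μ : Measure (EuclideanSpace ℝ (Fin D))} [IsProbabilityMeasure μ]
    (hM : RegularManifold d β LM M) (hβ : 1 ≤ β) (hμ : RegularDensity d α Lμ M p μ)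
    (hC : LogComplexity d LM C M p) (hy : y ∈ M) {ε : ℝ} (hε : 0 < ε) (hε1 : ε ≤ 1) :
    Real.exp (-C) * (Real.exp (-C) * ε / (4 * √d)) ^ d ≤ μ.real (Metric.closedBall y ε) := by
  have hC1 := hC.reach_LM.trans (min_le_left _ _)
  have hC2 := hC.reach_LM.trans (min_le_right _ _)
  have hLM : LM * Real.exp (-C) ≤ 1 := by
    have := mul_le_mul_of_nonneg_left hC2 hM.LM_pos.le
    rwa [mul_inv_cancel₀ hM.LM_pos.ne'] at this
  -- This radius meets both constraints, r ≤ τ/8 and LM r ≤ ε, as e^{-C} ≤ τ, LM e^{-C} ≤ 1 and ε ≤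
  -- 1.
  have hvol := ofReal_pow_le_euclideanHausdorffMeasure hM hβ hy (r := Real.exp (-C) * ε / 8)
    (ε := ε) (by positivity) (by nlinarith [Real.exp_pos (-C)]) (by nlinarith)
  have hd : (0 : ℝ) < d := by have := hM.three_le; exact_mod_cast (by lia : 0 < d)
  have heq : 2 * (Real.exp (-C) * ε / 8) / √d = Real.exp (-C) * ε / (4 * √d) := by
    field_simp; norm_num
  rw [heq] at hvol
  rw [measureReal_def, ← ENNReal.ofReal_le_iff_le_toReal (measure_ne_top _ _),
    ENNReal.ofReal_mul (Real.exp_pos _).le]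
  calc ENNReal.ofReal (Real.exp (-C)) * ENNReal.ofReal ((Real.exp (-C) * ε / (4 * √d)) ^ d)
      ≤ ENNReal.ofReal (Real.exp (-C)) * μHE[d] (M ∩ Metric.closedBall y ε) := by gcongr
    _ = ∫⁻ _ in M ∩ Metric.closedBall y ε, ENNReal.ofReal (Real.exp (-C)) ∂μHE[d] := by
        rw [setLIntegral_const]
    _ ≤ ∫⁻ x in M ∩ Metric.closedBall y ε, ENNReal.ofReal (p x) ∂μHE[d] := by
        refine setLIntegral_mono hμ.measurable.ennreal_ofReal fun x hx ↦ ?_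
        exact ENNReal.ofReal_le_ofReal (hC.density x hx.1).1.le
    _ = μ (Metric.closedBall y ε) := by
        rw [hμ.density, withDensity_apply _ Metric.isClosed_closedBall.measurableSet,
          Measure.restrict_restrict Metric.isClosed_closedBall.measurableSet, inter_comm]

end Charts

/-! ### Joint law at two times as a Gaussian observation channel -/

section JointLaw

open Filter Topology

variable {Ω : Type*} [MeasurableSpace Ω] {P : Measure Ω}

/-- Triples of random vectors with factorizing characteristic function have product law. -/
lemma map_prodMk_eq_prod_of_integral_cexp {E : Type*} [NormedAddCommGroup E]
    [InnerProductSpace ℝ E] [FiniteDimensional ℝ E] [MeasurableSpace E] [BorelSpace E]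
    [IsProbabilityMeasure P] {X Y Z : Ω → E} (hX : Measurable X) (hY : Measurable Y)
    (hZ : Measurable Z) {μ₁ μ₂ μ₃ : Measure E} [IsProbabilityMeasure μ₁] [IsProbabilityMeasure μ₂]
    [IsProbabilityMeasure μ₃]
    (h : ∀ a b c : E, ∫ ω, Complex.exp ((inner ℝ a (X ω) + inner ℝ b (Y ω) + inner ℝ c (Z ω) : ℝ) *
        Complex.I) ∂P =
      (∫ x, Complex.exp ((inner ℝ a x : ℝ) * Complex.I) ∂μ₁) *
        ((∫ x, Complex.exp ((inner ℝ b x : ℝ) * Complex.I) ∂μ₂) *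
          ∫ x, Complex.exp ((inner ℝ c x : ℝ) * Complex.I) ∂μ₃)) :
    P.map (fun ω ↦ (X ω, Y ω, Z ω)) = μ₁.prod (μ₂.prod μ₃) := by
  have : IsProbabilityMeasure (P.map fun ω ↦ (X ω, Y ω, Z ω)) :=
    Measure.isProbabilityMeasure_map (by fun_prop)
  refine Measure.ext_of_charFunDual (funext fun L ↦ ?_)
  rw [charFunDual_prod, charFunDual_prod]
  have hL : ∀ x y z, L (x, y, z) =
      inner ℝ ((InnerProductSpace.toDual ℝ E).symm (L.comp (.inl ℝ E (E × E)))) x +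
      inner ℝ ((InnerProductSpace.toDual ℝ E).symm
        ((L.comp (.inr ℝ E (E × E))).comp (.inl ℝ E E))) y +
      inner ℝ ((InnerProductSpace.toDual ℝ E).symm
        ((L.comp (.inr ℝ E (E × E))).comp (.inr ℝ E E))) z := by
    intro x y z
    simp only [InnerProductSpace.toDual_symm_apply, ContinuousLinearMap.comp_apply,
      ContinuousLinearMap.inl_apply, ContinuousLinearMap.inr_apply]
    rw [← map_add, ← map_add]
    simp
  rw [charFunDual_apply, integral_map (by fun_prop) (Measurable.aestronglyMeasurable (by fun_prop))]
  simp only [hL]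
  rw [h]
  simp only [InnerProductSpace.toDual_symm_apply, charFunDual_apply]

variable {D : ℕ} {X : ℝ≥0 → Ω → EuclideanSpace ℝ (Fin D)}
  {μ : Measure (EuclideanSpace ℝ (Fin D))}

/-- Joint law of the initial value and of the two independent noises of the forward process. -/
lemma IsForwardProcess.map_noise_eq_prod [IsProbabilityMeasure P] [IsProbabilityMeasure μ]
    (hX : IsForwardProcess X μ P) (t γ : ℝ≥0) {l h : ℝ} (hl : 0 < l) (hh : 0 < h)
    (hl_eq : l * (Real.exp (2 * (t + γ)) - 1) = 1) (hh_eq : (l + h) * (Real.exp (2 * t) - 1) = 1) :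
    P.map (fun ω ↦ (X 0 ω, l • (Real.exp (t + γ) • X (t + γ) ω - X 0 ω),
      (l + h) • (Real.exp t • X t ω - X 0 ω) - l • (Real.exp (t + γ) • X (t + γ) ω - X 0 ω))) =
      μ.prod ((gaussianMeasure (EuclideanSpace ℝ (Fin D)) l).prod
        (gaussianMeasure (EuclideanSpace ℝ (Fin D)) h)) := by
  have := isProbabilityMeasure_gaussianMeasure (E := EuclideanSpace ℝ (Fin D)) hl
  have := isProbabilityMeasure_gaussianMeasure (E := EuclideanSpace ℝ (Fin D)) hh
  have hXm := hX.1
  refine map_prodMk_eq_prod_of_integral_cexp (hXm 0)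
    (by have := hXm (t + γ); have := hXm 0; fun_prop)
    (by have := hXm (t + γ); have := hXm 0; have := hXm t; fun_prop) fun ξ η ζ ↦ ?_
  rw [charFun_gaussianMeasure hl, charFun_gaussianMeasure hh, ← Complex.exp_add,
    ← Complex.ofReal_neg, ← Complex.ofReal_neg, ← Complex.ofReal_add]
  have hlin : ∀ ω, inner ℝ ξ (X 0 ω) +
      inner ℝ η (l • (Real.exp (t + γ) • X (t + γ) ω - X 0 ω)) +
      inner ℝ ζ ((l + h) • (Real.exp t • X t ω - X 0 ω) -
        l • (Real.exp (t + γ) • X (t + γ) ω - X 0 ω)) =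
      inner ℝ ξ (X 0 ω) + inner ℝ (l • η + h • ζ) (Real.exp t • X t ω - X 0 ω) +
      inner ℝ (l • η - l • ζ) (Real.exp (t + γ) • X (t + γ) ω - Real.exp t • X t ω) := by
    intro ω
    simp only [inner_sub_right, inner_add_left, inner_sub_left, inner_smul_left, inner_smul_right,
      conj_trivial]
    ring
  simp only [hlin]
  rw [hX.integral_cexp t γ ξ (l • η + h • ζ) (l • η - l • ζ)]
  congr 2
  rw [← Complex.ofReal_neg]
  congr 1
  -- This identity makes the coefficient of ⟨η, ζ⟩ vanish: the two noises are uncorrelated.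
  have h1 : l * (Real.exp (2 * (t + γ)) - Real.exp (2 * t)) = h * (Real.exp (2 * t) - 1) := by
    linarith
  rw [norm_add_sq_real, norm_sub_sq_real]
  simp only [norm_smul, inner_smul_left, inner_smul_right, conj_trivial, mul_pow, Real.norm_eq_abs,
    sq_abs]
  generalize inner ℝ η ζ = q
  generalize Real.exp (2 * (t + γ) : ℝ) = a at *
  generalize Real.exp (2 * t : ℝ) = b at *
  linear_combination (-l * ‖η‖ ^ 2 / 2) * hl_eq + (-h * ‖ζ‖ ^ 2 / 2) * hh_eq +
    (l * q - l * ‖ζ‖ ^ 2 / 2) * h1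

/-- Bayes' formula for two independent Gaussian observations of a random vector. -/
lemma lintegral_gaussian_channel {E : Type*} [NormedAddCommGroup E]
    [InnerProductSpace ℝ E] [FiniteDimensional ℝ E] [MeasurableSpace E] [BorelSpace E]
    {μ : Measure E} [IsProbabilityMeasure μ] {K : Set E} (hK : IsCompact K)
    (hμ : ∀ᵐ y ∂μ, y ∈ K) {l h : ℝ} (hl : 0 < l) (hh : 0 < h) {f : E → E → ℝ≥0∞}
    (hf : Measurable (Function.uncurry f)) :
    ∫⁻ y, ∫⁻ w, ∫⁻ v, f (l • y + w) (h • y + v) ∂(gaussianMeasure E h) ∂(gaussianMeasure E l) ∂μ =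
      ∫⁻ u, ∫⁻ v, ENNReal.ofReal (likelihood μ (l + h) (u + v)) * f u v
        ∂(gaussianMeasure E h) ∂(gaussianMeasure E l) := by
  have := isProbabilityMeasure_gaussianMeasure (E := E) hl
  have := isProbabilityMeasure_gaussianMeasure (E := E) hh
  have ht : Measurable fun p : (E × E) × E ↦
      ENNReal.ofReal (tilt (l + h) (p.1.2 + p.2) p.1.1) * f p.1.2 p.2 := by
    have h1 : Continuous fun p : (E × E) × E ↦ tilt (l + h) (p.1.2 + p.2) p.1.1 := by
      unfold tilt; fun_prop
    have h2 : Measurable fun p : (E × E) × E ↦ f p.1.2 p.2 :=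
      hf.comp (by fun_prop : Measurable fun p : (E × E) × E ↦ (p.1.2, p.2))
    exact h1.measurable.ennreal_ofReal.mul h2
  have h1 : ∀ y, ∫⁻ w, ∫⁻ v, f (l • y + w) (h • y + v) ∂(gaussianMeasure E h)
      ∂(gaussianMeasure E l) = ∫⁻ u, ∫⁻ v, ENNReal.ofReal (tilt (l + h) (u + v) y) * f u v
        ∂(gaussianMeasure E h) ∂(gaussianMeasure E l) := by
    intro y
    have h2 : ∀ u, ∫⁻ v, f u (h • y + v) ∂(gaussianMeasure E h) =
        ∫⁻ v, ENNReal.ofReal (tilt h v y) * f u v ∂(gaussianMeasure E h) := fun u ↦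
      lintegral_gaussianMeasure_add_smul hh y (hf.comp measurable_prodMk_left)
    simp only [h2]
    have h3 : Measurable fun p : E × E ↦ ENNReal.ofReal (tilt h p.2 y) * f p.1 p.2 := by
      have h4 : Continuous fun p : E × E ↦ tilt h p.2 y := by unfold tilt; fun_prop
      exact h4.measurable.ennreal_ofReal.mul hf
    rw [lintegral_gaussianMeasure_add_smul hl y
      (f := fun u ↦ ∫⁻ v, ENNReal.ofReal (tilt h v y) * f u v ∂(gaussianMeasure E h))
      h3.lintegral_prod_right']
    refine lintegral_congr fun u ↦ ?_
    rw [← lintegral_const_mul' _ _ ENNReal.ofReal_ne_top]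
    refine lintegral_congr fun v ↦ ?_
    rw [← tilt_mul_tilt, ENNReal.ofReal_mul (tilt_pos _ _ _).le, mul_assoc]
  have h5 : ∀ u v, ∫⁻ y, ENNReal.ofReal (tilt (l + h) (u + v) y) * f u v ∂μ =
      ENNReal.ofReal (likelihood μ (l + h) (u + v)) * f u v := by
    intro u v
    have h4 : Continuous fun y ↦ tilt (l + h) (u + v) y := by unfold tilt; fun_prop
    rw [lintegral_mul_const _ h4.measurable.ennreal_ofReal, likelihood,
      ofReal_integral_eq_lintegral_ofReal (integrable_of_continuous_of_ae_mem hK hμ h4)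
        (Eventually.of_forall fun y ↦ (tilt_pos _ _ _).le)]
  have h6 : ∀ u, ∫⁻ y, ∫⁻ v, ENNReal.ofReal (tilt (l + h) (u + v) y) * f u v
      ∂(gaussianMeasure E h) ∂μ = ∫⁻ v, ENNReal.ofReal (likelihood μ (l + h) (u + v)) * f u v
        ∂(gaussianMeasure E h) := by
    intro u
    have h9 : Continuous fun p : E × E ↦ tilt (l + h) (u + p.2) p.1 := by unfold tilt; fun_prop
    have h10 : Measurable fun p : E × E ↦ f u p.2 := hf.comp (by fun_prop : Measurable
      fun p : E × E ↦ (u, p.2))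
    have hu : Measurable (Function.uncurry fun y v ↦
        ENNReal.ofReal (tilt (l + h) (u + v) y) * f u v) := h9.measurable.ennreal_ofReal.mul h10
    rw [lintegral_lintegral_swap hu.aemeasurable]
    simp only [h5]
  simp only [h1]
  have h8 : Measurable (Function.uncurry fun y u ↦
      ∫⁻ v, ENNReal.ofReal (tilt (l + h) (u + v) y) * f u v ∂(gaussianMeasure E h)) :=
    ht.lintegral_prod_right'
  exact (lintegral_lintegral_swap h8.aemeasurable).trans (lintegral_congr h6)

/-- Joint law of the forward process at two times, relative to a product of Gaussians. -/
lemma IsForwardProcess.lintegral_comp_eq [IsProbabilityMeasure P] [IsProbabilityMeasure μ]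
    (hX : IsForwardProcess X μ P) {K : Set (EuclideanSpace ℝ (Fin D))} (hK : IsCompact K)
    (hμ : ∀ᵐ y ∂μ, y ∈ K) (t γ : ℝ≥0) {l h : ℝ} (hl : 0 < l) (hh : 0 < h)
    (hl_eq : l * (Real.exp (2 * (t + γ)) - 1) = 1) (hh_eq : (l + h) * (Real.exp (2 * t) - 1) = 1)
    {f : EuclideanSpace ℝ (Fin D) → EuclideanSpace ℝ (Fin D) → ℝ≥0∞}
    (hf : Measurable (Function.uncurry f)) :
    ∫⁻ ω, f ((l * Real.exp (t + γ)) • X (t + γ) ω) (((l + h) * Real.exp t) • X t ω) ∂P =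
      ∫⁻ u, ∫⁻ v, ENNReal.ofReal (likelihood μ (l + h) (u + v)) * f u (u + v)
        ∂(gaussianMeasure (EuclideanSpace ℝ (Fin D)) h)
        ∂(gaussianMeasure (EuclideanSpace ℝ (Fin D)) l) := by
  have := isProbabilityMeasure_gaussianMeasure (E := EuclideanSpace ℝ (Fin D)) hl
  have := isProbabilityMeasure_gaussianMeasure (E := EuclideanSpace ℝ (Fin D)) hh
  have hXm := hX.1
  have hX0 := hXm 0
  have hXt := hXm t
  have hXtγ := hXm (t + γ)
  have hg : Measurable (Function.uncurry fun u v ↦ f u (u + v)) :=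
    hf.comp (by fun_prop : Measurable fun p : EuclideanSpace ℝ (Fin D) ×
      EuclideanSpace ℝ (Fin D) ↦ (p.1, p.1 + p.2))
  have hF : Measurable fun p : EuclideanSpace ℝ (Fin D) ×
      EuclideanSpace ℝ (Fin D) × EuclideanSpace ℝ (Fin D) ↦
      f (l • p.1 + p.2.1) ((l • p.1 + p.2.1) + (h • p.1 + p.2.2)) :=
    hf.comp (by fun_prop : Measurable fun p : EuclideanSpace ℝ (Fin D) ×
      EuclideanSpace ℝ (Fin D) × EuclideanSpace ℝ (Fin D) ↦
      (l • p.1 + p.2.1, (l • p.1 + p.2.1) + (h • p.1 + p.2.2)))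
  -- The observation at time t is the sum of the two channel outputs, hence the change of variables
  -- (u, v) ↦ (u, u + v).
  rw [← lintegral_gaussian_channel hK hμ hl hh hg]
  have h1 : ∫⁻ ω, f ((l * Real.exp (t + γ)) • X (t + γ) ω) (((l + h) * Real.exp t) • X t ω) ∂P =
      ∫⁻ p, f (l • p.1 + p.2.1) ((l • p.1 + p.2.1) + (h • p.1 + p.2.2))
          ∂(μ.prod ((gaussianMeasure (EuclideanSpace ℝ (Fin D)) l).prod
          (gaussianMeasure (EuclideanSpace ℝ (Fin D)) h))) := by
    rw [← hX.map_noise_eq_prod t γ hl hh hl_eq hh_eq, lintegral_map hF (by fun_prop)]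
    refine lintegral_congr fun ω ↦ ?_
    congr 1 <;> module
  rw [h1, lintegral_prod _ hF.aemeasurable]
  refine lintegral_congr fun y ↦ ?_
  exact lintegral_prod _ (hF.comp measurable_prodMk_left).aemeasurable

end JointLaw

/-! ### Tweedie's formula and the exact error of the proxy -/

section ScoreFormula

variable {E : Type*} [NormedAddCommGroup E] [InnerProductSpace ℝ E] [MeasurableSpace E]
  [FiniteDimensional ℝ E] [BorelSpace E] {κ : Measure E} {K : Set E}

/-- Differentiation under the integral; the compact support gives a constant dominating function
near u. -/
lemma hasGradientAt_likelihood [IsFiniteMeasure κ] (hK : IsCompact K) (hκ : ∀ᵐ y ∂κ, y ∈ K)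
    (s : ℝ) (u : E) : HasGradientAt (likelihood κ s) (∫ y, tilt s u y • y ∂κ) u := by
  have hF (x : E) : Continuous fun y ↦ tilt s x y := by unfold tilt; fun_prop
  have hF' : Continuous fun y ↦ tilt s u y • innerSL ℝ y := by unfold tilt; fun_prop
  have hsmul : Continuous fun y ↦ tilt s u y • y := by unfold tilt; fun_prop
  have hK' : IsCompact (Metric.closedBall u 1 ×ˢ K) := (isCompact_closedBall u 1).prod hK
  have hcont : Continuous fun p : E × E ↦ tilt s p.1 p.2 • innerSL ℝ p.2 := by
    unfold tilt; fun_prop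
  obtain ⟨b, hb⟩ := hK'.exists_bound_of_continuousOn hcont.continuousOn
  have key := hasFDerivAt_integral_of_dominated_of_fderiv_le (μ := κ) (𝕜 := ℝ)
    (F := fun x y ↦ tilt s x y) (F' := fun x y ↦ tilt s x y • innerSL ℝ y) (x₀ := u)
    (bound := fun _ ↦ b) (Metric.ball_mem_nhds u one_pos)
    (Filter.Eventually.of_forall fun x ↦ (hF x).aestronglyMeasurable)
    (integrable_of_continuous_of_ae_mem hK hκ (hF u)) hF'.aestronglyMeasurable
    (by
      filter_upwards [hκ] with y hy x hx
      exact hb (x, y) ⟨Metric.ball_subset_closedBall hx, hy⟩)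
    (integrable_const b)
    (by
      refine Filter.Eventually.of_forall fun y x _ ↦ ?_
      have h1 : HasFDerivAt (fun x : E ↦ (inner ℝ x y : ℝ)) (innerSL ℝ y) x := by
        simp_rw [real_inner_comm y]
        exact (innerSL ℝ y).hasFDerivAt
      exact (h1.sub_const _).exp)
  rw [hasGradientAt_iff_hasFDerivAt]
  refine key.congr_fderiv (Eq.symm ?_)
  ext w
  rw [ContinuousLinearMap.integral_apply (integrable_of_continuous_of_ae_mem hK hκ hF'),
    InnerProductSpace.toDual_apply_apply, real_inner_comm,
    ← integral_inner (integrable_of_continuous_of_ae_mem hK hκ hsmul)]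
  refine integral_congr_ae (Filter.Eventually.of_forall fun y ↦ ?_)
  simp [inner_smul_right, real_inner_comm]

lemma sigma_sq {t : ℝ} (ht : 0 ≤ t) : σ t ^ 2 = 1 - Real.exp (-2 * t) :=
  Real.sq_sqrt (by rw [sub_nonneg, Real.exp_le_one_iff]; linarith)

lemma sigma_pos {t : ℝ} (ht : 0 < t) : 0 < σ t :=
  Real.sqrt_pos.2 (by rw [sub_pos, Real.exp_lt_one_iff]; linarith)

variable {D : ℕ} {μ : Measure (EuclideanSpace ℝ (Fin D))} {M : Set (EuclideanSpace ℝ (Fin D))}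

/-- Expanding the square leaves a tilt with precision c_t²/σ_t² at the rescaled observation c_t
x/σ_t². -/
lemma marginal_eq {t : ℝ} (ht : 0 < t) (x : EuclideanSpace ℝ (Fin D)) :
    marginal μ t x = Real.exp (-(2 * σ t ^ 2)⁻¹ * ‖x‖ ^ 2) *
      likelihood μ (c t ^ 2 / σ t ^ 2) ((c t / σ t ^ 2) • x) := by
  rw [marginal, likelihood, ← integral_const_mul]
  refine integral_congr_ae (Filter.Eventually.of_forall fun y ↦ ?_)
  have := (sigma_pos ht).ne'
  simp only [tilt]
  rw [← Real.exp_add, norm_sub_sq_real, inner_smul_left, inner_smul_right, norm_smul, mul_pow,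
    Real.norm_eq_abs, sq_abs, conj_trivial]
  congr 1
  field_simp
  ring

/-- Tweedie's formula. -/
lemma score_eq [IsProbabilityMeasure μ] (hM : IsCompact M) (hμ : ∀ᵐ y ∂μ, y ∈ M) {t : ℝ}
    (ht : 0 < t) (x : EuclideanSpace ℝ (Fin D)) :
    score μ t x = (c t / σ t ^ 2) •
      posteriorMean μ (c t ^ 2 / σ t ^ 2) ((c t / σ t ^ 2) • x) - (σ t ^ 2)⁻¹ • x := by
  have hσ := sigma_pos ht
  have hlog : (fun x' ↦ Real.log (marginal μ t x')) = fun x' ↦ -(2 * σ t ^ 2)⁻¹ * ‖x'‖ ^ 2 +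
      Real.log (likelihood μ (c t ^ 2 / σ t ^ 2) ((c t / σ t ^ 2) • x')) := by
    funext x'
    rw [marginal_eq ht, Real.log_mul (Real.exp_pos _).ne' (likelihood_pos hM hμ _ _).ne',
      Real.log_exp]
  refine HasGradientAt.gradient ?_
  rw [hlog, hasGradientAt_iff_hasFDerivAt]
  have h1 := (hasStrictFDerivAt_norm_sq x).hasFDerivAt.const_mul (-(2 * σ t ^ 2)⁻¹)
  have h2 := ((hasGradientAt_likelihood hM hμ (c t ^ 2 / σ t ^ 2)
    ((c t / σ t ^ 2) • x)).hasFDerivAt.comp x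
    ((hasFDerivAt_id x).const_smul (c t / σ t ^ 2))).log (likelihood_pos hM hμ _ _).ne'
  refine (h1.add h2).congr_fderiv (Eq.symm ?_)
  ext w
  simp only [posteriorMean, map_sub, map_smul, sub_apply,
    add_apply, smul_apply, ContinuousLinearMap.comp_apply,
    ContinuousLinearMap.id_apply, InnerProductSpace.toDual_apply_apply, smul_eq_mul,
    innerSL_apply_apply, Function.comp_apply, nsmul_eq_mul]
  field_simp
  push_cast
  ring

lemma c_add (t γ : ℝ) : c (t + γ) = c t * c γ := by
  rw [c, c, c, ← Real.exp_add]; congr 1; ring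

/-- The weight of the proxy turns the coefficient of the later posterior mean into c_t/σ_t², and its
correction removes all terms linear in x and x', because c_{t+γ} = c_t c_γ. -/
lemma score_sub_scoreProxy [IsProbabilityMeasure μ] (hM : IsCompact M) (hμ : ∀ᵐ y ∂μ, y ∈ M)
    {t γ : ℝ} (ht : 0 < t) (hγ : 0 < γ) (x x' : EuclideanSpace ℝ (Fin D)) :
    score μ t x - scoreProxy μ γ t x x' = (c t / σ t ^ 2) •
      (posteriorMean μ (c t ^ 2 / σ t ^ 2) ((c t / σ t ^ 2) • x) -
        posteriorMean μ (c (t + γ) ^ 2 / σ (t + γ) ^ 2)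
          ((c (t + γ) / σ (t + γ) ^ 2) • x')) := by
  have h1 := (sigma_pos ht).ne'
  have h2 := (sigma_pos (add_pos ht hγ)).ne'
  have h3 : c γ ≠ 0 := (Real.exp_pos _).ne'
  rw [scoreProxy, score_eq hM hμ ht, score_eq hM hμ (add_pos ht hγ)]
  generalize posteriorMean μ (c (t + γ) ^ 2 / σ (t + γ) ^ 2) ((c (t + γ) / σ (t + γ) ^ 2) • x') = m
  rw [c_add]
  match_scalars <;> field_simp <;> ring

end ScoreFormula

/-! ### Assembly of the error bound and numerical constants -/

section ProxyError

open Filter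

variable {D : ℕ} {M : Set (EuclideanSpace ℝ (Fin D))} {μ : Measure (EuclideanSpace ℝ (Fin D))}
  {Ω : Type*} [MeasurableSpace Ω] {P : Measure Ω} {X : ℝ≥0 → Ω → EuclideanSpace ℝ (Fin D)}

lemma c_sq (t : ℝ) : c t ^ 2 = (Real.exp (2 * t))⁻¹ := by
  rw [c, ← Real.exp_nat_mul, ← Real.exp_neg]; congr 1; push_cast; ring

lemma c_mul_exp (t : ℝ) : c t * Real.exp t = 1 := by
  rw [c, ← Real.exp_add, neg_add_cancel, Real.exp_zero]

lemma exp_mul_sigma_sq {t : ℝ} (ht : 0 ≤ t) :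
    Real.exp (2 * t) * σ t ^ 2 = Real.exp (2 * t) - 1 := by
  rw [sigma_sq ht, mul_sub, ← Real.exp_add, mul_one, neg_mul, add_neg_cancel, Real.exp_zero]

lemma exp_mul_sigma_sq_add {t γ : ℝ} (ht : 0 ≤ t) :
    Real.exp (2 * t) * (σ t ^ 2 + (Real.exp (2 * γ) - 1)) = Real.exp (2 * (t + γ)) - 1 := by
  rw [mul_add, exp_mul_sigma_sq ht, mul_sub, ← Real.exp_add, mul_one, mul_add]; ring

lemma c_sq_div_sigma_sq {t : ℝ} (ht : 0 < t) :
    c t ^ 2 / σ t ^ 2 = (Real.exp (2 * t) - 1)⁻¹ := by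
  rw [← exp_mul_sigma_sq ht.le, c_sq, mul_inv]; rfl

lemma c_div_sigma_sq {t : ℝ} (ht : 0 < t) :
    c t / σ t ^ 2 = (Real.exp (2 * t) - 1)⁻¹ * Real.exp t := by
  rw [← c_sq_div_sigma_sq ht, div_mul_eq_mul_div, sq (c t), mul_assoc, c_mul_exp, mul_one]

lemma sigma_le_one (t : ℝ) : σ t ≤ 1 := by
  rw [σ, Real.sqrt_le_one]
  linarith [Real.exp_pos (-2 * t)]

/-- The mean squared error of the proxy in terms of the small ball probabilities of `μ`. -/
lemma IsForwardProcess.lintegral_sq_score_sub_le [IsProbabilityMeasure P] [IsProbabilityMeasure μ]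
    (hX : IsForwardProcess X μ P) (hM : IsCompact M) (hμ : ∀ᵐ y ∂μ, y ∈ M)
    (hdiam : ∀ x ∈ M, ∀ y ∈ M, ‖x - y‖ ≤ 1) (t γ : ℝ≥0) (ht : 0 < t) (hγ : 0 < γ) {l h ε m : ℝ}
    (hl : l = (Real.exp (2 * (t + γ)) - 1)⁻¹) (hh : h = (Real.exp (2 * t) - 1)⁻¹ - l)
    (hl0 : 0 < l) (hh0 : 0 < h) (hm : 0 < m)
    (hball : ∀ y ∈ M, m ≤ μ.real (Metric.closedBall y ε)) :
    ∫⁻ ω, ENNReal.ofReal (‖score μ t (X t ω) - scoreProxy μ γ t (X t ω) (X (t + γ) ω)‖ ^ 2) ∂P ≤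
      ENNReal.ofReal ((c t / σ t ^ 2) ^ 2 * (h * Real.exp (3 * h / 2) *
        (256 / l ^ 2 * (2 * (2 * l * ε ^ 2 + Real.log m⁻¹) ^ 2 + 4)))) := by
  have ht' : (0 : ℝ) < t := ht
  have hγ' : (0 : ℝ) < γ := hγ
  have hlh : l + h = (Real.exp (2 * t) - 1)⁻¹ := by rw [hh]; ring
  have hl_eq : l * (Real.exp (2 * (t + γ)) - 1) = 1 :=
    by
    rw [hl, inv_mul_cancel₀ (inv_pos.1 (hl ▸ hl0)).ne']
  have hlh_eq : (l + h) * (Real.exp (2 * t) - 1) = 1 :=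
    by
    rw [hlh, inv_mul_cancel₀ (inv_pos.1 (hlh ▸ add_pos hl0 hh0)).ne']
  have hmeas : Measurable (Function.uncurry fun u w : EuclideanSpace ℝ (Fin D) ↦
      ENNReal.ofReal (‖posteriorMean μ (l + h) w - posteriorMean μ l u‖ ^ 2)) := by
    have h1 := (measurable_posteriorMean (κ := μ) (l + h)).comp
      (measurable_snd : Measurable (Prod.snd : EuclideanSpace ℝ (Fin D) × _ → _))
    have h2 := (measurable_posteriorMean (κ := μ) l).comp
      (measurable_fst : Measurable (Prod.fst : EuclideanSpace ℝ (Fin D) ×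
        EuclideanSpace ℝ (Fin D) → _))
    exact ((h1.sub h2).norm.pow_const 2).ennreal_ofReal
  have hscore : ∀ ω, ENNReal.ofReal
      (‖score μ t (X t ω) - scoreProxy μ γ t (X t ω) (X (t + γ) ω)‖ ^ 2) =
      ENNReal.ofReal ((c t / σ t ^ 2) ^ 2) * ENNReal.ofReal
        (‖posteriorMean μ (l + h) (((l + h) * Real.exp t) • X t ω) -
          posteriorMean μ l ((l * Real.exp (t + γ)) • X (t + γ) ω)‖ ^ 2) := by
    intro ω
    rw [score_sub_scoreProxy hM hμ ht' hγ', c_div_sigma_sq (add_pos ht' hγ'),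
      c_sq_div_sigma_sq (add_pos ht' hγ'), c_sq_div_sigma_sq ht', norm_smul, mul_pow,
      Real.norm_eq_abs, sq_abs, ENNReal.ofReal_mul (sq_nonneg _), ← hl, ← hlh]
    congr 6
    rw [c_div_sigma_sq ht', hlh]
  simp only [hscore]
  rw [lintegral_const_mul' _ _ ENNReal.ofReal_ne_top, ENNReal.ofReal_mul (sq_nonneg _)]
  gcongr
  rw [hX.lintegral_comp_eq hM hμ t γ hl0 hh0 hl_eq hlh_eq hmeas]
  refine le_trans (le_of_eq ?_) (lintegral_sq_posteriorMean_sub_le hM hμ hdiam hl0 hh0 hm hball)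
  refine lintegral_congr fun u ↦ lintegral_congr fun v ↦ ?_
  rw [← ENNReal.ofReal_mul (likelihood_pos hM hμ _ _).le]

/-- With x = σ_t², g = e^{2γ} - 1 and E = e^{2t}, one has l = 1/(E(x+g)) and h = g/(E x (x+g)). In
the last ratio E cancels, leaving g (x+g)/x³, and g ≤ 4γ together with g ≤ x gives 8γ/x². -/
lemma noise_scale_bound {t γ l h : ℝ} (ht : 0 < t) (hγ : 0 < γ) (hγ4 : γ < 1 / 4)
    (hl : l = (Real.exp (2 * (t + γ)) - 1)⁻¹) (hh : h = (Real.exp (2 * t) - 1)⁻¹ - l)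
    (hsmall : γ * (σ t ^ 4)⁻¹ ≤ 1 / 100) :
    0 < l ∧ 0 < h ∧ h ≤ 1 / 25 ∧ l * σ t ^ 2 ≤ 1 ∧
      (c t / σ t ^ 2) ^ 2 * h / l ^ 2 ≤ 8 * (γ * (σ t ^ 4)⁻¹) := by
  have hσ := sigma_pos ht
  have hσ1 := sigma_le_one t
  rw [← exp_mul_sigma_sq_add ht.le] at hl
  rw [← exp_mul_sigma_sq ht.le] at hh
  have hg0 : 0 < Real.exp (2 * γ) - 1 := by
    rw [sub_pos, Real.one_lt_exp_iff]; linarith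
  have hg : Real.exp (2 * γ) - 1 ≤ 4 * γ := by
    have := Real.abs_exp_sub_one_le (x := 2 * γ) (by rw [abs_of_pos (by linarith)]; linarith)
    rw [abs_of_pos hg0, abs_of_pos (by linarith)] at this
    linarith
  have hE : 1 ≤ Real.exp (2 * t) := Real.one_le_exp (by linarith)
  have hc : (c t / σ t ^ 2) ^ 2 = (Real.exp (2 * t))⁻¹ / (σ t ^ 2) ^ 2 := by
    rw [div_pow, c_sq]
  have hx4 : σ t ^ 4 = (σ t ^ 2) ^ 2 := by ring
  rw [hc, hx4]
  rw [hx4] at hsmall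
  clear hc hx4
  have hx : 0 < σ t ^ 2 := by positivity
  have hx1 : σ t ^ 2 ≤ 1 := pow_le_one₀ hσ.le hσ1
  generalize σ t ^ 2 = x at *
  generalize Real.exp (2 * γ) - 1 = g at *
  generalize Real.exp (2 * t) = E at *
  have hE0 : 0 < E := by linarith
  have hl0 : 0 < l := by rw [hl]; positivity
  have hh' : h = g / (E * x * (x + g)) := by rw [hh, hl]; field_simp; ring
  have hh0 : 0 < h := by rw [hh']; positivity
  have hgx : g ≤ x ^ 2 / 25 := by
    rw [← div_eq_mul_inv, div_le_iff₀ (by positivity)] at hsmall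
    linarith
  refine ⟨hl0, hh0, ?_, ?_, ?_⟩
  · rw [hh', div_le_iff₀ (by positivity)]
    have h1 : x ^ 2 ≤ E * x * (x + g) := by
      nlinarith [mul_pos hx hg0, mul_le_mul_of_nonneg_right hE (by positivity : 0 ≤ x * (x + g))]
    linarith
  · rw [hl, inv_mul_le_iff₀ (by positivity)]
    nlinarith [mul_pos hE0 hg0, mul_le_mul_of_nonneg_right hE hx.le]
  · have h1 : E⁻¹ / x ^ 2 * h / l ^ 2 = g * (x + g) / x ^ 3 := by rw [hh', hl]; field_simp
    have h2 : 8 * (γ * (x ^ 2)⁻¹) = 8 * γ * x / x ^ 3 := by field_simp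
    rw [h1, h2]
    gcongr ?_ / _
    have h3 : g ≤ x := by nlinarith
    nlinarith

lemma log_ball_bound {d : ℕ} {C s ℓ : ℝ} (hd : 3 ≤ d) (hC4 : 4 < C) (hCd : d < C) (hs : 0 < s)
    (hℓ : Real.log s⁻¹ ≤ ℓ / 4) :
    Real.log (Real.exp (-C) * (Real.exp (-C) * s / (4 * √d)) ^ d)⁻¹ ≤
      C + d * (3 * C + ℓ / 4) := by
  have hd' : (0 : ℝ) < d := by exact_mod_cast (by lia : 0 < d)
  have h1 : (Real.exp (-C) * (Real.exp (-C) * s / (4 * √d)) ^ d)⁻¹ =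
      Real.exp C * (Real.exp C * s⁻¹ * (4 * √d)) ^ d := by
    rw [mul_inv, ← inv_pow, Real.exp_neg, inv_inv]
    congr 2
    field_simp
  rw [h1, Real.log_mul (by positivity) (by positivity), Real.log_exp, Real.log_pow,
    Real.log_mul (by positivity) (by positivity), Real.log_mul (by positivity) (by positivity),
    Real.log_exp, Real.log_mul (by positivity) (by positivity), Real.log_sqrt hd'.le]
  have h2 : Real.log 4 ≤ 3 := by
    have := Real.log_le_sub_one_of_pos (show (0 : ℝ) < 4 by norm_num); linarith
  have h3 : Real.log d ≤ d - 1 := Real.log_le_sub_one_of_pos hd'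
  have h4 : C + Real.log s⁻¹ + (Real.log 4 + Real.log d / 2) ≤ 3 * C + ℓ / 4 := by linarith
  linarith [mul_le_mul_of_nonneg_left h4 hd'.le]

/-- L is at most d (4C + ℓ), so L² carries a factor d². Since d < C, this factor is itself at most
Q/80, which accounts for the third power of Q. -/
lemma two_mul_sq_add_le {d C ℓ L Q : ℝ} (hd : 3 ≤ d) (hC4 : 4 < C) (hCd : d < C) (hℓ : 0 ≤ ℓ)
    (hL0 : 0 ≤ L) (hL : L ≤ 2 + (C + d * (3 * C + ℓ / 4))) (hQ : 80 * d * C + 9 * ℓ ≤ Q) :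
    2 * L ^ 2 + 4 ≤ Q ^ 3 := by
  have h1 : L ≤ d * (4 * C + ℓ) := by nlinarith
  have h2 : d ^ 2 ≤ Q / 80 := by nlinarith
  have h3 : 4 * C + ℓ ≤ Q / 9 := by nlinarith
  have hQ0 : 80 ≤ Q := by nlinarith
  calc 2 * L ^ 2 + 4 ≤ 2 * (d ^ 2 * (4 * C + ℓ) ^ 2) + 4 := by rw [← mul_pow]; gcongr
    _ ≤ 2 * (Q / 80 * (Q / 9) ^ 2) + 4 := by gcongr
    _ ≤ Q ^ 3 := by nlinarith [pow_le_pow_left₀ (by norm_num) hQ0 3]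

/-- The bound on the error of the proxy in terms of the constants of the manifold. -/
lemma proxy_error_le_scoreBound {d : ℕ} {C t γ l h : ℝ} (hd : 3 ≤ d) (hC : max (d : ℝ) 4 < C)
    (ht : 0 < t) (hγ : 0 < γ) (hγ4 : γ < 1 / 4) (hsmall : scoreBound d C t γ < 1)
    (hl : l = (Real.exp (2 * (t + γ)) - 1)⁻¹) (hh : h = (Real.exp (2 * t) - 1)⁻¹ - l) :
    0 < l ∧ 0 < h ∧ (c t / σ t ^ 2) ^ 2 * (h * Real.exp (3 * h / 2) *
        (256 / l ^ 2 * (2 * (2 * l * σ t ^ 2 + Real.log (Real.exp (-C) *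
          (Real.exp (-C) * σ t / (4 * √d)) ^ d)⁻¹) ^ 2 + 4))) ≤ scoreBound d C t γ := by
  have hσ := sigma_pos ht
  have hσ1 := sigma_le_one t
  have hd' : (3 : ℝ) ≤ d := by exact_mod_cast hd
  obtain ⟨hCd, hC4⟩ := max_lt_iff.1 hC
  have hℓ : 0 < Real.log γ⁻¹ := Real.log_pos ((one_lt_inv₀ hγ).2 (by linarith))
  obtain ⟨Q, hQdef⟩ : ∃ Q, Q = 20 * d * (Real.posLog (σ (t + γ) / c (t + γ)) + 4 * C) +
    9 * Real.log γ⁻¹ := ⟨_, rfl⟩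
  have hpos : 0 ≤ Real.posLog (σ (t + γ) / c (t + γ)) := Real.posLog_nonneg
  -- The log₊ term is nonnegative and is simply dropped.
  have hQ : 80 * d * C + 9 * Real.log γ⁻¹ ≤ Q := by
    rw [hQdef]; nlinarith
  have hQ80 : 80 ≤ Q := by nlinarith
  rw [scoreBound, ← hQdef] at hsmall ⊢
  have hS : 0 < (σ t ^ 4)⁻¹ := by positivity
  have hQ3 : (80 : ℝ) ^ 3 ≤ Q ^ 3 := pow_le_pow_left₀ (by norm_num) hQ80 3
  have hγS : γ * (σ t ^ 4)⁻¹ ≤ 1 / 100 := by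
    have := mul_le_mul_of_nonneg_left hQ3 (mul_pos hγ hS).le
    nlinarith
  obtain ⟨hl0, hh0, hh1, hlσ, hscale⟩ := noise_scale_bound ht hγ hγ4 hl hh hγS
  refine ⟨hl0, hh0, ?_⟩
  -- Smallness of R forces γ ≤ σ_t⁴, so the logarithm of the radius σ_t is absorbed into log γ⁻¹.
  have hlogσ : Real.log (σ t)⁻¹ ≤ Real.log γ⁻¹ / 4 := by
    have h1 : ((σ t)⁻¹) ^ 4 ≤ γ⁻¹ := by
      rw [inv_pow, le_inv_comm₀ hS hγ, inv_inv]
      rw [← div_eq_mul_inv, div_le_iff₀ (by positivity)] at hγS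
      nlinarith [pow_pos hσ 4]
    have h2 := Real.log_le_log (by positivity) h1
    rw [Real.log_pow] at h2
    push_cast at h2
    linarith
  have hlogm := log_ball_bound hd hC4 hCd hσ hlogσ
  obtain ⟨L, hL⟩ : ∃ L, L = 2 * l * σ t ^ 2 + Real.log (Real.exp (-C) *
    (Real.exp (-C) * σ t / (4 * √d)) ^ d)⁻¹ := ⟨_, rfl⟩
  rw [← hL]
  have hlogm0 : 0 ≤ Real.log (Real.exp (-C) * (Real.exp (-C) * σ t / (4 * √d)) ^ d)⁻¹ := by
    have he : Real.exp (-C) ≤ 1 := Real.exp_le_one_iff.2 (by linarith)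
    have hsd : 1 ≤ √(d : ℝ) := Real.one_le_sqrt.2 (by linarith)
    refine Real.log_nonneg ((one_le_inv₀ (by positivity)).2 ?_)
    refine mul_le_one₀ he (by positivity) (pow_le_one₀ (by positivity) ?_)
    rw [div_le_one (by positivity)]
    have := mul_le_one₀ he hσ.le hσ1
    linarith
  have hL0 : 0 ≤ L := by rw [hL]; positivity
  have hLle : 2 * L ^ 2 + 4 ≤ Q ^ 3 :=
    two_mul_sq_add_le hd' hC4 hCd hℓ.le hL0 (by rw [hL]; linarith) hQ
  have hexp : Real.exp (3 * h / 2) ≤ 2 := by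
    have := Real.abs_exp_sub_one_le (x := 3 * h / 2)
      (by rw [abs_of_pos (by positivity)]; linarith)
    rw [abs_of_pos (show 0 < 3 * h / 2 by positivity)] at this
    linarith [(abs_le.1 this).2]
  calc (c t / σ t ^ 2) ^ 2 * (h * Real.exp (3 * h / 2) * (256 / l ^ 2 * (2 * L ^ 2 + 4)))
      = ((c t / σ t ^ 2) ^ 2 * h / l ^ 2) * Real.exp (3 * h / 2) * 256 * (2 * L ^ 2 + 4) := by
        ring
    -- The constant is 8 · 2 · 256 = 4096, below 66² = 4356.
    _ ≤ (8 * (γ * (σ t ^ 4)⁻¹)) * 2 * 256 * Q ^ 3 := by gcongr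
    _ ≤ 66 ^ 2 * γ * (σ t ^ 4)⁻¹ * Q ^ 3 := by
        have : 0 ≤ γ * (σ t ^ 4)⁻¹ * Q ^ 3 := by positivity
        linarith

end ProxyError

end ManifoldDiffusion

/-! ### The main estimate -/

theorem lemma6p1 {Ω : Type*} [MeasurableSpace Ω] (P : Measure Ω) [IsProbabilityMeasure P]
    (D d α β : ℕ) (hαβ : α + 1 ≤ β) (LM Lμ C : ℝ)
    (M : Set (EuclideanSpace ℝ (Fin D))) (p : EuclideanSpace ℝ (Fin D) → ℝ)
    (μ : Measure (EuclideanSpace ℝ (Fin D))) [IsProbabilityMeasure μ]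
    (hM : ManifoldDiffusion.RegularManifold d β LM M)
    (hμ : ManifoldDiffusion.RegularDensity d α Lμ M p μ)
    (hC : ManifoldDiffusion.LogComplexity d LM C M p)
    (hdiam : Metric.diam M ≤ 1)
    (X : ℝ≥0 → Ω → EuclideanSpace ℝ (Fin D))
    (hX : ManifoldDiffusion.IsForwardProcess X μ P)
    (t γ : ℝ≥0) (ht : 0 < t) (hγ : 0 < γ) (hγ4 : γ < 1 / 4)
    (hsmall : ManifoldDiffusion.scoreBound d C t γ < 1) :
    Integrable (fun ω => ‖ManifoldDiffusion.score μ t (X t ω)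
        - ManifoldDiffusion.scoreProxy μ γ t (X t ω) (X (t + γ) ω)‖ ^ 2) P ∧
      ∫ ω, ‖ManifoldDiffusion.score μ t (X t ω)
        - ManifoldDiffusion.scoreProxy μ γ t (X t ω) (X (t + γ) ω)‖ ^ 2 ∂P
        ≤ ManifoldDiffusion.scoreBound d C t γ := by
  have hμM : ∀ᵐ y ∂μ, y ∈ M := hμ.ae_mem hM.compact
  have hdiam' : ∀ x ∈ M, ∀ y ∈ M, ‖x - y‖ ≤ 1 := fun x hx y hy ↦ by
    rw [← dist_eq_norm]
    exact (Metric.dist_le_diam_of_mem hM.compact.isBounded hx hy).trans hdiam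
  have ht' : (0 : ℝ) < t := ht
  have hγ' : (0 : ℝ) < γ := hγ
  have hγ4' : (γ : ℝ) < 1 / 4 := by exact_mod_cast hγ4
  obtain ⟨l, hl⟩ : ∃ l, l = (Real.exp (2 * (t + γ) : ℝ) - 1)⁻¹ := ⟨_, rfl⟩
  obtain ⟨h, hh⟩ : ∃ h, h = (Real.exp (2 * t : ℝ) - 1)⁻¹ - l := ⟨_, rfl⟩
  obtain ⟨hl0, hh0, hle⟩ := ManifoldDiffusion.proxy_error_le_scoreBound hM.three_le hC.gt ht' hγ'
    hγ4' hsmall hl hh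
  have hσ := ManifoldDiffusion.sigma_pos ht'
  have hd : (0 : ℝ) < d := by have := hM.three_le; exact_mod_cast (by lia : 0 < d)
  -- Small balls are taken of radius σ_t: since l σ_t² ≤ 1, the term 2 l ε² stays at most 2.
  have hlint := (hX.lintegral_sq_score_sub_le hM.compact hμM hdiam' t γ ht hγ hl hh hl0 hh0
    (by positivity) fun y hy ↦ ManifoldDiffusion.le_measureReal_closedBall hM (by lia) hμ hC hy hσ
      (ManifoldDiffusion.sigma_le_one t)).trans (ENNReal.ofReal_le_ofReal hle)
  have hmeas : Measurable fun ω ↦ ‖ManifoldDiffusion.score μ t (X t ω)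
      - ManifoldDiffusion.scoreProxy μ γ t (X t ω) (X (t + γ) ω)‖ ^ 2 := by
    have hXt := hX.1 t
    have hXtγ := hX.1 (t + γ)
    have h1 (s : ℝ) := ManifoldDiffusion.measurable_posteriorMean (κ := μ) s
    -- Measurability is read off from posterior means rather than from the gradient defining the
    -- score.
    simp only [ManifoldDiffusion.score_sub_scoreProxy hM.compact hμM ht' hγ']
    fun_prop
  have hnonneg : 0 ≤ᵐ[P] fun ω ↦ ‖ManifoldDiffusion.score μ t (X t ω)
      - ManifoldDiffusion.scoreProxy μ γ t (X t ω) (X (t + γ) ω)‖ ^ 2 :=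
    Filter.Eventually.of_forall fun ω ↦ sq_nonneg _
  refine ⟨⟨hmeas.aestronglyMeasurable, ?_⟩, ?_⟩
  · rw [hasFiniteIntegral_iff_ofReal hnonneg]
    exact hlint.trans_lt ENNReal.ofReal_lt_top
  · rw [integral_eq_lintegral_of_nonneg_ae hnonneg hmeas.aestronglyMeasurable]
    refine ENNReal.toReal_le_of_le_ofReal (le_trans (by positivity) hle) hlint
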